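/- Let $G$ be a compact Lie group with Lie algebra $\mathfrak g$, and let $\cdot$ be an $\mathrm{Ad}$-invariant (positive definite) inner product on $\mathfrak g$, used to identify $\mathfrak g^*$ with $\mathfrak g$. Let $(e_a)$ be an orthonormal basis, $f_{abc}=e_a\cdot[e_b,e_c]$, and $\phi=\frac1{12}\sum f_{abc}\,e_a\wedge e_b\wedge e_c\in\wedge^3\mathfrak g$. Let $M$ be a $G$-manifold (smooth, finite-dimensional, with a smooth action of $G$). For $\xi\in\mathfrak g$ put $\xi_M(m)=\frac{d}{dt}|_{t=0}\exp(-t\xi).m$; extend this to a map $\wedge^\bullet\mathfrak g\to C^\infty(M;\wedge^\bullet TM)$, and for $\alpha:M\to\wedge^k\mathfrak g$ put $\alpha_M(m)=(\alpha(m))_M(m)$. Multivectors are evaluated on covectors by $(v_1\wedge\dots\wedge v_k)(\alpha_1,\dots,\alpha_k)=\det(\alpha_j(v_i))$, $P^\sharp$ is given by $\beta(P^\sharp(\alpha))=P(\alpha,\beta)$, and the Schouten bracket $[\cdot,\cdot]$ extends the Lie bracket of vector fields with $[\alpha,\beta\wedge\gamma]=[\alpha,\beta]\wedge\gamma+(-1)^{(|\alpha|-1)|\beta|}\beta\wedge[\alpha,\gamma]$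 and $[\alpha,\beta]=-(-1)^{(|\alpha|-1)(|\beta|-1)}[\beta,\alpha]$. A *Hamiltonian Poisson structure* on $M$ is a pair $(P_0,\Phi_0)$ of a smooth $G$-invariant bivector field $P_0$ with $[P_0,P_0]=0$ and a smooth map $\Phi_0:M\to\mathfrak g$ with $\Phi_0(g.m)=\mathrm{Ad}_g\Phi_0(m)$ and $P_0^\sharp(d(\Phi_0\cdot\xi))=\xi_M$ for all $\xi\in\mathfrak g$. A *Hamiltonian quasi-Poisson structure* on $M$ is a pair $(P,\Phi)$ of a smooth $G$-invariant bivector field $P$ with $[P,P]=\phi_M$ and a smooth map $\Phi:M\to G$ (the moment map) with $\Phi(g.m)=g\Phi(m)g^{-1}$ and $P^\sharp(d(f\circ\Phi))=\frac12\sum_a\big(((e_a^L+e_a^R)f)\circ\Phi\big)\,(e_a)_M$ for all $f\in C^\infty(G,\mathbb R)$, where $\xi^L,\xi^R$ are the left- and right-invariant vector fields on $G$ with value $\xi$ at the identity. Let $\mathfrak g^\natural\subset\mathfrak g$ be the set of points where $\exp:\mathfrak g\to G$ has maximal rank, and for $\xi\in\mathfrak g^\natural$ let $T(\xi)=\frac12\sum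 T_{ab}(\xi)\,e_a\wedge e_b\in\wedge^2\mathfrak g$ with $T_{ab}(\xi)=e_a\cdot\varphi(\mathrm{ad}_\xi)e_b$, where $\varphi(s)=\frac1s-\frac12\coth\frac s2$ (and $\varphi(0)=0$). (1) If $(P_0,\Phi_0)$ is a Hamiltonian Poisson structure on $M$ with $\Phi_0(M)\subset\mathfrak g^\natural$, then $(P,\Phi)$ with $P=P_0-(T\circ\Phi_0)_M$ and $\Phi=\exp\circ\Phi_0$ is a Hamiltonian quasi-Poisson structure on $M$. (2) Let $(P,\Phi)$ be a Hamiltonian quasi-Poisson structure on $M$ such that $\Phi(M)$ is contained in an open set $U\subset G$ on which $\exp$ admits a smooth inverse $\log:U\to\mathfrak g$, $\exp\circ\log=\mathrm{id}_U$. Suppose that $G$ is connected, or that $\log(gug^{-1})=\mathrm{Ad}_g\log u$ whenever $g\in G$ and $u,gug^{-1}\in U$. Then $(P_0,\Phi_0)$ with $\Phi_0=\log\circ\Phi$ and $P_0=P+(T\circ\Phi_0)_M$ is a Hamiltonian Poisson structure on $M$. -/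

import Mathlib

open scoped Manifold ContDiff

noncomputable section

namespace QuasiPoisson

/-! ### The Lie group

`G` is a Lie group modelled on the finite-dimensional real vector space `𝔤`. By Mathlib's convention
the tangent space `T₁G` (that is, `GroupLieAlgebra 𝓘(ℝ, 𝔤) G`) is the model space `𝔤` itself,
so `𝔤` is the Lie algebra of `G`. -/

section Group

variable {𝔤 : Type*} [NormedAddCommGroup 𝔤] [NormedSpace ℝ 𝔤]
  (G : Type*) [TopologicalSpace G] [ChartedSpace 𝔤 G] [Group G]

/-- The Lie bracket of the Lie algebra of `G` (bracket of left-invariant vector fields). -/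
def lieBr (ξ η : 𝔤) : 𝔤 :=
  let x : GroupLieAlgebra 𝓘(ℝ, 𝔤) G := ξ
  let y : GroupLieAlgebra 𝓘(ℝ, 𝔤) G := η
  (⁅x, y⁆ : GroupLieAlgebra 𝓘(ℝ, 𝔤) G)

variable {G}

/-- The adjoint representation: the differential at `1` of conjugation by `g`. -/
def Ad (g : G) : 𝔤 →L[ℝ] 𝔤 :=
  mfderiv 𝓘(ℝ, 𝔤) 𝓘(ℝ, 𝔤) (fun x : G => g * x * g⁻¹) 1

/-- The value at `g` of the left-invariant vector field `ξ^L`. -/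
def leftField (ξ : 𝔤) (g : G) : TangentSpace 𝓘(ℝ, 𝔤) g :=
  mulInvariantVectorField (I := 𝓘(ℝ, 𝔤)) ξ g

/-- The value at `g` of the right-invariant vector field `ξ^R`. -/
def rightField (ξ : 𝔤) (g : G) : TangentSpace 𝓘(ℝ, 𝔤) g :=
  (mfderiv 𝓘(ℝ, 𝔤) 𝓘(ℝ, 𝔤) (fun x : G => x * g) 1 : 𝔤 →L[ℝ] 𝔤) ξ

variable (G)

open Classical in
/-- The exponential map: `exp ξ = γ 1`, for the integral curve `γ : ℝ → G` of the left-invariant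
vector field `ξ^L` with `γ 0 = 1` (it exists and is unique on every Lie group; the value in the
other case is never used). -/
def lieExp (ξ : 𝔤) : G :=
  if h : ∃ γ : ℝ → G, γ 0 = 1 ∧ IsMIntegralCurve (I := 𝓘(ℝ, 𝔤)) γ (leftField ξ)
  then h.choose 1 else 1

/-- The set `𝔤^♮` of the points of `𝔤` at which the exponential map has maximal rank. -/
def expRegular : Set 𝔤 :=
  {ξ | Function.Bijective (mfderiv 𝓘(ℝ, 𝔤) 𝓘(ℝ, 𝔤) (lieExp G) ξ)}

/-- `B` is an inner product on `𝔤` that is invariant under the adjoint action of `G`. -/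
structure IsInvariantInnerProduct (B : LinearMap.BilinForm ℝ 𝔤) : Prop where
  symm : ∀ ξ η, B ξ η = B η ξ
  pos : ∀ ξ, ξ ≠ 0 → 0 < B ξ ξ
  invariant : ∀ (g : G) (ξ η : 𝔤), B (Ad g ξ) (Ad g η) = B ξ η

variable {ι : Type*} [Fintype ι] [DecidableEq ι]

/-- The structure constants `f_abc = e_a · [e_b, e_c]`. -/
def structConst (B : LinearMap.BilinForm ℝ 𝔤) (e : Module.Basis ι ℝ 𝔤) (a b c : ι) : ℝ :=
  B (e a) (lieBr G (e b) (e c))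

/-- The Cartan 3-tensor `φ = (1/12) ∑ f_abc e_a ∧ e_b ∧ e_c ∈ ∧³𝔤`, in an orthonormal basis. -/
def cartanTensor (B : LinearMap.BilinForm ℝ 𝔤) (e : Module.Basis ι ℝ 𝔤) : ⋀[ℝ]^3 𝔤 :=
  (1 / 12 : ℝ) • ∑ a, ∑ b, ∑ c,
    structConst G B e a b c • exteriorPower.ιMulti ℝ 3 ![e a, e b, e c]

/-- The meromorphic function `φ(s) = 1/s - (1/2) coth(s/2)`. At the removable singularity `s = 0`
the conventions on division by zero give the limit value `0`. -/
def phi (s : ℂ) : ℂ := 1 / s - (1 / 2) * (Complex.cosh (s / 2) / Complex.sinh (s / 2))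

/-- The matrix `(ad_ξ)_ab = e_a · [ξ, e_b]` of `ad_ξ` in an orthonormal basis, as a complex matrix.
It is real and skew-symmetric, hence normal. -/
def adMatrix (B : LinearMap.BilinForm ℝ 𝔤) (e : Module.Basis ι ℝ 𝔤) (ξ : 𝔤) :
    Matrix ι ι ℂ :=
  Matrix.of fun a b => ((B (e a) (lieBr G ξ (e b)) : ℝ) : ℂ)

open scoped Matrix.Norms.L2Operator in
/-- The entries `T_ab(ξ) = (φ(ad_ξ))_ab`, by the functional calculus of the normal matrix `ad_ξ`.
The matrix `φ(ad_ξ)` is real, because `ad_ξ` is real and `φ` commutes with conjugation. -/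
def Tcoef (B : LinearMap.BilinForm ℝ 𝔤) (e : Module.Basis ι ℝ 𝔤) (ξ : 𝔤) (a b : ι) : ℝ :=
  (cfc (p := IsStarNormal) phi (adMatrix G B e ξ) a b).re

/-- `T(ξ) = (1/2) ∑ T_ab(ξ) e_a ∧ e_b ∈ ∧²𝔤`. -/
def Ttensor (B : LinearMap.BilinForm ℝ 𝔤) (e : Module.Basis ι ℝ 𝔤) (ξ : 𝔤) : ⋀[ℝ]^2 𝔤 :=
  (1 / 2 : ℝ) • ∑ a, ∑ b, Tcoef G B e ξ a b • exteriorPower.ιMulti ℝ 2 ![e a, e b]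

end Group

/-! ### Multivector fields -/

section Multivector

variable {V : Type*} [NormedAddCommGroup V] [NormedSpace ℝ V]
  {M : Type*} [TopologicalSpace M] [ChartedSpace V M]

/-- The evaluation of a `k`-vector on `k` covectors, normalized by
`(v₁ ∧ ⋯ ∧ v_k)(α₁, …, α_k) = det (α_j (v_i))`. -/
def ev {W : Type*} [AddCommGroup W] [Module ℝ W] {k : ℕ} (Q : ⋀[ℝ]^k W)
    (α : Fin k → Module.Dual ℝ W) : ℝ :=
  exteriorPower.pairingDual ℝ W k (exteriorPower.ιMulti ℝ k α) Q

/-- The differential `(df)_m`, a covector at `m`. -/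
def diff (f : M → ℝ) (m : M) : Module.Dual ℝ (TangentSpace 𝓘(ℝ, V) m) :=
  (mfderiv 𝓘(ℝ, V) 𝓘(ℝ, ℝ) f m : TangentSpace 𝓘(ℝ, V) m →L[ℝ] ℝ).toLinearMap

variable (V M) in
/-- (Not necessarily smooth) sections of `∧^k TM`. -/
abbrev MultivectorField (k : ℕ) : Type _ := (m : M) → ⋀[ℝ]^k (TangentSpace 𝓘(ℝ, V) m)

/-- The bracket `{f, g} = P(df, dg)`. -/
def bracket (P : MultivectorField V M 2) (f g : M → ℝ) (m : M) : ℝ :=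
  ev (P m) ![diff f m, diff g m]

/-- A bivector field is smooth if `P(df, dg)` is smooth for all smooth functions `f`, `g`. -/
def IsSmoothBivector (P : MultivectorField V M 2) : Prop :=
  ∀ f g : M → ℝ, ContMDiff 𝓘(ℝ, V) 𝓘(ℝ, ℝ) ∞ f → ContMDiff 𝓘(ℝ, V) 𝓘(ℝ, ℝ) ∞ g →
    ContMDiff 𝓘(ℝ, V) 𝓘(ℝ, ℝ) ∞ (bracket P f g)

/-- The trivector field `S` is the Schouten bracket `[P, Q]` of the bivector fields `P` and `Q`:
it is the trivector field with
`[P, Q](df, dg, dh) = ∑_cycl ({h, {f, g}_P}_Q + {h, {f, g}_Q}_P)` for all smooth `f`, `g`, `h`.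
In the normalization of `ev`, this is the bracket that extends the Lie bracket of vector fields by
`[α, β ∧ γ] = [α, β] ∧ γ + (-1)^((|α|-1)|β|) β ∧ [α, γ]` and
`[α, β] = -(-1)^((|α|-1)(|β|-1)) [β, α]`; on decomposable bivector fields,
`[X₁ ∧ X₂, Y₁ ∧ Y₂] = ∑ (-1)^(i+j) [X_i, Y_j] ∧ X_i' ∧ Y_j'`, where `i'` is the other index. -/
def IsSchoutenBracket (P Q : MultivectorField V M 2) (S : MultivectorField V M 3) : Prop :=
  ∀ f g h : M → ℝ, ContMDiff 𝓘(ℝ, V) 𝓘(ℝ, ℝ) ∞ f → ContMDiff 𝓘(ℝ, V) 𝓘(ℝ, ℝ) ∞ g →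
    ContMDiff 𝓘(ℝ, V) 𝓘(ℝ, ℝ) ∞ h → ∀ m : M,
      ev (S m) ![diff f m, diff g m, diff h m] =
        (bracket Q h (bracket P f g) m + bracket P h (bracket Q f g) m) +
        (bracket Q f (bracket P g h) m + bracket P f (bracket Q g h) m) +
        (bracket Q g (bracket P h f) m + bracket P g (bracket Q h f) m)

end Multivector

/-! ### Actions and moment maps -/

section Action

variable {𝔤 : Type*} [NormedAddCommGroup 𝔤] [NormedSpace ℝ 𝔤]
  (G : Type*) [TopologicalSpace G] [ChartedSpace 𝔤 G] [Group G]
  {V : Type*} [NormedAddCommGroup V] [NormedSpace ℝ V]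
  {M : Type*} [TopologicalSpace M] [ChartedSpace V M] [MulAction G M]
  {ι : Type*} [Fintype ι] [DecidableEq ι]

/-- The infinitesimal action `ξ ↦ ξ_M(m) = d/dt|_{t=0} exp(-tξ).m`, that is, minus the differential
at `1` of the orbit map `g ↦ g.m`, applied to `ξ`. -/
def genField (m : M) : 𝔤 →ₗ[ℝ] TangentSpace 𝓘(ℝ, V) m :=
  (-(mfderiv 𝓘(ℝ, 𝔤) 𝓘(ℝ, V) (fun g : G => g • m) 1 : 𝔤 →L[ℝ] V)).toLinearMap

/-- The multivector field `α_M(m) = (α(m))_M(m)` of a function `α : M → ∧^k 𝔤`. -/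
def genMulti {k : ℕ} (α : M → ⋀[ℝ]^k 𝔤) : MultivectorField V M k :=
  fun m => exteriorPower.map k (genField G m) (α m)

/-- Invariance of a multivector field: `g_* P = P` for all `g ∈ G`. -/
def IsInvariant {k : ℕ} (P : MultivectorField V M k) : Prop :=
  ∀ (g : G) (m : M),
    exteriorPower.map k
      (mfderiv 𝓘(ℝ, V) 𝓘(ℝ, V) (fun x : M => g • x) m).toLinearMap (P m) = P (g • m)

/-- `(M, P, Φ)` is a Hamiltonian Poisson `G`-manifold, where `𝔤*` is identified with `𝔤` by `B`:
`P` is a smooth invariant bivector field with `[P, P] = 0`, and `Φ : M → 𝔤` is smooth and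
equivariant with `P♯(d(Φ · ξ)) = ξ_M`, where `P♯(α)(β) = P(α, β)`. -/
structure IsHamiltonianPoisson (B : LinearMap.BilinForm ℝ 𝔤) (P : MultivectorField V M 2)
    (Φ : M → 𝔤) : Prop where
  smooth : IsSmoothBivector P
  invariant : IsInvariant G P
  poisson : IsSchoutenBracket P P (fun _ => 0)
  smooth_moment : ContMDiff 𝓘(ℝ, V) 𝓘(ℝ, 𝔤) ∞ Φ
  equivariant : ∀ (g : G) (m : M), Φ (g • m) = Ad g (Φ m)
  moment : ∀ (ξ : 𝔤) (m : M) (β : Module.Dual ℝ (TangentSpace 𝓘(ℝ, V) m)),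
    ev (P m) ![diff (fun x => B (Φ x) ξ) m, β] = β (genField G m ξ)

/-- `(M, P, Φ)` is a Hamiltonian quasi-Poisson `G`-manifold, for the inner product `B` with
orthonormal basis `e`: `P` is a smooth invariant bivector field with `[P, P] = φ_M`, and `Φ : M → G`
is smooth and `Ad`-equivariant with `P♯(d(Φ^*f)) = (1/2) ∑ Φ^*((e_a^L + e_a^R) f) (e_a)_M` for all
smooth functions `f` on `G`. -/
structure IsHamiltonianQuasiPoisson (B : LinearMap.BilinForm ℝ 𝔤) (e : Module.Basis ι ℝ 𝔤)
    (P : MultivectorField V M 2) (Φ : M → G) : Prop where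
  smooth : IsSmoothBivector P
  invariant : IsInvariant G P
  quasiPoisson : IsSchoutenBracket P P (genMulti G (fun _ => cartanTensor G B e))
  smooth_moment : ContMDiff 𝓘(ℝ, V) 𝓘(ℝ, 𝔤) ∞ Φ
  equivariant : ∀ (g : G) (m : M), Φ (g • m) = g * Φ m * g⁻¹
  moment : ∀ f : G → ℝ, ContMDiff 𝓘(ℝ, 𝔤) 𝓘(ℝ, ℝ) ∞ f →
    ∀ (m : M) (β : Module.Dual ℝ (TangentSpace 𝓘(ℝ, V) m)),
      ev (P m) ![diff (fun x => f (Φ x)) m, β] =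
        ∑ a, (1 / 2 : ℝ) * (diff f (Φ m) (leftField (e a) (Φ m) + rightField (e a) (Φ m))) *
          β (genField G m (e a))

end Action

end QuasiPoisson

end

open scoped Manifold ContDiff

noncomputable section

set_option linter.unusedSectionVars false

/-! Write r(ξ) = φ(ad ξ), so that T(ξ) has the coefficients e_a · r(ξ) e_b. Everything that is not
formal comes down to this operator.

Moment maps. Let μ be the 𝔤-valued moment map. Contracting P₀ with L ∘ dμ gives ∑ L(e_a)(e_a)_M, and
equivariance, in the form dμ(ξ_M) = [μ, ξ], shows that (T ∘ μ)_M contributes ∑ L(ad_μ r(μ)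
e_a)(e_a)_M. The twisted bivector P₀ - (T ∘ μ)_M thus yields ∑ L((1 - ad_μ r(μ)) e_a)(e_a)_M. The
differential of exp at ξ is S₁(ad ξ) followed by right translation, where S₁(s) = (eˢ - 1)/s, and (1
- s φ(s)) S₁(s) = (eˢ + 1)/2. Since e^{ad ξ} = Ad(exp ξ) converts right translates into left ones,
this is the quasi-Poisson moment condition (`hasMFDerivAt_lieExp`, `one_sub_phiAd_mul_expTail`,
`leftVec_add_rightVec_lieExp`).

Jacobi identity. In the cyclic sum of {h, {f, g}} for the twisted bivector, the moment condition and
the invariance of P₀ remove every mixed term. What remains is the classical dynamical Yang-Baxter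
expression in r, contracted with the derivatives of f, g, h along the generating fields. By
`dynamical_yang_baxter` it equals f_abc / 4, which gives `jacobiator_sub_Ttensor`. As [P, P] is
twice the Jacobiator and φ_M has the coefficients f_abc / 2, twisting turns 0 into φ_M and
untwisting turns φ_M into 0.

Yang-Baxter equation. The matrix of ad ξ is skew-Hermitian, so trilinear identities may be tested on
its complex eigenvectors u, v, w, with eigenvalues α, β, γ. Invariance makes u · [v, w] vanish
unless α + β + γ = 0. If γ ≠ 0, the direction w is tangent to the adjoint orbit, and equivariance of
r gives the derivative the coefficient (φ(α) + φ(β))/γ. If γ = 0, the direction commutes with ξ and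
the coefficient is -φ'(α). The equation becomes the scalar identity `derivCoeff_relation`, a form of
the addition theorem for coth.

Smoothness. A point ξ is regular exactly when S₁(ad ξ) is invertible, and there φ = S₂/S₁ - 1/2 with
S₂(s) = (eˢ - 1 - s)/s². Hence `phiAd` is smooth and equivariant on the regular set. It agrees with
the functional calculus that defines T, because both act by φ(β) on eigenvectors.

Logarithms. A smooth right inverse of exp takes regular values. When G is connected, `log ∘ Φ` is
equivariant by a clopen argument based on local injectivity of exp. The identity P = P₀ - (T ∘ Φ₀)_M
then lets the same Jacobiator formula be read backwards. -/

namespace QuasiPoisson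

/-! ### Differentials of maps of manifolds -/

section Calculus
variable {E E₃ E'' : Type*} [NormedAddCommGroup E] [NormedSpace ℝ E]
  [NormedAddCommGroup E₃] [NormedSpace ℝ E₃] [NormedAddCommGroup E''] [NormedSpace ℝ E'']
  {N N' N'' : Type*} [TopologicalSpace N] [ChartedSpace E N]
  [TopologicalSpace N'] [ChartedSpace E₃ N'] [TopologicalSpace N''] [ChartedSpace E'' N'']

variable (E E₃) in
/-- The differential of a map of manifolds at a point, as a map of the model spaces. -/
def tder (F : N → N') (p : N) : E →L[ℝ] E₃ := mfderiv 𝓘(ℝ, E) 𝓘(ℝ, E₃) F p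

lemma tder_comp {F : N' → N''} {f : N → N'} {p : N}
    (hF : MDifferentiableAt 𝓘(ℝ, E₃) 𝓘(ℝ, E'') F (f p))
    (hf : MDifferentiableAt 𝓘(ℝ, E) 𝓘(ℝ, E₃) f p) :
    tder E E'' (fun x => F (f x)) p = (tder E₃ E'' F (f p)).comp (tder E E₃ f p) :=
  mfderiv_comp p hF hf

lemma tder_comp_apply {F : N' → N''} {f : N → N'} {p : N}
    (hF : MDifferentiableAt 𝓘(ℝ, E₃) 𝓘(ℝ, E'') F (f p))
    (hf : MDifferentiableAt 𝓘(ℝ, E) 𝓘(ℝ, E₃) f p) (v : E) :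
    tder E E'' (fun x => F (f x)) p v = tder E₃ E'' F (f p) (tder E E₃ f p v) := by
  rw [tder_comp hF hf]; rfl

lemma tder_id (p : N) : tder E E (fun x : N => x) p = ContinuousLinearMap.id ℝ E :=
  mfderiv_id

lemma tder_const (c : N') (p : N) : tder E E₃ (fun _ : N => c) p = 0 :=
  mfderiv_const

lemma tder_eq_fderiv_chart {F : N → E₃} {p : N}
    (hF : MDifferentiableAt 𝓘(ℝ, E) 𝓘(ℝ, E₃) F p) :
    tder E E₃ F p =
      fderiv ℝ (fun y => F ((extChartAt 𝓘(ℝ, E) p).symm y)) (extChartAt 𝓘(ℝ, E) p p) := by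
  have h : HasFDerivWithinAt (𝕜 := ℝ) (E := E) (F := E₃)
      (fun y => F ((extChartAt 𝓘(ℝ, E) p).symm y)) (tder E E₃ F p) (Set.range 𝓘(ℝ, E))
      (extChartAt 𝓘(ℝ, E) p p) := hF.hasMFDerivAt.2
  exact (h.hasFDerivAt (by simp)).fderiv.symm

lemma tder_eq_fderiv (F : E → E₃) (p : E) : tder E E₃ F p = fderiv ℝ F p :=
  mfderiv_eq_fderiv

end Calculus
-- Partial differentials on a product of manifolds
section Swap
variable {E₁ E₂ E₃ : Type*} [NormedAddCommGroup E₁] [NormedSpace ℝ E₁]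
  [NormedAddCommGroup E₂] [NormedSpace ℝ E₂] [NormedAddCommGroup E₃] [NormedSpace ℝ E₃]
  {N₁ N₂ : Type*} [TopologicalSpace N₁] [ChartedSpace E₁ N₁] [IsManifold 𝓘(ℝ, E₁) ∞ N₁]
  [TopologicalSpace N₂] [ChartedSpace E₂ N₂] [IsManifold 𝓘(ℝ, E₂) ∞ N₂]

lemma contMDiffAt_of_contDiffAt_chart {F : N₁ → E₃} {p : N₁}
    (h : ContDiffAt ℝ ∞ (fun y => F ((extChartAt 𝓘(ℝ, E₁) p).symm y)) (extChartAt 𝓘(ℝ, E₁) p p)) :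
    ContMDiffAt 𝓘(ℝ, E₁) 𝓘(ℝ, E₃) ∞ F p := by
  have h1 := h.contMDiffAt.comp p (contMDiffAt_extChartAt (I := 𝓘(ℝ, E₁)) (x := p) (n := ∞))
  refine h1.congr_of_eventuallyEq ?_
  filter_upwards [extChartAt_source_mem_nhds (I := 𝓘(ℝ, E₁)) p] with x hx
  rw [Function.comp_apply, (extChartAt 𝓘(ℝ, E₁) p).left_inv hx]

lemma contMDiffAt_extChartAt_symm_self (p : N₁) :
    ContMDiffAt 𝓘(ℝ, E₁) 𝓘(ℝ, E₁) ∞ (extChartAt 𝓘(ℝ, E₁) p).symm (extChartAt 𝓘(ℝ, E₁) p p) :=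
  (contMDiffOn_extChartAt_symm p).contMDiffAt (extChartAt_target_mem_nhds p)

lemma contDiffAt_chart_prod {H : N₁ × N₂ → E₃}
    (hH : ContMDiff (𝓘(ℝ, E₁).prod 𝓘(ℝ, E₂)) 𝓘(ℝ, E₃) ∞ H) (p : N₁) (q : N₂) :
    ContDiffAt ℝ ∞ (fun z : E₁ × E₂ => H ((extChartAt 𝓘(ℝ, E₁) p).symm z.1,
      (extChartAt 𝓘(ℝ, E₂) q).symm z.2)) (extChartAt 𝓘(ℝ, E₁) p p, extChartAt 𝓘(ℝ, E₂) q q) := by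
  refine ContMDiffAt.contDiffAt ?_
  have h1 := (contMDiffAt_extChartAt_symm_self (E₁ := E₁) p).comp
    (extChartAt 𝓘(ℝ, E₁) p p, extChartAt 𝓘(ℝ, E₂) q q)
    ((contDiff_fst (𝕜 := ℝ) (E := E₁) (F := E₂)).contMDiff.contMDiffAt)
  have h2 := (contMDiffAt_extChartAt_symm_self (E₁ := E₂) q).comp
    (extChartAt 𝓘(ℝ, E₁) p p, extChartAt 𝓘(ℝ, E₂) q q)
    ((contDiff_snd (𝕜 := ℝ) (E := E₁) (F := E₂)).contMDiff.contMDiffAt)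
  exact (hH _).comp _ (h1.prodMk h2)

lemma contDiffAt_chart {F : N₁ → E₃} (hF : ContMDiff 𝓘(ℝ, E₁) 𝓘(ℝ, E₃) ∞ F) (p : N₁) :
    ContDiffAt ℝ ∞ (fun y => F ((extChartAt 𝓘(ℝ, E₁) p).symm y)) (extChartAt 𝓘(ℝ, E₁) p p) := by
  have h := (contMDiffAt_iff.1 (hF p)).2
  simp only [mfld_simps, contDiffWithinAt_univ] at h
  exact h

lemma ContMDiff.slice_left {H : N₁ × N₂ → E₃}
    (hH : ContMDiff (𝓘(ℝ, E₁).prod 𝓘(ℝ, E₂)) 𝓘(ℝ, E₃) ∞ H) (q : N₂) :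
    ContMDiff 𝓘(ℝ, E₁) 𝓘(ℝ, E₃) ∞ (fun x => H (x, q)) :=
  hH.comp (contMDiff_id.prodMk contMDiff_const)

lemma ContMDiff.slice_right {H : N₁ × N₂ → E₃}
    (hH : ContMDiff (𝓘(ℝ, E₁).prod 𝓘(ℝ, E₂)) 𝓘(ℝ, E₃) ∞ H) (p : N₁) :
    ContMDiff 𝓘(ℝ, E₂) 𝓘(ℝ, E₃) ∞ (fun y => H (p, y)) :=
  hH.comp (contMDiff_const.prodMk contMDiff_id)

/-- The partial differential of a smooth function on a product is smooth in the other variable. -/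
lemma contMDiff_tder_left {H : N₁ × N₂ → E₃}
    (hH : ContMDiff (𝓘(ℝ, E₁).prod 𝓘(ℝ, E₂)) 𝓘(ℝ, E₃) ∞ H) (p : N₁) :
    ContMDiff 𝓘(ℝ, E₂) 𝓘(ℝ, E₁ →L[ℝ] E₃) ∞ (fun y => tder E₁ E₃ (fun x => H (x, y)) p) := by
  intro y₀
  apply contMDiffAt_of_contDiffAt_chart
  have h := contDiffAt_chart_prod hH p y₀
  have h2 := ContDiffAt.fderiv (n := ∞) (m := ∞)
    (f := fun (b : E₂) (a : E₁) => H ((extChartAt 𝓘(ℝ, E₁) p).symm a,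
      (extChartAt 𝓘(ℝ, E₂) y₀).symm b)) (g := fun _ => extChartAt 𝓘(ℝ, E₁) p p)
    (x₀ := extChartAt 𝓘(ℝ, E₂) y₀ y₀)
    (ContDiffAt.comp (f := fun z : E₂ × E₁ => (z.2, z.1))
      (extChartAt 𝓘(ℝ, E₂) y₀ y₀, extChartAt 𝓘(ℝ, E₁) p p) h
      (contDiff_snd.prodMk contDiff_fst).contDiffAt) contDiffAt_const (by simp)
  refine h2.congr_of_eventuallyEq (Filter.Eventually.of_forall fun y => ?_)
  exact tder_eq_fderiv_chart ((ContMDiff.slice_left hH _).mdifferentiable (by simp) p)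

lemma ContMDiff.prod_swap {H : N₁ × N₂ → E₃}
    (hH : ContMDiff (𝓘(ℝ, E₁).prod 𝓘(ℝ, E₂)) 𝓘(ℝ, E₃) ∞ H) :
    ContMDiff (𝓘(ℝ, E₂).prod 𝓘(ℝ, E₁)) 𝓘(ℝ, E₃) ∞ (fun z : N₂ × N₁ => H (z.2, z.1)) :=
  hH.comp (contMDiff_snd.prodMk contMDiff_fst)

lemma contMDiff_tder_right {H : N₁ × N₂ → E₃}
    (hH : ContMDiff (𝓘(ℝ, E₁).prod 𝓘(ℝ, E₂)) 𝓘(ℝ, E₃) ∞ H) (q : N₂) :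
    ContMDiff 𝓘(ℝ, E₁) 𝓘(ℝ, E₂ →L[ℝ] E₃) ∞ (fun x => tder E₂ E₃ (fun y => H (x, y)) q) :=
  contMDiff_tder_left (ContMDiff.prod_swap hH) q

lemma ContMDiff.clm_eval {F : N₁ → E₂ →L[ℝ] E₃}
    (hF : ContMDiff 𝓘(ℝ, E₁) 𝓘(ℝ, E₂ →L[ℝ] E₃) ∞ F) (v : E₂) :
    ContMDiff 𝓘(ℝ, E₁) 𝓘(ℝ, E₃) ∞ (fun x => F x v) :=
  hF.clm_apply contMDiff_const

/-- Partial derivatives of a smooth function on a product of manifolds commute. -/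
lemma tder_tder_swap {H : N₁ × N₂ → E₃}
    (hH : ContMDiff (𝓘(ℝ, E₁).prod 𝓘(ℝ, E₂)) 𝓘(ℝ, E₃) ∞ H) (p : N₁) (q : N₂) (u : E₁) (v : E₂) :
    tder E₁ E₃ (fun x => tder E₂ E₃ (fun y => H (x, y)) q v) p u =
      tder E₂ E₃ (fun y => tder E₁ E₃ (fun x => H (x, y)) p u) q v := by
  have hdiff := contDiffAt_chart_prod hH p q
  set a₀ := extChartAt 𝓘(ℝ, E₁) p p
  set b₀ := extChartAt 𝓘(ℝ, E₂) q q
  set K : E₁ × E₂ → E₃ := fun z => H ((extChartAt 𝓘(ℝ, E₁) p).symm z.1,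
      (extChartAt 𝓘(ℝ, E₂) q).symm z.2) with hK
  have hev : ∀ᶠ z in nhds (a₀, b₀), DifferentiableAt ℝ K z :=
    ((hdiff.of_le (m := 1) (by simp)).eventually (by simp)).mono
      fun z hz => hz.differentiableAt (by simp)
  have hK2 : DifferentiableAt ℝ (fderiv ℝ K) (a₀, b₀) :=
    (hdiff.fderiv_right (m := 1) (by rw [one_add_one_eq_two]; exact ENat.LEInfty.out)).differentiableAt (by simp)
  have hsymm := hdiff.isSymmSndFDerivAt (by rw [minSmoothness_of_isRCLikeNormedField]; exact ENat.LEInfty.out)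
  have key1 : tder E₁ E₃ (fun x => tder E₂ E₃ (fun y => H (x, y)) q v) p u =
      fderiv ℝ (fderiv ℝ K) (a₀, b₀) (u, 0) (0, v) := by
    rw [tder_eq_fderiv_chart (((ContMDiff.clm_eval (contMDiff_tder_right hH q) v).mdifferentiable
      (by simp)) p)]
    -- The inner differential has to be identified on a whole neighbourhood of the base point,
    -- because it is differentiated once more.
    have : (fun a => tder E₂ E₃ (fun y => H ((extChartAt 𝓘(ℝ, E₁) p).symm a, y)) q v)
        =ᶠ[nhds a₀] fun a => fderiv ℝ K (a, b₀) (0, v) := by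
      have ht : Filter.Tendsto (fun a : E₁ => (a, b₀)) (nhds a₀) (nhds (a₀, b₀)) :=
        (Continuous.prodMk_left b₀).tendsto a₀
      filter_upwards [ht.eventually hev] with a ha
      rw [tder_eq_fderiv_chart ((ContMDiff.slice_right hH _).mdifferentiable (by simp) q)]
      have h1 : HasFDerivAt (fun b : E₂ => K (a, b))
          ((fderiv ℝ K (a, b₀)).comp (ContinuousLinearMap.inr ℝ E₁ E₂)) b₀ :=
        HasFDerivAt.comp (f := fun b => (a, b)) b₀ ha.hasFDerivAt (hasFDerivAt_prodMk_right a b₀)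
      rw [show fderiv ℝ (fun y => H ((extChartAt 𝓘(ℝ, E₁) p).symm a,
        (extChartAt 𝓘(ℝ, E₂) q).symm y)) b₀ = _ from h1.fderiv]
      simp
    rw [this.fderiv_eq]
    have h2 : HasFDerivAt (fun a : E₁ => fderiv ℝ K (a, b₀))
        ((fderiv ℝ (fderiv ℝ K) (a₀, b₀)).comp (ContinuousLinearMap.inl ℝ E₁ E₂)) a₀ :=
      HasFDerivAt.comp (f := fun a => (a, b₀)) a₀ hK2.hasFDerivAt (hasFDerivAt_prodMk_left a₀ b₀)
    rw [(h2.clm_apply (hasFDerivAt_const (0, v) a₀)).fderiv]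
    simp
  have key2 : tder E₂ E₃ (fun y => tder E₁ E₃ (fun x => H (x, y)) p u) q v =
      fderiv ℝ (fderiv ℝ K) (a₀, b₀) (0, v) (u, 0) := by
    rw [tder_eq_fderiv_chart (((ContMDiff.clm_eval (contMDiff_tder_left hH p) u).mdifferentiable
      (by simp)) q)]
    have : (fun b => tder E₁ E₃ (fun x => H (x, (extChartAt 𝓘(ℝ, E₂) q).symm b)) p u)
        =ᶠ[nhds b₀] fun b => fderiv ℝ K (a₀, b) (u, 0) := by
      have ht : Filter.Tendsto (fun b : E₂ => (a₀, b)) (nhds b₀) (nhds (a₀, b₀)) :=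
        (Continuous.prodMk_right a₀).tendsto b₀
      filter_upwards [ht.eventually hev] with b hb
      rw [tder_eq_fderiv_chart ((ContMDiff.slice_left hH _).mdifferentiable (by simp) p)]
      have h1 : HasFDerivAt (fun a : E₁ => K (a, b))
          ((fderiv ℝ K (a₀, b)).comp (ContinuousLinearMap.inl ℝ E₁ E₂)) a₀ :=
        HasFDerivAt.comp (f := fun a => (a, b)) a₀ hb.hasFDerivAt (hasFDerivAt_prodMk_left a₀ b)
      rw [show fderiv ℝ (fun y => H ((extChartAt 𝓘(ℝ, E₁) p).symm y,
        (extChartAt 𝓘(ℝ, E₂) q).symm b)) a₀ = _ from h1.fderiv]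
      simp
    rw [this.fderiv_eq]
    have h2 : HasFDerivAt (fun b : E₂ => fderiv ℝ K (a₀, b))
        ((fderiv ℝ (fderiv ℝ K) (a₀, b₀)).comp (ContinuousLinearMap.inr ℝ E₁ E₂)) b₀ :=
      HasFDerivAt.comp (f := fun b => (a₀, b)) b₀ hK2.hasFDerivAt (hasFDerivAt_prodMk_right a₀ b₀)
    rw [(h2.clm_apply (hasFDerivAt_const (u, 0) b₀)).fderiv]
    simp
  rw [key1, key2, hsymm.eq]
end Swap

/-! ### The Lie bracket of vector fields as a commutator of derivations -/

section LieBracket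
variable {E E₃ : Type*} [NormedAddCommGroup E] [NormedSpace ℝ E]
  [NormedAddCommGroup E₃] [NormedSpace ℝ E₃]
  {N : Type*} [TopologicalSpace N] [ChartedSpace E N] [IsManifold 𝓘(ℝ, E) ∞ N]

/-- The tangent space at `p` is identified with the model space through the preferred chart at `p`,
so that chart has trivial differential there. -/
lemma tder_extChartAt_self (p : N) :
    tder E E (extChartAt 𝓘(ℝ, E) p) p = ContinuousLinearMap.id ℝ E := by
  rw [tder_eq_fderiv_chart (mdifferentiableAt_extChartAt (mem_chart_source _ _))]
  have : (fun y => extChartAt 𝓘(ℝ, E) p ((extChartAt 𝓘(ℝ, E) p).symm y))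
      =ᶠ[nhds (extChartAt 𝓘(ℝ, E) p p)] id := by
    filter_upwards [extChartAt_target_mem_nhds (I := 𝓘(ℝ, E)) p] with y hy
    exact (extChartAt 𝓘(ℝ, E) p).right_inv hy
  rw [this.fderiv_eq, fderiv_id]

lemma tder_congr {F F' : N → E₃} {p : N} (h : F =ᶠ[nhds p] F') : tder E E₃ F p = tder E E₃ F' p :=
  h.mfderiv_eq

/-- Every linear map of the tangent space at a point is the differential of a globally defined
smooth function. -/
lemma exists_contMDiff_tder_eq [FiniteDimensional ℝ E] [T2Space N] (p : N) (L : E →L[ℝ] E₃) :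
    ∃ F : N → E₃, ContMDiff 𝓘(ℝ, E) 𝓘(ℝ, E₃) ∞ F ∧ tder E E₃ F p = L := by
  obtain ⟨χ⟩ := (inferInstance : Nonempty (SmoothBumpFunction 𝓘(ℝ, E) p))
  refine ⟨fun x => χ x • L (extChartAt 𝓘(ℝ, E) p x), ?_, ?_⟩
  · refine χ.contMDiff_smul (g := fun x => L (extChartAt 𝓘(ℝ, E) p x)) ?_
    exact L.contMDiff.comp_contMDiffOn (contMDiffOn_extChartAt)
  · have : (fun x => χ x • L (extChartAt 𝓘(ℝ, E) p x)) =ᶠ[nhds p]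
        fun x => L (extChartAt 𝓘(ℝ, E) p x) := by
      filter_upwards [χ.eventuallyEq_one] with x hx
      simp [hx]
    rw [tder_congr this, tder_comp L.mdifferentiableAt
      (mdifferentiableAt_extChartAt (mem_chart_source _ _)), tder_extChartAt_self, tder_eq_fderiv]
    simp

/-- The Lie bracket of vector fields, given by functions with values in the model space. -/
def fieldBracket (X Y : N → E) (p : N) : E :=
  VectorField.mlieBracket 𝓘(ℝ, E) (M := N) X Y p

/-- Differentiability of a vector field given by a function with values in the model space. -/
def IsDiffField (X : N → E) (p : N) : Prop :=
  MDifferentiableAt 𝓘(ℝ, E) 𝓘(ℝ, E).tangent (fun x => (⟨x, X x⟩ : TangentBundle 𝓘(ℝ, E) N)) p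

/-- The expression of a vector field in the chart at `p`. -/
def chartField (X : N → E) (p : N) : E → E :=
  VectorField.mpullbackWithin 𝓘(ℝ, E) 𝓘(ℝ, E) (M' := N) (extChartAt 𝓘(ℝ, E) p).symm X
    (Set.range 𝓘(ℝ, E))

lemma inverse_of_eq_id {L : E →L[ℝ] E} (h : L = ContinuousLinearMap.id ℝ E) (v : E) :
    L.inverse v = v := by
  subst h; simp

lemma fieldBracket_eq_chart (X Y : N → E) (p : N) :
    fieldBracket X Y p = fderiv ℝ (chartField Y p) (extChartAt 𝓘(ℝ, E) p p)
        (chartField X p (extChartAt 𝓘(ℝ, E) p p)) -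
      fderiv ℝ (chartField X p) (extChartAt 𝓘(ℝ, E) p p)
        (chartField Y p (extChartAt 𝓘(ℝ, E) p p)) := by
  have h : fieldBracket X Y p = (tder E E (extChartAt 𝓘(ℝ, E) p) p).inverse
    (VectorField.lieBracketWithin ℝ (chartField X p) (chartField Y p)
      ((extChartAt 𝓘(ℝ, E) p).symm ⁻¹' Set.univ ∩ Set.range 𝓘(ℝ, E)) (extChartAt 𝓘(ℝ, E) p p)) := rfl
  rw [h, inverse_of_eq_id (tder_extChartAt_self p)]
  simp [VectorField.lieBracketWithin, fderivWithin_univ]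

lemma IsDiffField.differentiableAt [CompleteSpace E] {X : N → E} {p : N} (h : IsDiffField X p) :
    DifferentiableAt ℝ (chartField X p) (extChartAt 𝓘(ℝ, E) p p) := by
  have h1 : DifferentiableWithinAt ℝ (chartField X p)
      ((extChartAt 𝓘(ℝ, E) p).symm ⁻¹' Set.univ ∩ Set.range 𝓘(ℝ, E)) (extChartAt 𝓘(ℝ, E) p p) :=
    MDifferentiableWithinAt.differentiableWithinAt_mpullbackWithin_vectorField
      (MDifferentiableAt.mdifferentiableWithinAt h)
  exact h1.differentiableAt (by simp)

lemma tder_chart_symm_chartField (X : N → E) {p : N} {y : E}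
    (hy : y ∈ (extChartAt 𝓘(ℝ, E) p).target) :
    tder E E (extChartAt 𝓘(ℝ, E) p).symm y (chartField X p y) =
      X ((extChartAt 𝓘(ℝ, E) p).symm y) := by
  have h := (isInvertible_mfderivWithin_extChartAt_symm hy).self_apply_inverse
    (X ((extChartAt 𝓘(ℝ, E) p).symm y))
  have h2 : mfderivWithin 𝓘(ℝ, E) 𝓘(ℝ, E) (extChartAt 𝓘(ℝ, E) p).symm (Set.range 𝓘(ℝ, E)) y =
      mfderiv 𝓘(ℝ, E) 𝓘(ℝ, E) (extChartAt 𝓘(ℝ, E) p).symm y := by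
    rw [modelWithCornersSelf_coe, Set.range_id, mfderivWithin_univ]
  have h3 : chartField X p y = (mfderivWithin 𝓘(ℝ, E) 𝓘(ℝ, E) (extChartAt 𝓘(ℝ, E) p).symm
    (Set.range 𝓘(ℝ, E)) y).inverse (X ((extChartAt 𝓘(ℝ, E) p).symm y)) := rfl
  rw [← h3] at h
  exact (congrArg (fun L : E →L[ℝ] E => L (chartField X p y)) h2.symm).trans h

lemma mdifferentiableAt_extChartAt_symm {p : N} {y : E}
    (hy : y ∈ (extChartAt 𝓘(ℝ, E) p).target) :
    MDifferentiableAt 𝓘(ℝ, E) 𝓘(ℝ, E) (extChartAt 𝓘(ℝ, E) p).symm y :=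
  ((contMDiffOn_extChartAt_symm (n := ∞) p).contMDiffAt
    ((isOpen_extChartAt_target p).mem_nhds hy)).mdifferentiableAt (by simp)

lemma chartField_self (X : N → E) (p : N) : chartField X p (extChartAt 𝓘(ℝ, E) p p) = X p := by
  have h := tder_chart_symm_chartField X (mem_extChartAt_target (I := 𝓘(ℝ, E)) p)
  rw [extChartAt_to_inv] at h
  rw [← h]
  have h1 := tder_comp (p := extChartAt 𝓘(ℝ, E) p p) (f := (extChartAt 𝓘(ℝ, E) p).symm)
    (F := extChartAt 𝓘(ℝ, E) p)
    (by rw [extChartAt_to_inv]; exact mdifferentiableAt_extChartAt (mem_chart_source _ _))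
    (mdifferentiableAt_extChartAt_symm (mem_extChartAt_target (I := 𝓘(ℝ, E)) p))
  rw [extChartAt_to_inv, tder_extChartAt_self, ContinuousLinearMap.id_comp] at h1
  rw [← h1]
  have : (fun y => extChartAt 𝓘(ℝ, E) p ((extChartAt 𝓘(ℝ, E) p).symm y))
      =ᶠ[nhds (extChartAt 𝓘(ℝ, E) p p)] id := by
    filter_upwards [extChartAt_target_mem_nhds (I := 𝓘(ℝ, E)) p] with y hy
    exact (extChartAt 𝓘(ℝ, E) p).right_inv hy
  rw [tder_congr this, tder_eq_fderiv, fderiv_id]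
  rfl

/-- This is the product rule in the chart at `p`. The first summand is symmetric in the two vector
fields once `u` is the other field, so it drops out of the commutator, and the second summand
produces the bracket. -/
lemma tder_field_chart [CompleteSpace E] {F : N → E₃} (hF : ContMDiff 𝓘(ℝ, E) 𝓘(ℝ, E₃) ∞ F)
    {X : N → E} {p : N} (hX : IsDiffField X p) (u : E) :
    tder E E₃ (fun x => tder E E₃ F x (X x)) p u =
      fderiv ℝ (fderiv ℝ (fun y => F ((extChartAt 𝓘(ℝ, E) p).symm y))) (extChartAt 𝓘(ℝ, E) p p) u
        (chartField X p (extChartAt 𝓘(ℝ, E) p p)) +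
      fderiv ℝ (fun y => F ((extChartAt 𝓘(ℝ, E) p).symm y)) (extChartAt 𝓘(ℝ, E) p p)
        (fderiv ℝ (chartField X p) (extChartAt 𝓘(ℝ, E) p p) u) := by
  have hFc := contDiffAt_chart hF p
  have hev : (fun y => tder E E₃ F ((extChartAt 𝓘(ℝ, E) p).symm y)
      (X ((extChartAt 𝓘(ℝ, E) p).symm y))) =ᶠ[nhds (extChartAt 𝓘(ℝ, E) p p)]
      fun y => fderiv ℝ (fun y => F ((extChartAt 𝓘(ℝ, E) p).symm y)) y (chartField X p y) := by
    filter_upwards [extChartAt_target_mem_nhds (I := 𝓘(ℝ, E)) p] with y hy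
    rw [← tder_eq_fderiv, tder_comp (hF.mdifferentiable (by simp) _)
      (mdifferentiableAt_extChartAt_symm hy), ContinuousLinearMap.comp_apply,
      tder_chart_symm_chartField X hy]
  have hK2 : DifferentiableAt ℝ (fderiv ℝ (fun y => F ((extChartAt 𝓘(ℝ, E) p).symm y)))
      (extChartAt 𝓘(ℝ, E) p p) :=
    (hFc.fderiv_right (m := 1) (by rw [one_add_one_eq_two]; exact ENat.LEInfty.out)).differentiableAt
      (by simp)
  have hd := hK2.hasFDerivAt.clm_apply hX.differentiableAt.hasFDerivAt
  have hmd : MDifferentiableAt 𝓘(ℝ, E) 𝓘(ℝ, E₃) (fun x => tder E E₃ F x (X x)) p := by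
    have h1 := (hd.congr_of_eventuallyEq hev).differentiableAt.mdifferentiableAt.comp p
      (mdifferentiableAt_extChartAt (I := 𝓘(ℝ, E)) (mem_chart_source _ p))
    refine h1.congr_of_eventuallyEq ?_
    filter_upwards [extChartAt_source_mem_nhds (I := 𝓘(ℝ, E)) p] with x hx
    simp only [Function.comp_apply]
    rw [(extChartAt 𝓘(ℝ, E) p).left_inv hx]
  rw [tder_eq_fderiv_chart hmd, hev.fderiv_eq, hd.fderiv]
  simp [add_comm]

/-- The Lie bracket of vector fields acts on functions as the commutator. -/
lemma tder_fieldBracket [CompleteSpace E] {F : N → E₃} (hF : ContMDiff 𝓘(ℝ, E) 𝓘(ℝ, E₃) ∞ F)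
    {X Y : N → E} {p : N} (hX : IsDiffField X p) (hY : IsDiffField Y p) :
    tder E E₃ F p (fieldBracket X Y p) =
      tder E E₃ (fun x => tder E E₃ F x (Y x)) p (X p) -
      tder E E₃ (fun x => tder E E₃ F x (X x)) p (Y p) := by
  rw [tder_field_chart hF hX, tder_field_chart hF hY, fieldBracket_eq_chart,
    tder_eq_fderiv_chart (hF.mdifferentiable (by simp) p), map_sub, ← chartField_self X p,
    ← chartField_self Y p, ((contDiffAt_chart hF p).isSymmSndFDerivAt
      (by rw [minSmoothness_of_isRCLikeNormedField]; exact ENat.LEInfty.out)).eq]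
  simp only [chartField_self]
  abel

end LieBracket

/-! ### Chain rules for maps into products and for linear maps -/

section Calculus
variable {E E₁ E₂ E₃ : Type*} [NormedAddCommGroup E] [NormedSpace ℝ E]
  [NormedAddCommGroup E₁] [NormedSpace ℝ E₁]
  [NormedAddCommGroup E₂] [NormedSpace ℝ E₂] [NormedAddCommGroup E₃] [NormedSpace ℝ E₃]
  {N N₁ N₂ N' : Type*} [TopologicalSpace N] [ChartedSpace E N]
  [TopologicalSpace N₁] [ChartedSpace E₁ N₁]
  [TopologicalSpace N₂] [ChartedSpace E₂ N₂]
  [TopologicalSpace N'] [ChartedSpace E₃ N']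

lemma tder_prod {K : N₁ × N₂ → N'} {a : N → N₁} {b : N → N₂} {p : N}
    (hK : MDifferentiableAt (𝓘(ℝ, E₁).prod 𝓘(ℝ, E₂)) 𝓘(ℝ, E₃) K (a p, b p))
    (ha : MDifferentiableAt 𝓘(ℝ, E) 𝓘(ℝ, E₁) a p)
    (hb : MDifferentiableAt 𝓘(ℝ, E) 𝓘(ℝ, E₂) b p) (u : E) :
    tder E E₃ (fun x => K (a x, b x)) p u =
      tder E₁ E₃ (fun y => K (y, b p)) (a p) (tder E E₁ a p u) +
      tder E₂ E₃ (fun y => K (a p, y)) (b p) (tder E E₂ b p u) := by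
  have h1 := hK.hasMFDerivAt.comp p (ha.hasMFDerivAt.prodMk hb.hasMFDerivAt)
  have h2 := h1.mfderiv
  have h3 := mfderiv_prod_eq_add_apply hK (v := (tder E E₁ a p u, tder E E₂ b p u))
  exact (congrArg (fun L : E →L[ℝ] E₃ => L u) h2).trans h3

lemma tder_clm_comp (L : E₁ →L[ℝ] E₃) {F : N → E₁} {p : N}
    (hF : MDifferentiableAt 𝓘(ℝ, E) 𝓘(ℝ, E₁) F p) :
    tder E E₃ (fun x => L (F x)) p = L.comp (tder E E₁ F p) := by
  rw [tder_comp L.mdifferentiableAt hF, tder_eq_fderiv, L.fderiv]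

lemma tder_clm_eval {F : N → E₁ →L[ℝ] E₃} {p : N}
    (hF : MDifferentiableAt 𝓘(ℝ, E) 𝓘(ℝ, E₁ →L[ℝ] E₃) F p) (v : E₁) (u : E) :
    tder E E₃ (fun x => F x v) p u = tder E (E₁ →L[ℝ] E₃) F p u v := by
  rw [show (fun x => F x v) = fun x => ContinuousLinearMap.apply ℝ E₃ v (F x) from rfl,
    tder_clm_comp _ hF]
  rfl

end Calculus

/-! ### Invariant vector fields and the adjoint representation -/

section Group
variable {𝔤 : Type*} [NormedAddCommGroup 𝔤] [NormedSpace ℝ 𝔤]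
  {G : Type*} [TopologicalSpace G] [ChartedSpace 𝔤 G] [Group G]
  {E₃ : Type*} [NormedAddCommGroup E₃] [NormedSpace ℝ E₃]

/-- The left-invariant vector field, with values in the model space. -/
def leftVec (ξ : 𝔤) (g : G) : 𝔤 := tder 𝔤 𝔤 (fun x : G => g * x) 1 ξ

/-- The right-invariant vector field, with values in the model space. -/
def rightVec (ξ : 𝔤) (g : G) : 𝔤 := tder 𝔤 𝔤 (fun x : G => x * g) 1 ξ

lemma Ad_eq_tder (g : G) : (Ad g : 𝔤 →L[ℝ] 𝔤) = tder 𝔤 𝔤 (fun x : G => g * x * g⁻¹) 1 := rfl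

variable [LieGroup 𝓘(ℝ, 𝔤) ∞ G]

lemma contMDiff_mul' : ContMDiff (𝓘(ℝ, 𝔤).prod 𝓘(ℝ, 𝔤)) 𝓘(ℝ, 𝔤) ∞ (fun z : G × G => z.1 * z.2) :=
  contMDiff_mul 𝓘(ℝ, 𝔤) ∞

lemma mdiff_of_contMDiff {N N' E E₃ : Type*} [NormedAddCommGroup E] [NormedSpace ℝ E]
    [NormedAddCommGroup E₃] [NormedSpace ℝ E₃] [TopologicalSpace N] [ChartedSpace E N]
    [TopologicalSpace N'] [ChartedSpace E₃ N'] {F : N → N'}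
    (hF : ContMDiff 𝓘(ℝ, E) 𝓘(ℝ, E₃) ∞ F) (p : N) : MDifferentiableAt 𝓘(ℝ, E) 𝓘(ℝ, E₃) F p :=
  hF.mdifferentiable (by simp) p

lemma mdiff_mul_left (g x : G) :
    MDifferentiableAt 𝓘(ℝ, 𝔤) 𝓘(ℝ, 𝔤) (fun x : G => g * x) x :=
  mdiff_of_contMDiff (contMDiff_mul_left (n := ∞)) x

lemma mdiff_mul_right (g x : G) :
    MDifferentiableAt 𝓘(ℝ, 𝔤) 𝓘(ℝ, 𝔤) (fun x : G => x * g) x :=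
  mdiff_of_contMDiff (contMDiff_mul_right (n := ∞)) x

lemma contMDiff_conj (g : G) : ContMDiff 𝓘(ℝ, 𝔤) 𝓘(ℝ, 𝔤) ∞ (fun x : G => g * x * g⁻¹) :=
  (contMDiff_const.mul contMDiff_id).mul contMDiff_const

lemma mdiff_conj (g x : G) :
    MDifferentiableAt 𝓘(ℝ, 𝔤) 𝓘(ℝ, 𝔤) (fun x : G => g * x * g⁻¹) x :=
  mdiff_of_contMDiff (contMDiff_conj g) x

variable {N' : Type*} [TopologicalSpace N'] [ChartedSpace E₃ N']

/-- Derivatives along invariant fields become derivatives at the identity of translated functions;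
the calculus on the group is done in this form. -/
lemma tder_leftVec {F : G → N'} {g : G} (hF : MDifferentiableAt 𝓘(ℝ, 𝔤) 𝓘(ℝ, E₃) F g) (ξ : 𝔤) :
    tder 𝔤 E₃ F g (leftVec ξ g) = tder 𝔤 E₃ (fun x => F (g * x)) 1 ξ := by
  have h := tder_comp_apply (p := (1 : G)) (f := fun x : G => g * x) (F := F)
    (by rwa [mul_one]) (mdiff_mul_left g 1) ξ
  rw [h, mul_one]; rfl

lemma tder_rightVec {F : G → N'} {g : G} (hF : MDifferentiableAt 𝓘(ℝ, 𝔤) 𝓘(ℝ, E₃) F g) (ξ : 𝔤) :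
    tder 𝔤 E₃ F g (rightVec ξ g) = tder 𝔤 E₃ (fun x => F (x * g)) 1 ξ := by
  have h := tder_comp_apply (p := (1 : G)) (f := fun x : G => x * g) (F := F)
    (by rwa [one_mul]) (mdiff_mul_right g 1) ξ
  rw [h, one_mul]; rfl

lemma tder_Ad {F : G → N'} (hF : MDifferentiableAt 𝓘(ℝ, 𝔤) 𝓘(ℝ, E₃) F 1) (g : G) (ξ : 𝔤) :
    tder 𝔤 E₃ F 1 (Ad g ξ) = tder 𝔤 E₃ (fun x => F (g * x * g⁻¹)) 1 ξ := by
  have h := tder_comp_apply (p := (1 : G)) (f := fun x : G => g * x * g⁻¹) (F := F)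
    (by rwa [mul_one, mul_inv_cancel]) (mdiff_conj g 1) ξ
  rw [h, mul_one, mul_inv_cancel]; rfl

lemma leftVec_one (ξ : 𝔤) : leftVec ξ (1 : G) = ξ := by
  simp only [leftVec, one_mul]
  rw [tder_id]; rfl

lemma leftVec_mul (ξ : 𝔤) (g h : G) :
    leftVec ξ (g * h) = tder 𝔤 𝔤 (fun x : G => g * x) h (leftVec ξ h) := by
  rw [tder_leftVec (mdiff_mul_left g h)]
  simp only [leftVec, mul_assoc]

/-- This is the identity g x = (g x g⁻¹) g, differentiated at x = 1. -/
lemma leftVec_eq (ξ : 𝔤) (g : G) : leftVec ξ g = rightVec (Ad g ξ) g := by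
  rw [rightVec, tder_Ad (mdiff_mul_right g 1), leftVec]
  simp

lemma Ad_one : (Ad (1 : G) : 𝔤 →L[ℝ] 𝔤) = ContinuousLinearMap.id ℝ 𝔤 := by
  rw [Ad_eq_tder]
  simp [tder_id]

lemma Ad_mul (g h : G) (ξ : 𝔤) : Ad (g * h) ξ = Ad g (Ad h ξ) := by
  conv_rhs => rw [Ad_eq_tder g, tder_Ad (mdiff_conj g 1)]
  rw [Ad_eq_tder]
  simp [mul_assoc]

lemma Ad_inv_Ad (g : G) (ξ : 𝔤) : Ad g⁻¹ (Ad g ξ) = ξ := by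
  rw [← Ad_mul, inv_mul_cancel, Ad_one]; rfl

lemma Ad_Ad_inv (g : G) (ξ : 𝔤) : Ad g (Ad g⁻¹ ξ) = ξ := by
  rw [← Ad_mul, mul_inv_cancel, Ad_one]; rfl

lemma tder_inv_one (ξ : 𝔤) : tder 𝔤 𝔤 (fun g : G => g⁻¹) 1 ξ = -ξ := by
  have h := tder_prod (p := (1 : G)) (K := fun z : G × G => z.1 * z.2) (a := fun x => x)
    (b := fun x => x⁻¹) ((contMDiff_mul' (𝔤 := 𝔤)).mdifferentiable (by simp) _)
    mdifferentiableAt_id (mdiff_of_contMDiff (contMDiff_inv 𝓘(ℝ, 𝔤) ∞) 1) ξ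
  simp only [mul_inv_cancel, inv_one, mul_one, one_mul, tder_const, tder_id] at h
  exact eq_neg_of_add_eq_zero_right h.symm

variable [FiniteDimensional ℝ 𝔤] [T2Space G]

-- Such a function detects vectors at the identity, so identities in the Lie algebra can be checked
-- by differentiating functions with values in a fixed vector space.
variable (𝔤 G) in
lemma exists_log_chart : ∃ F : G → 𝔤, ContMDiff 𝓘(ℝ, 𝔤) 𝓘(ℝ, 𝔤) ∞ F ∧
    tder 𝔤 𝔤 F 1 = ContinuousLinearMap.id ℝ 𝔤 :=
  exists_contMDiff_tder_eq 1 _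

/-- `Ad g` is the partial differential in x at 1 of F(g x g⁻¹), a smooth function of the pair (g,
x), when F has identity differential at 1. -/
lemma contMDiff_Ad : ContMDiff 𝓘(ℝ, 𝔤) 𝓘(ℝ, 𝔤 →L[ℝ] 𝔤) ∞ (fun g : G => (Ad g : 𝔤 →L[ℝ] 𝔤)) := by
  obtain ⟨F, hF, hF1⟩ := exists_log_chart 𝔤 G
  have h := contMDiff_tder_right (N₁ := G) (N₂ := G) (H := fun z => F (z.1 * z.2 * z.1⁻¹))
    (hF.comp ((contMDiff_fst.mul contMDiff_snd).mul contMDiff_fst.inv)) 1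
  convert h using 2 with g
  ext ξ
  rw [← tder_Ad (mdiff_of_contMDiff hF 1), hF1]; rfl

lemma isDiffField_leftVec (ξ : 𝔤) (g : G) : IsDiffField (leftVec ξ) g := by
  have : LieGroup 𝓘(ℝ, 𝔤) (minSmoothness ℝ 3) G := LieGroup.of_le (n := ∞)
    (by rw [minSmoothness_of_isRCLikeNormedField]; exact ENat.LEInfty.out)
  exact mdifferentiableAt_mulInvariantVectorField (I := 𝓘(ℝ, 𝔤)) (G := G) ξ

lemma tder_lieBr {F : G → E₃} (hF : ContMDiff 𝓘(ℝ, 𝔤) 𝓘(ℝ, E₃) ∞ F) (ξ η : 𝔤) :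
    tder 𝔤 E₃ F 1 (lieBr G ξ η) =
      tder 𝔤 E₃ (fun g => tder 𝔤 E₃ (fun x => F (g * x)) 1 η) 1 ξ -
      tder 𝔤 E₃ (fun g => tder 𝔤 E₃ (fun x => F (g * x)) 1 ξ) 1 η := by
  have h := tder_fieldBracket hF (isDiffField_leftVec ξ 1) (isDiffField_leftVec η 1)
  rw [leftVec_one, leftVec_one] at h
  simp only [tder_leftVec (mdiff_of_contMDiff hF _)] at h
  exact h

/-- The derivative of the adjoint representation is the Lie bracket. -/
lemma tder_Ad_apply (ξ η : 𝔤) : tder 𝔤 𝔤 (fun g : G => Ad g η) 1 ξ = lieBr G ξ η := by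
  obtain ⟨F, hF, hF1⟩ := exists_log_chart 𝔤 G
  have hl : lieBr G ξ η = tder 𝔤 𝔤 F 1 (lieBr G ξ η) := by rw [hF1]; rfl
  have hAd : (fun g : G => Ad g η) = fun g => tder 𝔤 𝔤 (fun x => F (g * x * g⁻¹)) 1 η := by
    ext g
    rw [← tder_Ad (mdiff_of_contMDiff hF 1), hF1]; rfl
  have hmul : ContMDiff (𝓘(ℝ, 𝔤).prod 𝓘(ℝ, 𝔤)) 𝓘(ℝ, 𝔤) ∞ (fun z : G × G => F (z.1 * z.2)) :=
    hF.comp contMDiff_mul'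
  have hmul' : ContMDiff (𝓘(ℝ, 𝔤).prod 𝓘(ℝ, 𝔤)) 𝓘(ℝ, 𝔤) ∞ (fun z : G × G => F (z.2 * z.1)) :=
    hF.comp (contMDiff_snd.mul contMDiff_fst)
  rw [hl, tder_lieBr hF, hAd, tder_tder_swap (H := fun z : G × G => F (z.1 * z.2 * z.1⁻¹))
    (hF.comp ((contMDiff_fst.mul contMDiff_snd).mul contMDiff_fst.inv))]
  -- The product rule for the two occurrences of g in g x g⁻¹; inversion contributes the sign.
  -- Differentiating in x then gives the two terms of the bracket.
  have hin : ∀ x : G, tder 𝔤 𝔤 (fun g => F (g * x * g⁻¹)) 1 ξ =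
      tder 𝔤 𝔤 (fun g => F (g * x)) 1 ξ - tder 𝔤 𝔤 (fun g => F (x * g)) 1 ξ := by
    intro x
    have h := tder_prod (p := (1 : G)) (K := fun z : G × G => F (z.1 * x * z.2))
      (a := fun g => g) (b := fun g => g⁻¹)
      ((hF.comp ((contMDiff_fst.mul contMDiff_const).mul contMDiff_snd)).mdifferentiable
        (by simp) _)
      mdifferentiableAt_id (mdiff_of_contMDiff (contMDiff_inv 𝓘(ℝ, 𝔤) ∞) 1) ξ
    simp only [inv_one, mul_one, one_mul, tder_id, tder_inv_one, map_neg] at h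
    rw [h, sub_eq_add_neg]; rfl
  simp only [hin]
  have hs1 := tder_tder_swap hmul 1 1 ξ η
  have hd1 := mdiff_of_contMDiff (ContMDiff.clm_eval (contMDiff_tder_left hmul 1) ξ) 1
  have hd2 := mdiff_of_contMDiff (ContMDiff.clm_eval (contMDiff_tder_left hmul' 1) ξ) 1
  have hsub : tder 𝔤 𝔤 (fun y : G => tder 𝔤 𝔤 (fun g => F (g * y)) 1 ξ -
      tder 𝔤 𝔤 (fun g => F (y * g)) 1 ξ) 1 η =
      tder 𝔤 𝔤 (fun y : G => tder 𝔤 𝔤 (fun g => F (g * y)) 1 ξ) 1 η -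
      tder 𝔤 𝔤 (fun y : G => tder 𝔤 𝔤 (fun g => F (y * g)) 1 ξ) 1 η :=
    congrArg (fun L : 𝔤 →L[ℝ] 𝔤 => L η) (hd1.hasMFDerivAt.sub hd2.hasMFDerivAt).mfderiv
  rw [hsub, hs1]

variable (G) in
/-- The adjoint representation of the Lie algebra. -/
def adL : 𝔤 →L[ℝ] 𝔤 →L[ℝ] 𝔤 := tder 𝔤 (𝔤 →L[ℝ] 𝔤) (fun g : G => (Ad g : 𝔤 →L[ℝ] 𝔤)) 1

lemma adL_apply (ξ η : 𝔤) : adL G ξ η = lieBr G ξ η := by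
  rw [← tder_Ad_apply, tder_clm_eval (mdiff_of_contMDiff contMDiff_Ad 1)]; rfl

lemma lieBr_swap (ξ η : 𝔤) : lieBr G ξ η = -lieBr G η ξ := by
  obtain ⟨F, hF, hF1⟩ := exists_log_chart 𝔤 G
  have h : ∀ ξ η, lieBr G ξ η = tder 𝔤 𝔤 F 1 (lieBr G ξ η) := fun ξ η => by rw [hF1]; rfl
  rw [h ξ η, h η ξ, tder_lieBr hF, tder_lieBr hF, neg_sub]

end Group

/-! ### One-parameter subgroups and the exponential map -/

section Exp
variable {𝔤 : Type*} [NormedAddCommGroup 𝔤] [NormedSpace ℝ 𝔤] [FiniteDimensional ℝ 𝔤]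
  {G : Type*} [TopologicalSpace G] [ChartedSpace 𝔤 G] [Group G] [LieGroup 𝓘(ℝ, 𝔤) ∞ G] [T2Space G]
  {E₃ : Type*} [NormedAddCommGroup E₃] [NormedSpace ℝ E₃]

/-- `γ` is an integral curve of the left-invariant vector field with value `ξ` at the identity. -/
def IsLeftCurve (ξ : 𝔤) (γ : ℝ → G) : Prop :=
  ∀ t, HasMFDerivAt 𝓘(ℝ, ℝ) 𝓘(ℝ, 𝔤) γ t
    ((1 : ℝ →L[ℝ] ℝ).smulRight (leftVec ξ (γ t)) : ℝ →L[ℝ] 𝔤)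

lemma isLeftCurve_iff {ξ : 𝔤} {γ : ℝ → G} :
    IsLeftCurve ξ γ ↔ IsMIntegralCurve (I := 𝓘(ℝ, 𝔤)) γ (leftField ξ) := Iff.rfl

lemma contMDiff_leftField (ξ : 𝔤) : ContMDiff 𝓘(ℝ, 𝔤) 𝓘(ℝ, 𝔤).tangent 1
    (fun x : G => (⟨x, leftField ξ x⟩ : TangentBundle 𝓘(ℝ, 𝔤) G)) := by
  have : LieGroup 𝓘(ℝ, 𝔤) (minSmoothness ℝ 3) G := LieGroup.of_le (n := ∞)
    (by rw [minSmoothness_of_isRCLikeNormedField]; exact ENat.LEInfty.out)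
  refine ContMDiff.of_le (contMDiff_mulInvariantVectorField (I := 𝓘(ℝ, 𝔤)) (G := G) ξ) ?_
  rw [minSmoothness_of_isRCLikeNormedField]
  exact one_le_two

lemma IsLeftCurve.unique {ξ : 𝔤} {γ γ' : ℝ → G} (h : IsLeftCurve ξ γ) (h' : IsLeftCurve ξ γ')
    (h0 : γ 0 = γ' 0) : γ = γ' :=
  isMIntegralCurve_Ioo_eq_of_contMDiff_boundaryless (contMDiff_leftField ξ) h h' h0

lemma HasMFDerivAt.curve_comp {N N' E E₃ : Type*} [NormedAddCommGroup E] [NormedSpace ℝ E]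
    [NormedAddCommGroup E₃] [NormedSpace ℝ E₃] [TopologicalSpace N] [ChartedSpace E N]
    [TopologicalSpace N'] [ChartedSpace E₃ N'] {F : N → N'} {γ : ℝ → N} {t : ℝ} {v : E} {w : E₃}
    (hγ : HasMFDerivAt 𝓘(ℝ, ℝ) 𝓘(ℝ, E) γ t ((1 : ℝ →L[ℝ] ℝ).smulRight v : ℝ →L[ℝ] E))
    (hF : MDifferentiableAt 𝓘(ℝ, E) 𝓘(ℝ, E₃) F (γ t)) (hw : tder E E₃ F (γ t) v = w) :
    HasMFDerivAt 𝓘(ℝ, ℝ) 𝓘(ℝ, E₃) (fun s => F (γ s)) t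
      ((1 : ℝ →L[ℝ] ℝ).smulRight w : ℝ →L[ℝ] E₃) := by
  have h := hF.hasMFDerivAt.comp t hγ
  have h2 : (tder E E₃ F (γ t)).comp ((1 : ℝ →L[ℝ] ℝ).smulRight v : ℝ →L[ℝ] E) =
      ((1 : ℝ →L[ℝ] ℝ).smulRight w : ℝ →L[ℝ] E₃) := by
    ext; simp [hw]
  rw [← h2]
  exact h

lemma IsLeftCurve.mul_left {ξ : 𝔤} {γ : ℝ → G} (h : IsLeftCurve ξ γ) (g : G) :
    IsLeftCurve ξ (fun t => g * γ t) := fun t =>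
  HasMFDerivAt.curve_comp (h t) (mdiff_mul_left g _) (leftVec_mul ξ g (γ t)).symm

lemma IsLeftCurve.conj {ξ : 𝔤} {γ : ℝ → G} (h : IsLeftCurve ξ γ) (g : G) :
    IsLeftCurve (Ad g ξ) (fun t => g * γ t * g⁻¹) := fun t => by
  refine HasMFDerivAt.curve_comp (h t) (mdiff_conj g _) ?_
  rw [tder_leftVec (mdiff_conj g _), leftVec, tder_Ad (mdiff_mul_left _ 1)]
  simp [mul_assoc]

lemma leftVec_smul (c : ℝ) (ξ : 𝔤) (g : G) : leftVec (c • ξ) g = c • leftVec ξ g := by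
  simp [leftVec]

lemma leftField_smul (c : ℝ) (ξ : 𝔤) : leftField (G := G) (c • ξ) = c • leftField ξ := by
  ext g
  exact leftVec_smul c ξ g

lemma IsLeftCurve.comp_mul {ξ : 𝔤} {γ : ℝ → G} (h : IsLeftCurve ξ γ) (c : ℝ) :
    IsLeftCurve (c • ξ) (fun t => γ (t * c)) := by
  rw [isLeftCurve_iff, leftField_smul]
  exact IsMIntegralCurve.comp_mul h c

lemma IsLeftCurve.comp_add {ξ : 𝔤} {γ : ℝ → G} (h : IsLeftCurve ξ γ) (c : ℝ) :
    IsLeftCurve ξ (fun t => γ (t + c)) :=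
  IsMIntegralCurve.comp_add h c

/-- Left translates of one local solution through 1 give solutions through every point with a common
existence time, and this forces the field to be complete. -/
lemma exists_isLeftCurve (ξ : 𝔤) : ∃ γ : ℝ → G, γ 0 = 1 ∧ IsLeftCurve ξ γ := by
  obtain ⟨γ, h0, hγ⟩ := exists_isMIntegralCurveAt_of_contMDiffAt_boundaryless (t₀ := 0) (x₀ := 1)
    (contMDiff_leftField (G := G) ξ).contMDiffAt
  obtain ⟨ε, hε, hγ⟩ := isMIntegralCurveAt_iff'.1 hγ
  refine exists_isMIntegralCurve_of_isMIntegralCurveOn (contMDiff_leftField (G := G) ξ) hε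
    (fun x => ⟨fun t => x * γ t, by simp [h0], fun t ht => ?_⟩) 1
  have ht' : t ∈ Metric.ball (0 : ℝ) ε := by
    rw [Real.ball_eq_Ioo]; simpa using ht
  have h1 : HasMFDerivAt 𝓘(ℝ, ℝ) 𝓘(ℝ, 𝔤) γ t
      ((1 : ℝ →L[ℝ] ℝ).smulRight (leftVec ξ (γ t)) : ℝ →L[ℝ] 𝔤) :=
    (hγ t ht').hasMFDerivAt (Metric.isOpen_ball.mem_nhds ht')
  exact (HasMFDerivAt.curve_comp h1 (mdiff_mul_left x _)
    (leftVec_mul ξ x (γ t)).symm).hasMFDerivWithinAt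

lemma lieExp_eq {ξ : 𝔤} {γ : ℝ → G} (h : IsLeftCurve ξ γ) (h0 : γ 0 = 1) :
    lieExp G ξ = γ 1 := by
  have hex : ∃ γ : ℝ → G, γ 0 = 1 ∧ IsMIntegralCurve (I := 𝓘(ℝ, 𝔤)) γ (leftField ξ) := ⟨γ, h0, h⟩
  rw [lieExp, dif_pos hex]
  have := hex.choose_spec
  rw [IsLeftCurve.unique (h' := h) this.2 (by rw [this.1, h0])]

lemma lieExp_smul_eq {ξ : 𝔤} {γ : ℝ → G} (h : IsLeftCurve ξ γ) (h0 : γ 0 = 1) (t : ℝ) :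
    lieExp G (t • ξ) = γ t := by
  rw [lieExp_eq (h.comp_mul t) (by simpa using h0), one_mul]

lemma isLeftCurve_lieExp (ξ : 𝔤) : IsLeftCurve ξ (fun t : ℝ => lieExp G (t • ξ)) := by
  obtain ⟨γ, h0, h⟩ := exists_isLeftCurve (G := G) ξ
  simp_rw [lieExp_smul_eq h h0]
  exact h

variable (G) in
lemma lieExp_zero : lieExp G (0 : 𝔤) = 1 := by
  obtain ⟨γ, h0, h⟩ := exists_isLeftCurve (G := G) (0 : 𝔤)
  have := lieExp_smul_eq h h0 0
  rwa [zero_smul, h0] at this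

/-- As functions of t both sides are integral curves of the same left-invariant field, and they
agree at t = 0. -/
lemma lieExp_add_smul (ξ : 𝔤) (s t : ℝ) :
    lieExp G ((s + t) • ξ) = lieExp G (s • ξ) * lieExp G (t • ξ) := by
  have h1 := (isLeftCurve_lieExp (G := G) ξ).mul_left (lieExp G (s • ξ))
  have h2 := (isLeftCurve_lieExp (G := G) ξ).comp_add s
  have := congrFun (IsLeftCurve.unique h2 h1 (by simp [lieExp_zero])) t
  rwa [add_comm t s] at this

lemma lieExp_neg (ξ : 𝔤) : lieExp G (-ξ) = (lieExp G ξ)⁻¹ := by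
  have h := lieExp_add_smul (G := G) ξ (-1) 1
  rw [neg_add_cancel, zero_smul, lieExp_zero, neg_one_smul, one_smul] at h
  exact (inv_eq_of_mul_eq_one_left h.symm).symm

lemma lieExp_Ad (g : G) (ξ : 𝔤) : lieExp G (Ad g ξ) = g * lieExp G ξ * g⁻¹ := by
  rw [lieExp_eq ((isLeftCurve_lieExp (G := G) ξ).conj g) (by simp [lieExp_zero]), one_smul]

lemma hasDerivAt_of_curve {N E : Type*} [NormedAddCommGroup E] [NormedSpace ℝ E]
    [TopologicalSpace N] [ChartedSpace E N] {F : N → E₃} {γ : ℝ → N} {t : ℝ} {v : E}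
    (hγ : HasMFDerivAt 𝓘(ℝ, ℝ) 𝓘(ℝ, E) γ t ((1 : ℝ →L[ℝ] ℝ).smulRight v : ℝ →L[ℝ] E))
    (hF : MDifferentiableAt 𝓘(ℝ, E) 𝓘(ℝ, E₃) F (γ t)) :
    HasDerivAt (fun s => F (γ s)) (tder E E₃ F (γ t) v) t := by
  have h := HasMFDerivAt.curve_comp hγ hF rfl
  have h2 : HasFDerivAt (fun s => F (γ s))
    ((1 : ℝ →L[ℝ] ℝ).smulRight (tder E E₃ F (γ t) v) : ℝ →L[ℝ] E₃) t := h.hasFDerivAt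
  simpa using h2.hasDerivAt

lemma hasDerivAt_lieExp {F : G → E₃} (ξ : 𝔤) (t : ℝ)
    (hF : MDifferentiableAt 𝓘(ℝ, 𝔤) 𝓘(ℝ, E₃) F (lieExp G (t • ξ))) :
    HasDerivAt (fun s : ℝ => F (lieExp G (s • ξ)))
      (tder 𝔤 E₃ F (lieExp G (t • ξ)) (leftVec ξ (lieExp G (t • ξ)))) t :=
  hasDerivAt_of_curve (isLeftCurve_lieExp ξ t) hF

lemma hasDerivAt_lieExp_zero {F : G → E₃} (ξ : 𝔤)
    (hF : MDifferentiableAt 𝓘(ℝ, 𝔤) 𝓘(ℝ, E₃) F 1) :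
    HasDerivAt (fun s : ℝ => F (lieExp G (s • ξ))) (tder 𝔤 E₃ F 1 ξ) 0 := by
  have h := hasDerivAt_lieExp (G := G) (F := F) ξ 0 (by rwa [zero_smul, lieExp_zero])
  rwa [zero_smul, lieExp_zero, leftVec_one] at h

lemma hasDerivAt_Ad_lieExp (ξ : 𝔤) (t : ℝ) :
    HasDerivAt (fun s : ℝ => (Ad (lieExp G (s • ξ)) : 𝔤 →L[ℝ] 𝔤))
      ((Ad (lieExp G (t • ξ)) : 𝔤 →L[ℝ] 𝔤) * adL G ξ) t := by
  have h := hasDerivAt_lieExp (G := G) (F := fun g => (Ad g : 𝔤 →L[ℝ] 𝔤)) ξ t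
    (mdiff_of_contMDiff contMDiff_Ad _)
  rw [tder_leftVec (mdiff_of_contMDiff contMDiff_Ad _)] at h
  have h2 : (fun x : G => (Ad (lieExp G (t • ξ) * x) : 𝔤 →L[ℝ] 𝔤)) =
      fun x => ContinuousLinearMap.compL ℝ 𝔤 𝔤 𝔤 (Ad (lieExp G (t • ξ))) (Ad x) := by
    ext x η
    rw [Ad_mul]; rfl
  rw [h2, tder_clm_comp _ (mdiff_of_contMDiff contMDiff_Ad 1)] at h
  exact h

/-- The product F(t) exp(-tX) has zero derivative. -/
lemma eq_exp_smul_of_hasDerivAt {𝔸 : Type*} [NormedRing 𝔸] [NormedAlgebra ℝ 𝔸] [CompleteSpace 𝔸]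
    {F : ℝ → 𝔸} {X : 𝔸} (hF : ∀ t, HasDerivAt F (F t * X) t) (h0 : F 0 = 1) (t : ℝ) :
    F t = NormedSpace.exp (t • X) := by
  have h1 : ∀ s : ℝ, HasDerivAt (fun s : ℝ => F s * NormedSpace.exp (s • (-X))) 0 s := by
    intro s
    have h := (hF s).mul (hasDerivAt_exp_smul_const' (𝕂 := ℝ) (-X) s)
    rw [mul_assoc, ← mul_add, neg_mul, add_neg_cancel, mul_zero] at h
    exact h
  have h2 := is_const_of_deriv_eq_zero (fun s => (h1 s).differentiableAt)
    (fun s => (h1 s).deriv) t 0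
  simp only [zero_smul, h0, smul_neg, neg_zero, NormedSpace.exp_zero, mul_one] at h2
  have h3 : NormedSpace.exp (-(t • X)) * NormedSpace.exp (t • X) = 1 := by
    let := NormedAlgebra.restrictScalars ℚ ℝ 𝔸
    rw [← NormedSpace.exp_add_of_commute (Commute.refl _).neg_left, neg_add_cancel,
      NormedSpace.exp_zero]
  rw [← mul_one (F t), ← h3, ← mul_assoc, h2, one_mul]

lemma Ad_lieExp_smul (ξ : 𝔤) (t : ℝ) :
    (Ad (lieExp G (t • ξ)) : 𝔤 →L[ℝ] 𝔤) = NormedSpace.exp (t • adL G ξ) :=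
  eq_exp_smul_of_hasDerivAt (F := fun t : ℝ => (Ad (lieExp G (t • ξ)) : 𝔤 →L[ℝ] 𝔤))
    (hasDerivAt_Ad_lieExp ξ) (by rw [zero_smul, lieExp_zero, Ad_one]; rfl) t

/-- Both sides are the derivative at s = 0 of one curve, since exp(s Ad_g ξ) = g exp(sξ) g⁻¹. -/
lemma lieBr_Ad (g : G) (ξ η : 𝔤) : lieBr G (Ad g ξ) (Ad g η) = Ad g (lieBr G ξ η) := by
  have h1 := hasDerivAt_lieExp_zero (G := G) (F := fun x => Ad x (Ad g η)) (Ad g ξ)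
    (mdiff_of_contMDiff (ContMDiff.clm_eval contMDiff_Ad _) 1)
  have h2 := hasDerivAt_lieExp_zero (G := G) (F := fun x => Ad g (Ad x η)) ξ
    (mdiff_of_contMDiff ((Ad g : 𝔤 →L[ℝ] 𝔤).contMDiff.comp (ContMDiff.clm_eval contMDiff_Ad _)) 1)
  rw [tder_Ad_apply] at h1
  rw [tder_clm_comp (Ad g : 𝔤 →L[ℝ] 𝔤) (F := fun x : G => Ad x η)
    (mdiff_of_contMDiff (ContMDiff.clm_eval contMDiff_Ad _) 1)] at h2
  have h3 : (fun s : ℝ => (Ad (lieExp G (s • Ad g ξ)) : 𝔤 →L[ℝ] 𝔤) (Ad g η)) =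
      fun s => Ad g (Ad (lieExp G (s • ξ)) η) := by
    ext s
    rw [← map_smul, lieExp_Ad, ← Ad_mul, ← Ad_mul]
    simp
  rw [h3] at h1
  rw [h1.unique h2, ContinuousLinearMap.comp_apply, tder_Ad_apply]

/-- Differentiate the constant function B(Ad_{exp(sζ)} ξ, Ad_{exp(sζ)} η) at s = 0. -/
lemma invariant_lieBr {B : LinearMap.BilinForm ℝ 𝔤} (hB : IsInvariantInnerProduct G B)
    (ζ ξ η : 𝔤) : B (lieBr G ζ ξ) η = -B ξ (lieBr G ζ η) := by
  let Bc : 𝔤 →L[ℝ] 𝔤 →L[ℝ] ℝ := LinearMap.toContinuousLinearMap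
    ((LinearMap.toContinuousLinearMap : (𝔤 →ₗ[ℝ] ℝ) ≃ₗ[ℝ] _).toLinearMap ∘ₗ B)
  have hAd : ∀ v : 𝔤, HasDerivAt (fun s : ℝ => Ad (lieExp G (s • ζ)) v) (lieBr G ζ v) 0 := by
    intro v
    have := hasDerivAt_lieExp_zero (G := G) (F := fun x => Ad x v) ζ
      (mdiff_of_contMDiff (ContMDiff.clm_eval contMDiff_Ad _) 1)
    rwa [tder_Ad_apply] at this
  have h := ((Bc.hasFDerivAt.comp_hasDerivAt (0 : ℝ) (hAd ξ)).clm_apply (hAd η))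
  have h2 : (fun s : ℝ => (Bc ∘ fun s : ℝ => Ad (lieExp G (s • ζ)) ξ) s
      (Ad (lieExp G (s • ζ)) η)) = fun _ => B ξ η := by
    ext s
    exact hB.invariant _ ξ η
  rw [h2] at h
  have h3 := h.unique (hasDerivAt_const _ _)
  simp only [Function.comp_apply, zero_smul, lieExp_zero, Ad_one] at h3
  have h4 : B (lieBr G ζ ξ) η + B ξ (lieBr G ζ η) = 0 := h3
  linarith

end Exp

/-! ### The entire functions S_k(x) = ∑ xⁿ/(n + k)! on a Banach algebra -/

section Series
variable {𝔸 : Type*} [NormedRing 𝔸] [NormedAlgebra ℝ 𝔸] [CompleteSpace 𝔸]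

/-- The entire function `∑ xⁿ / (n + k)!` on a Banach algebra. -/
def expTail (k : ℕ) (x : 𝔸) : 𝔸 := ∑' n : ℕ, (((n + k).factorial : ℝ)⁻¹) • x ^ n

lemma norm_expTail_term_le (k : ℕ) (x : 𝔸) (n : ℕ) :
    ‖(((n + k).factorial : ℝ)⁻¹) • x ^ n‖ ≤ ‖(((n).factorial : ℝ)⁻¹) • x ^ n‖ := by
  rw [norm_smul, norm_smul, norm_inv, norm_inv, Real.norm_natCast, Real.norm_natCast]
  gcongr
  omega

lemma summable_expTail (k : ℕ) (x : 𝔸) :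
    Summable (fun n : ℕ => (((n + k).factorial : ℝ)⁻¹) • x ^ n) :=
  Summable.of_norm_bounded (NormedSpace.norm_expSeries_summable' (𝕂 := ℝ) x)
    (norm_expTail_term_le k x)

lemma hasSum_expTail (k : ℕ) (x : 𝔸) :
    HasSum (fun n : ℕ => (((n + k).factorial : ℝ)⁻¹) • x ^ n) (expTail k x) :=
  (summable_expTail k x).hasSum

lemma expTail_zero_left (x : 𝔸) : expTail 0 x = NormedSpace.exp x := by
  rw [NormedSpace.exp_eq_tsum ℝ]; rfl

/-- The recursion encodes S₁ = (eˣ - 1)/x and S₂ = (eˣ - 1 - x)/x² with no division by x, which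
matters because ad ξ is never invertible for ξ ≠ 0. -/
lemma mul_expTail_succ (k : ℕ) (x : 𝔸) :
    x * expTail (k + 1) x = expTail k x - ((k.factorial : ℝ)⁻¹) • 1 := by
  have h1 := (hasSum_expTail (k + 1) x).mul_left x
  have h2 := (hasSum_nat_add_iff' 1).2 (hasSum_expTail k x)
  simp only [Finset.range_one, Finset.sum_singleton, zero_add, pow_zero] at h2
  have h3 : (fun n : ℕ => x * ((((n + (k + 1)).factorial : ℝ)⁻¹) • x ^ n)) =
      fun n : ℕ => (((n + 1 + k).factorial : ℝ)⁻¹) • x ^ (n + 1) := by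
    ext n
    rw [mul_smul_comm, ← pow_succ', add_right_comm n 1 k, add_assoc n k 1]
  rw [h3] at h1
  exact h1.unique h2

lemma expTail_succ_mul (k : ℕ) (x : 𝔸) :
    expTail (k + 1) x * x = expTail k x - ((k.factorial : ℝ)⁻¹) • 1 := by
  have h1 := (hasSum_expTail (k + 1) x).mul_right x
  have h2 := (hasSum_nat_add_iff' 1).2 (hasSum_expTail k x)
  simp only [Finset.range_one, Finset.sum_singleton, zero_add, pow_zero] at h2
  have h3 : (fun n : ℕ => ((((n + (k + 1)).factorial : ℝ)⁻¹) • x ^ n) * x) =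
      fun n : ℕ => (((n + 1 + k).factorial : ℝ)⁻¹) • x ^ (n + 1) := by
    ext n
    rw [smul_mul_assoc, ← pow_succ, add_right_comm n 1 k, add_assoc n k 1]
  rw [h3] at h1
  exact h1.unique h2

lemma expTail_succ_zero (k : ℕ) : expTail k (0 : 𝔸) = ((k.factorial : ℝ)⁻¹) • 1 := by
  rw [expTail, tsum_eq_single 0 (fun n hn => by simp [hn])]
  simp

/-- By the ratio test the scalar series has infinite radius of convergence, so the function is
analytic on the whole algebra. -/
lemma contDiff_expTail (k : ℕ) : ContDiff ℝ ∞ (expTail k : 𝔸 → 𝔸) := by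
  have hr : (FormalMultilinearSeries.ofScalars 𝔸 (fun n : ℕ => (((n + k).factorial : ℝ)⁻¹))).radius
      = ⊤ := by
    apply FormalMultilinearSeries.ofScalars_radius_eq_top_of_tendsto
    · exact Filter.Eventually.of_forall fun n => by positivity
    · have h1 : (fun n : ℕ => ‖(((n.succ + k).factorial : ℝ)⁻¹)‖ / ‖(((n + k).factorial : ℝ)⁻¹)‖) =
          fun n => ((((n + k : ℕ) : ℝ) + 1)⁻¹) := by
        ext n
        rw [Nat.succ_add, Nat.factorial_succ, norm_inv, norm_inv, Real.norm_natCast,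
          Real.norm_natCast]
        have := Nat.factorial_pos (n + k)
        push_cast
        field_simp
      rw [h1]
      have h2 := tendsto_one_div_add_atTop_nhds_zero_nat (𝕜 := ℝ)
      simp only [one_div] at h2
      exact h2.comp (Filter.tendsto_add_atTop_nat k)
  have h := (FormalMultilinearSeries.ofScalars 𝔸
    (fun n : ℕ => (((n + k).factorial : ℝ)⁻¹))).hasFPowerSeriesOnBall (by rw [hr]; simp)
  rw [hr] at h
  have h2 : AnalyticOnNhd ℝ (expTail k : 𝔸 → 𝔸) Set.univ := by
    have h3 := h.analyticOnNhd
    rw [Metric.eball_top_eq_univ] at h3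
    convert h3 using 1
    ext x
    exact (FormalMultilinearSeries.ofScalars_sum_eq _ x).symm
  exact contDiffOn_univ.1 (h2.contDiffOn uniqueDiffOn_univ)

/-- In effect t S₁(tx) is the integral of e^{sx} over [0, t]; here the series is differentiated term
by term. -/
lemma hasDerivAt_smul_expTail_one (x : 𝔸) (t : ℝ) :
    HasDerivAt (fun s : ℝ => s • expTail 1 (s • x)) (NormedSpace.exp (t • x)) t := by
  have hfun : (fun s : ℝ => s • expTail 1 (s • x)) =
      fun s => ∑' n : ℕ, (s ^ (n + 1) * ((n + 1).factorial : ℝ)⁻¹) • x ^ n := by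
    ext s
    rw [expTail, ← (summable_expTail 1 (s • x)).tsum_const_smul]
    refine tsum_congr fun n => ?_
    rw [smul_pow, smul_smul, smul_smul]
    congr 1; ring
  have hder : NormedSpace.exp (t • x) = ∑' n : ℕ, (t ^ n * ((n).factorial : ℝ)⁻¹) • x ^ n := by
    rw [NormedSpace.exp_eq_tsum ℝ]
    refine tsum_congr fun n => ?_
    rw [smul_pow, smul_smul, mul_comm]
  rw [hfun, hder]
  -- On the ball of this radius around 0, which contains t, the differentiated series is dominated
  -- by the exponential series of Rx.
  let R : ℝ := |t| + 1
  have hu : Summable (fun n : ℕ => ‖((n.factorial : ℝ)⁻¹) • (R • x) ^ n‖) :=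
    NormedSpace.norm_expSeries_summable' (𝕂 := ℝ) (R • x)
  refine hasDerivAt_tsum_of_isPreconnected (y₀ := (0 : ℝ)) (t := Metric.ball (0 : ℝ) R)
    (g := fun n (s : ℝ) => (s ^ (n + 1) * ((n + 1).factorial : ℝ)⁻¹) • x ^ n)
    (g' := fun n (s : ℝ) => (s ^ n * ((n).factorial : ℝ)⁻¹) • x ^ n) hu Metric.isOpen_ball
    (convex_ball 0 R).isPreconnected ?_ ?_ ?_ ?_ ?_
  · intro n s _
    have h := ((hasDerivAt_pow (n + 1) s).mul_const (((n + 1).factorial : ℝ)⁻¹)).smul_const (x ^ n)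
    convert h using 2
    rw [Nat.factorial_succ]
    push_cast
    field_simp
  · intro n s hs
    rw [smul_pow, smul_smul, norm_smul, norm_smul, mul_comm (_⁻¹ : ℝ), norm_mul, norm_mul,
      norm_pow s, norm_pow R]
    have : ‖s‖ ≤ ‖R‖ := by
      rw [mem_ball_zero_iff] at hs
      exact hs.le.trans (le_abs_self R)
    gcongr
  · simp only [Metric.mem_ball, dist_self]; positivity
  · simp [summable_zero]
  · rw [mem_ball_zero_iff, Real.norm_eq_abs]; exact lt_add_one _

end Series

/-! ### Global smooth functions with prescribed germ or support -/

section Bump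
variable {E E₃ : Type*} [NormedAddCommGroup E] [NormedSpace ℝ E] [FiniteDimensional ℝ E]
  {N : Type*} [TopologicalSpace N] [ChartedSpace E N] [IsManifold 𝓘(ℝ, E) ∞ N] [T2Space N]

lemma exists_contMDiff_eventuallyEq_extChartAt (p : N) :
    ∃ F : N → E, ContMDiff 𝓘(ℝ, E) 𝓘(ℝ, E) ∞ F ∧ F =ᶠ[nhds p] extChartAt 𝓘(ℝ, E) p := by
  obtain ⟨χ⟩ := (inferInstance : Nonempty (SmoothBumpFunction 𝓘(ℝ, E) p))
  refine ⟨fun x => χ x • extChartAt 𝓘(ℝ, E) p x, χ.contMDiff_smul contMDiffOn_extChartAt, ?_⟩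
  filter_upwards [χ.eventuallyEq_one] with x hx
  simp [hx]

lemma exists_contMDiff_bump {p : N} {O : Set N} (hO : O ∈ nhds p) :
    ∃ χ : N → ℝ, ContMDiff 𝓘(ℝ, E) 𝓘(ℝ, ℝ) ∞ χ ∧ χ p = 1 ∧ ∀ x, χ x ≠ 0 → x ∈ O := by
  obtain ⟨χ, hχ⟩ := (SmoothBumpFunction.nhds_basis_support (I := 𝓘(ℝ, E)) hO).ex_mem
  exact ⟨χ, χ.contMDiff, χ.eq_one, fun x hx => hχ (subset_tsupport _ hx)⟩

end Bump

/-! ### The differential of the exponential map -/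

section Exp
variable {𝔤 : Type*} [NormedAddCommGroup 𝔤] [NormedSpace ℝ 𝔤] [FiniteDimensional ℝ 𝔤]
  {G : Type*} [TopologicalSpace G] [ChartedSpace 𝔤 G] [Group G] [LieGroup 𝓘(ℝ, 𝔤) ∞ G] [T2Space G]
  {E₃ : Type*} [NormedAddCommGroup E₃] [NormedSpace ℝ E₃]

variable (G) in
/-- The curve `exp (t (ξ + h)) exp (- t ξ)`, which measures the variation of the exponential. -/
def varCurve (ξ h : 𝔤) (t : ℝ) : G := lieExp G (t • (ξ + h)) * lieExp G (t • (-ξ))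

lemma hasMFDerivAt_varCurve_zero (ξ h : 𝔤) :
    HasMFDerivAt 𝓘(ℝ, ℝ) 𝓘(ℝ, 𝔤) (varCurve G ξ h) 0
      ((1 : ℝ →L[ℝ] ℝ).smulRight h : ℝ →L[ℝ] 𝔤) := by
  have h1 := isLeftCurve_lieExp (G := G) (ξ + h) 0
  have h2 := isLeftCurve_lieExp (G := G) (-ξ) 0
  beta_reduce at h1 h2
  rw [zero_smul, lieExp_zero, leftVec_one] at h1 h2
  have hK := (contMDiff_mul' (𝔤 := 𝔤) (G := G)).mdifferentiable (by simp)
    (lieExp G ((0 : ℝ) • (ξ + h)), lieExp G ((0 : ℝ) • (-ξ)))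
  have hd : MDifferentiableAt 𝓘(ℝ, ℝ) 𝓘(ℝ, 𝔤) (varCurve G ξ h) 0 :=
    MDifferentiableAt.comp (f := fun t : ℝ => (lieExp G (t • (ξ + h)), lieExp G (t • (-ξ)))) 0 hK
      (h1.mdifferentiableAt.prodMk h2.mdifferentiableAt)
  have h3 : tder ℝ 𝔤 (varCurve G ξ h) 0 = ((1 : ℝ →L[ℝ] ℝ).smulRight h : ℝ →L[ℝ] 𝔤) := by
    ext
    have e1 : tder ℝ 𝔤 (fun t : ℝ => lieExp G (t • (ξ + h))) 0 =
      ((1 : ℝ →L[ℝ] ℝ).smulRight (ξ + h) : ℝ →L[ℝ] 𝔤) := h1.mfderiv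
    have e2 : tder ℝ 𝔤 (fun t : ℝ => lieExp G (t • (-ξ))) 0 =
      ((1 : ℝ →L[ℝ] ℝ).smulRight (-ξ) : ℝ →L[ℝ] 𝔤) := h2.mfderiv
    have := tder_prod hK h1.mdifferentiableAt h2.mdifferentiableAt (1 : ℝ)
    rw [e1, e2] at this
    simp only [zero_smul, lieExp_zero, mul_one, one_mul, tder_id] at this
    refine this.trans ?_
    simp
  rw [← h3]
  exact hd.hasMFDerivAt

/-- This cocycle identity reduces the velocity at time t to the velocity at time 0, conjugated by
exp(tξ). -/
lemma varCurve_add (ξ h : 𝔤) (t s : ℝ) : varCurve G ξ h (t + s) =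
    varCurve G ξ h t * (lieExp G (t • ξ) * varCurve G ξ h s * (lieExp G (t • ξ))⁻¹) := by
  have e : lieExp G (t • (-ξ)) = (lieExp G (t • ξ))⁻¹ := by rw [smul_neg, lieExp_neg]
  have e2 : lieExp G ((t + s) • (-ξ)) = lieExp G (s • (-ξ)) * lieExp G (t • (-ξ)) := by
    rw [add_comm, lieExp_add_smul]
  simp only [varCurve, lieExp_add_smul, e2, e]
  group

lemma hasDerivAt_varCurve {F : G → E₃} (hF : ContMDiff 𝓘(ℝ, 𝔤) 𝓘(ℝ, E₃) ∞ F) (ξ h : 𝔤) (t : ℝ) :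
    HasDerivAt (fun s => F (varCurve G ξ h s))
      (tder 𝔤 E₃ (fun x => F (varCurve G ξ h t * x)) 1 (Ad (lieExp G (t • ξ)) h)) t := by
  have hm : ContMDiff 𝓘(ℝ, 𝔤) 𝓘(ℝ, E₃) ∞ (fun x => F (varCurve G ξ h t * x)) :=
    hF.comp contMDiff_mul_left
  have hm2 : ContMDiff 𝓘(ℝ, 𝔤) 𝓘(ℝ, E₃) ∞ (fun x => F (varCurve G ξ h t *
    (lieExp G (t • ξ) * x * (lieExp G (t • ξ))⁻¹))) := hm.comp (contMDiff_conj (lieExp G (t • ξ)))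
  have h0 : varCurve G ξ h 0 = 1 := by simp [varCurve, lieExp_zero]
  have h1 := hasDerivAt_of_curve (F := fun x => F (varCurve G ξ h t *
    (lieExp G (t • ξ) * x * (lieExp G (t • ξ))⁻¹))) (hasMFDerivAt_varCurve_zero (G := G) ξ h)
    (mdiff_of_contMDiff hm2 _)
  rw [h0, ← tder_Ad (F := fun x => F (varCurve G ξ h t * x)) (mdiff_of_contMDiff hm 1)] at h1
  simp only [← varCurve_add] at h1
  have h2 := HasDerivAt.comp_sub_const (f := fun s => F (varCurve G ξ h (t + s))) t t
    (by rw [sub_self]; exact h1)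
  simpa using h2

variable [CompactSpace G]

/-- The bound is uniform over the group by compactness; it replaces a Lipschitz estimate for an
invariant metric. -/
lemma exists_bound_left {F : G → E₃} (hF : ContMDiff 𝓘(ℝ, 𝔤) 𝓘(ℝ, E₃) ∞ F) :
    ∃ C : ℝ, 0 ≤ C ∧ ∀ g : G, ‖tder 𝔤 E₃ (fun x => F (g * x)) 1‖ ≤ C := by
  have hc : Continuous (fun g : G => tder 𝔤 E₃ (fun x => F (g * x)) 1) :=
    (contMDiff_tder_right (H := fun z : G × G => F (z.1 * z.2)) (hF.comp contMDiff_mul') 1).continuous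
  obtain ⟨C, hC⟩ := isCompact_univ.exists_bound_of_continuousOn hc.continuousOn
  exact ⟨C, (norm_nonneg _).trans (hC 1 trivial), fun g => hC g trivial⟩

lemma exists_bound_Ad (ξ : 𝔤) :
    ∃ C : ℝ, 0 ≤ C ∧ ∀ t ∈ Set.Icc (0 : ℝ) 1, ‖(Ad (lieExp G (t • ξ)) : 𝔤 →L[ℝ] 𝔤)‖ ≤ C := by
  have hc : Continuous (fun t : ℝ => (Ad (lieExp G (t • ξ)) : 𝔤 →L[ℝ] 𝔤)) :=
    continuous_iff_continuousAt.2 fun t => (hasDerivAt_Ad_lieExp ξ t).continuousAt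
  obtain ⟨C, hC⟩ := (isCompact_Icc (a := (0 : ℝ)) (b := 1)).exists_bound_of_continuousOn
    hc.continuousOn
  exact ⟨C, (norm_nonneg _).trans (hC 0 (by simp)), hC⟩

lemma varCurve_zero (ξ h : 𝔤) : varCurve G ξ h 0 = 1 := by simp [varCurve, lieExp_zero]

/-- Take a bump function equal to 1 at the identity and supported in `O`. Along the curve its
derivative is O(‖h‖) uniformly in t, so for small h it cannot fall from 1 to 0 within unit time. -/
lemma eventually_varCurve_mem (ξ : 𝔤) {O : Set G} (hO : O ∈ nhds (1 : G)) :
    ∀ᶠ h in nhds (0 : 𝔤), ∀ t ∈ Set.Icc (0 : ℝ) 1, varCurve G ξ h t ∈ O := by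
  obtain ⟨χ, hχ, hχ1, hχO⟩ := exists_contMDiff_bump (E := 𝔤) hO
  obtain ⟨C, hC0, hC⟩ := exists_bound_left hχ
  obtain ⟨D, hD0, hD⟩ := exists_bound_Ad (G := G) ξ
  have hlim : Filter.Tendsto (fun h : 𝔤 => C * (D * ‖h‖)) (nhds 0) (nhds 0) := by
    have : Continuous (fun h : 𝔤 => C * (D * ‖h‖)) := by fun_prop
    simpa using this.tendsto 0
  filter_upwards [hlim.eventually (gt_mem_nhds one_pos)] with h hh t ht
  apply hχO
  intro hzero
  have hbound := norm_image_sub_le_of_norm_deriv_le_segment' (f := fun s => χ (varCurve G ξ h s))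
    (a := 0) (b := 1) (C := C * (D * ‖h‖))
    (fun s _ => (hasDerivAt_varCurve hχ ξ h s).hasDerivWithinAt)
    (fun s hs => by
      refine (ContinuousLinearMap.le_opNorm _ _).trans ?_
      refine mul_le_mul (hC _) ?_ (norm_nonneg _) hC0
      exact (ContinuousLinearMap.le_opNorm _ _).trans
        (mul_le_mul_of_nonneg_right (hD s (Set.Ico_subset_Icc_self hs)) (norm_nonneg _))) t ht
  rw [hzero, varCurve_zero, hχ1, sub_zero] at hbound
  have : C * (D * ‖h‖) * t ≤ C * (D * ‖h‖) * 1 :=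
    mul_le_mul_of_nonneg_left ht.2 (by positivity)
  norm_num at hbound
  linarith

/-- The curve F(varCurve t) is compared with t S₁(t ad ξ) h, whose velocity is Ad(exp tξ) h. The
velocities differ by a small operator applied to Ad(exp tξ) h, because the curve stays near 1 and F
has identity differential there; the mean value inequality then bounds the difference by ε‖h‖. -/
lemma hasFDerivAt_varCurve_one {F : G → 𝔤} (hF : ContMDiff 𝓘(ℝ, 𝔤) 𝓘(ℝ, 𝔤) ∞ F)
    (hF1 : tder 𝔤 𝔤 F 1 = ContinuousLinearMap.id ℝ 𝔤) (ξ : 𝔤) :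
    HasFDerivAt (fun h => F (varCurve G ξ h 1)) (expTail 1 (adL G ξ)) 0 := by
  obtain ⟨D, hD0, hD⟩ := exists_bound_Ad (G := G) ξ
  have hW : Continuous (fun g : G => tder 𝔤 𝔤 (fun x => F (g * x)) 1) :=
    (contMDiff_tder_right (H := fun z : G × G => F (z.1 * z.2)) (hF.comp contMDiff_mul') 1).continuous
  have hv0 : varCurve G ξ 0 1 = 1 := by simp [varCurve, lieExp_neg]
  rw [hasFDerivAt_iff_isLittleO_nhds_zero, Asymptotics.isLittleO_iff]
  intro ε hε
  -- `D` bounds Ad along the curve; the extra 1 keeps the denominator positive when D = 0.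
  have hε' : 0 < ε / (D + 1) := by positivity
  have hO : {g : G | ‖tder 𝔤 𝔤 (fun x => F (g * x)) 1 - ContinuousLinearMap.id ℝ 𝔤‖ < ε / (D + 1)}
      ∈ nhds (1 : G) := by
    have hc : ContinuousAt (fun g : G => ‖tder 𝔤 𝔤 (fun x => F (g * x)) 1 -
      ContinuousLinearMap.id ℝ 𝔤‖) 1 := (hW.sub continuous_const).norm.continuousAt
    refine hc.eventually (gt_mem_nhds ?_)
    simp only [one_mul]
    rw [hF1, sub_self, norm_zero]
    exact hε'
  filter_upwards [eventually_varCurve_mem ξ hO] with h hh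
  have hder : ∀ t ∈ Set.Icc (0 : ℝ) 1, HasDerivWithinAt
      (fun s : ℝ => F (varCurve G ξ h s) - (s • expTail 1 (s • adL G ξ)) h)
      (tder 𝔤 𝔤 (fun x => F (varCurve G ξ h t * x)) 1 (Ad (lieExp G (t • ξ)) h) -
        Ad (lieExp G (t • ξ)) h) (Set.Icc 0 1) t := by
    intro t _
    have h1 := (hasDerivAt_smul_expTail_one (adL G ξ) t).clm_apply (hasDerivAt_const t h)
    rw [← Ad_lieExp_smul] at h1
    simp only [map_zero, add_zero] at h1
    exact ((hasDerivAt_varCurve hF ξ h t).sub h1).hasDerivWithinAt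
  have hbound := norm_image_sub_le_of_norm_deriv_le_segment' hder
    (C := ε / (D + 1) * (D * ‖h‖)) (fun s hs => by
      have hs' := Set.Ico_subset_Icc_self hs
      have := (tder 𝔤 𝔤 (fun x => F (varCurve G ξ h s * x)) 1 -
        ContinuousLinearMap.id ℝ 𝔤).le_opNorm (Ad (lieExp G (s • ξ)) h)
      refine le_trans this (mul_le_mul (hh s hs').le ?_ (norm_nonneg _) hε'.le)
      exact (ContinuousLinearMap.le_opNorm _ _).trans
        (mul_le_mul_of_nonneg_right (hD s hs') (norm_nonneg _))) 1 (by simp)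
  simp only [varCurve_zero, one_smul, zero_smul, zero_apply, sub_zero,
    mul_one] at hbound
  rw [zero_add, hv0]
  have e : F (varCurve G ξ h 1) - F 1 - expTail 1 (adL G ξ) h =
    F (varCurve G ξ h 1) - expTail 1 (adL G ξ) h - F 1 := by abel
  rw [e]
  refine hbound.trans ?_
  have : ε / (D + 1) * (D * ‖h‖) = ε * ‖h‖ * (D / (D + 1)) := by field_simp
  rw [this]
  refine mul_le_of_le_one_right (by positivity) ?_
  rw [div_le_one (by positivity)]
  linarith

lemma tder_varCurve_one (ξ : 𝔤) :
    HasMFDerivAt 𝓘(ℝ, 𝔤) 𝓘(ℝ, 𝔤) (fun h => varCurve G ξ h 1) 0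
      (expTail 1 (adL G ξ) : 𝔤 →L[ℝ] 𝔤) := by
  have hv0 : varCurve G ξ 0 1 = 1 := by simp [varCurve, lieExp_neg]
  have hcont : ContinuousAt (fun h => varCurve G ξ h 1) 0 := by
    intro O hO
    beta_reduce at hO
    rw [hv0] at hO
    exact (eventually_varCurve_mem ξ hO).mono fun h hh => hh 1 (by simp)
  obtain ⟨F, hF, hFe⟩ := exists_contMDiff_eventuallyEq_extChartAt (E := 𝔤) (1 : G)
  have hF1 : tder 𝔤 𝔤 F 1 = ContinuousLinearMap.id ℝ 𝔤 := by
    rw [tder_congr hFe, tder_extChartAt_self]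
  have h := hasFDerivAt_varCurve_one hF hF1 ξ
  have h2 : HasFDerivAt (fun h => extChartAt 𝓘(ℝ, 𝔤) (varCurve G ξ 0 1) (varCurve G ξ h 1))
      (expTail 1 (adL G ξ)) 0 := by
    refine h.congr_of_eventuallyEq ?_
    rw [← hv0] at hFe
    filter_upwards [hcont.eventually hFe] with x hx
    rw [hx, hv0]
  exact ⟨hcont, h2.hasFDerivWithinAt⟩

/-- For ξ fixed, exp x is the product of `varCurve G ξ (x - ξ) 1` and exp ξ, so the derivative of
the first factor is followed by right translation. -/
lemma hasMFDerivAt_lieExp (ξ : 𝔤) :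
    HasMFDerivAt 𝓘(ℝ, 𝔤) 𝓘(ℝ, 𝔤) (lieExp G) ξ
      ((tder 𝔤 𝔤 (fun x : G => x * lieExp G ξ) 1).comp (expTail 1 (adL G ξ)) : 𝔤 →L[ℝ] 𝔤) := by
  have hv0 : varCurve G ξ 0 1 = 1 := by simp [varCurve, lieExp_neg]
  have hsub : HasMFDerivAt 𝓘(ℝ, 𝔤) 𝓘(ℝ, 𝔤) (fun x : 𝔤 => x - ξ) ξ
      (ContinuousLinearMap.id ℝ 𝔤 : 𝔤 →L[ℝ] 𝔤) :=
    ((hasFDerivAt_id ξ).sub_const ξ).hasMFDerivAt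
  have h1 : HasMFDerivAt 𝓘(ℝ, 𝔤) 𝓘(ℝ, 𝔤) (fun h => varCurve G ξ h 1) (ξ - ξ)
      (expTail 1 (adL G ξ) : 𝔤 →L[ℝ] 𝔤) := by
    rw [sub_self]; exact tder_varCurve_one ξ
  have h2 := HasMFDerivAt.comp (f := fun x : 𝔤 => x - ξ) ξ h1 hsub
  have hr : MDifferentiableAt 𝓘(ℝ, 𝔤) 𝓘(ℝ, 𝔤) (fun x : G => x * lieExp G ξ)
    (varCurve G ξ (ξ - ξ) 1) := mdiff_mul_right _ _
  have h3 := hr.hasMFDerivAt.comp ξ h2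
  have hfun : (fun x : G => x * lieExp G ξ) ∘ ((fun h => varCurve G ξ h 1) ∘ fun x : 𝔤 => x - ξ) =
      lieExp G := by
    ext x
    simp [varCurve, lieExp_neg]
  have hd : (tder 𝔤 𝔤 (fun x : G => x * lieExp G ξ) 1).comp (expTail 1 (adL G ξ)) =
      (tder 𝔤 𝔤 (fun x : G => x * lieExp G ξ) (varCurve G ξ (ξ - ξ) 1)).comp
        ((expTail 1 (adL G ξ)).comp (ContinuousLinearMap.id ℝ 𝔤)) := by
    rw [sub_self, hv0, ContinuousLinearMap.comp_id]
  rw [hd]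
  exact HasMFDerivAt.congr_of_eventuallyEq h3
    (Filter.Eventually.of_forall fun x => congrFun hfun.symm x)

lemma tder_lieExp_apply (ξ η : 𝔤) :
    tder 𝔤 𝔤 (lieExp G) ξ η = rightVec (expTail 1 (adL G ξ) η) (lieExp G ξ) := by
  have h : tder 𝔤 𝔤 (lieExp G) ξ = (tder 𝔤 𝔤 (fun x : G => x * lieExp G ξ) 1).comp
    (expTail 1 (adL G ξ)) := (hasMFDerivAt_lieExp ξ).mfderiv
  rw [h]; rfl

lemma continuous_lieExp : Continuous (lieExp G : 𝔤 → G) :=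
  continuous_iff_continuousAt.2 fun ξ => (hasMFDerivAt_lieExp ξ).continuousAt

end Exp

/-! ### Smoothness and regular points of the exponential map -/

section Smooth
universe u
variable {𝔤 : Type u} [NormedAddCommGroup 𝔤] [NormedSpace ℝ 𝔤] [FiniteDimensional ℝ 𝔤]
  {G : Type*} [TopologicalSpace G] [ChartedSpace 𝔤 G] [Group G] [LieGroup 𝓘(ℝ, 𝔤) ∞ G] [T2Space G]
  [CompactSpace G]

/-- Bootstrapping: the derivative of F ∘ exp is (F' ∘ exp) composed with S₁(ad ξ), where F' is the
smooth operator-valued function g ↦ d_x F(xg) at x = 1. Thus n derivatives for all such functions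
give n + 1. The target varies in the induction, and keeping it in the universe of 𝔤 is stable under
passing to operators. -/
lemma contDiff_comp_lieExp (n : ℕ) : ∀ {E₃ : Type u} [NormedAddCommGroup E₃] [NormedSpace ℝ E₃]
    {F : G → E₃}, ContMDiff 𝓘(ℝ, 𝔤) 𝓘(ℝ, E₃) ∞ F → ContDiff ℝ n (fun ξ : 𝔤 => F (lieExp G ξ)) := by
  induction n with
  | zero =>
    intro E₃ _ _ F hF
    exact contDiff_zero.2 (hF.continuous.comp continuous_lieExp)
  | succ n ih =>
    intro E₃ _ _ F hF
    have hR : ContMDiff 𝓘(ℝ, 𝔤) 𝓘(ℝ, 𝔤 →L[ℝ] E₃) ∞ (fun g : G => tder 𝔤 E₃ (fun x => F (x * g)) 1) :=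
      contMDiff_tder_left (H := fun z : G × G => F (z.1 * z.2)) (hF.comp contMDiff_mul') 1
    have hmd : ∀ ξ : 𝔤, MDifferentiableAt 𝓘(ℝ, 𝔤) 𝓘(ℝ, E₃) (fun ξ : 𝔤 => F (lieExp G ξ)) ξ :=
      fun ξ => (mdiff_of_contMDiff hF _).comp ξ (hasMFDerivAt_lieExp ξ).mdifferentiableAt
    push_cast
    rw [contDiff_succ_iff_fderiv]
    refine ⟨fun ξ => (hmd ξ).differentiableAt, by simp, ?_⟩
    have hfd : fderiv ℝ (fun ξ : 𝔤 => F (lieExp G ξ)) = fun ξ =>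
        (tder 𝔤 E₃ (fun x => F (x * lieExp G ξ)) 1).comp (expTail 1 (adL G ξ)) := by
      ext ξ η
      rw [← tder_eq_fderiv, tder_comp_apply (mdiff_of_contMDiff hF _)
        (hasMFDerivAt_lieExp ξ).mdifferentiableAt, tder_lieExp_apply,
        tder_rightVec (mdiff_of_contMDiff hF _)]
      rfl
    rw [hfd]
    refine (ih hR).clm_comp ?_
    exact ((contDiff_expTail 1).comp (adL (𝔤 := 𝔤) G).contDiff).of_le ENat.LEInfty.out

variable (𝔤 G) in
/-- The exponential map of a compact Lie group is smooth. -/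
lemma contMDiff_lieExp : ContMDiff 𝓘(ℝ, 𝔤) 𝓘(ℝ, 𝔤) ∞ (lieExp G : 𝔤 → G) := by
  intro ξ
  rw [contMDiffAt_iff_target]
  refine ⟨continuous_lieExp.continuousAt, ?_⟩
  obtain ⟨F, hF, hFe⟩ := exists_contMDiff_eventuallyEq_extChartAt (E := 𝔤) (lieExp G ξ)
  have h1 : ContDiff ℝ ∞ (fun ξ : 𝔤 => F (lieExp G ξ)) :=
    contDiff_infty.2 fun n => contDiff_comp_lieExp n hF
  refine h1.contMDiff.contMDiffAt.congr_of_eventuallyEq ?_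
  filter_upwards [continuous_lieExp.continuousAt.eventually hFe] with x hx
  exact hx.symm

lemma rightVec_bijective (g : G) :
    Function.Bijective (tder 𝔤 𝔤 (fun x : G => x * g) 1) := by
  have hinj : Function.Injective (tder 𝔤 𝔤 (fun x : G => x * g) 1) := by
    refine Function.LeftInverse.injective (g := tder 𝔤 𝔤 (fun x : G => x * g⁻¹) g) fun η => ?_
    have h := tder_rightVec (g := g) (mdiff_mul_right (𝔤 := 𝔤) g⁻¹ g) η
    simp only [mul_inv_cancel_right, tder_id] at h
    exact h
  exact ⟨hinj, (LinearMap.injective_iff_surjective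
    (f := (tder 𝔤 𝔤 (fun x : G => x * g) 1).toLinearMap)).1 hinj⟩

/-- Right translation has a bijective differential, so only the factor S₁(ad ξ) can degenerate. -/
lemma mem_expRegular_iff {ξ : 𝔤} : ξ ∈ expRegular G ↔ IsUnit (expTail 1 (adL G ξ)) := by
  have h : tder 𝔤 𝔤 (lieExp G) ξ = (tder 𝔤 𝔤 (fun x : G => x * lieExp G ξ) 1).comp
    (expTail 1 (adL G ξ)) := (hasMFDerivAt_lieExp ξ).mfderiv
  have hR := rightVec_bijective (𝔤 := 𝔤) (lieExp G ξ)
  change Function.Bijective (tder 𝔤 𝔤 (lieExp G) ξ) ↔ _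
  rw [h, ContinuousLinearMap.isUnit_iff_bijective]
  exact Function.Bijective.of_comp_iff' hR _

end Smooth

/-! ### Eigenvectors of skew-Hermitian matrices -/

section JointEigen
variable {ι : Type*} [Fintype ι] [DecidableEq ι]

lemma isSymmetric_toEuclideanLin_I_smul {A : Matrix ι ι ℂ} (hA : A.conjTranspose = -A) :
    (Matrix.toEuclideanLin (Complex.I • A)).IsSymmetric := by
  rw [Matrix.isSymmetric_toEuclideanLin_iff]
  rw [Matrix.IsHermitian, Matrix.conjTranspose_smul, hA]
  simp

/-- A linear map vanishes if it vanishes on the joint eigenvectors of two commuting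
skew-Hermitian matrices. -/
lemma linearMap_eq_zero_of_joint_eigenvectors {A W : Matrix ι ι ℂ} (hA : A.conjTranspose = -A)
    (hW : W.conjTranspose = -W) (hAW : A * W = W * A) {X : Type*} [AddCommGroup X] [Module ℂ X]
    (L : (ι → ℂ) →ₗ[ℂ] X)
    (h : ∀ (α δ : ℂ) (v : ι → ℂ), A.mulVec v = α • v → W.mulVec v = δ • v → L v = 0) : L = 0 := by
  have hcomm : Commute (Matrix.toEuclideanLin (Complex.I • A))
      (Matrix.toEuclideanLin (Complex.I • W)) := by
    ext v : 1
    change Matrix.toEuclideanLin _ (Matrix.toEuclideanLin _ v) =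
      Matrix.toEuclideanLin _ (Matrix.toEuclideanLin _ v)
    rw [Matrix.toLpLin_apply, Matrix.toLpLin_apply, Matrix.toLpLin_apply,
      Matrix.toLpLin_apply]
    simp only [Matrix.mulVec_mulVec, Matrix.smul_mul, Matrix.mul_smul, hAW]
  -- Multiplication by i makes the two matrices Hermitian; as they commute, their joint eigenspaces
  -- span.
  have htop := (isSymmetric_toEuclideanLin_I_smul hA).iSup_iSup_eigenspace_inf_eigenspace_eq_top_of_commute
    (isSymmetric_toEuclideanLin_I_smul hW) hcomm
  have key : ∀ {C : Matrix ι ι ℂ} {μ : ℂ} {v : EuclideanSpace ℂ ι},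
      v ∈ Module.End.eigenspace (Matrix.toEuclideanLin (Complex.I • C)) μ →
      C.mulVec v.ofLp = (-Complex.I * μ) • v.ofLp := by
    intro C μ v hv
    rw [Module.End.mem_eigenspace_iff, Matrix.toLpLin_apply] at hv
    have h2 : Complex.I • C.mulVec v.ofLp = μ • v.ofLp := by
      rw [← Matrix.smul_mulVec]; exact congrArg WithLp.ofLp hv
    rw [mul_smul, ← h2, smul_smul]
    simp
  have hle : (⊤ : Submodule ℂ (EuclideanSpace ℂ ι)) ≤
      LinearMap.ker (L ∘ₗ (WithLp.linearEquiv 2 ℂ (ι → ℂ)).toLinearMap) := by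
    rw [← htop]
    refine iSup_le fun α => iSup_le fun γ => fun v hv => ?_
    exact h _ _ _ (key hv.1) (key hv.2)
  ext1 v
  ext1
  have := hle (x := WithLp.toLp 2 (Pi.single v (1:ℂ))) trivial
  simpa using this

lemma linearMap_eq_zero_of_eigenvectors {A : Matrix ι ι ℂ} (hA : A.conjTranspose = -A)
    {X : Type*} [AddCommGroup X] [Module ℂ X] (L : (ι → ℂ) →ₗ[ℂ] X)
    (h : ∀ (α : ℂ) (v : ι → ℂ), A.mulVec v = α • v → L v = 0) : L = 0 :=
  linearMap_eq_zero_of_joint_eigenvectors hA hA rfl L fun α _ v h1 _ => h α v h1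

lemma matrix_eq_of_eigenvectors {A X Y : Matrix ι ι ℂ} (hA : A.conjTranspose = -A)
    (h : ∀ (α : ℂ) (v : ι → ℂ), A.mulVec v = α • v → X.mulVec v = Y.mulVec v) : X = Y := by
  have := linearMap_eq_zero_of_eigenvectors hA (Matrix.mulVecLin X - Matrix.mulVecLin Y)
    fun α v hv => by simp [h α v hv]
  exact Matrix.mulVec_injective (funext fun v => sub_eq_zero.1 (LinearMap.congr_fun this v))

open scoped Matrix.Norms.L2Operator in
-- The spectrum is finite, so `g` coincides on it with a Lagrange interpolation polynomial, and a
-- polynomial in A acts on an eigenvector through its value at the eigenvalue.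
lemma cfc_mulVec_of_eigenvector {A : Matrix ι ι ℂ} (hA : IsStarNormal A) (g : ℂ → ℂ) {α : ℂ}
    {v : ι → ℂ} (hv : A.mulVec v = α • v) :
    (cfc (p := IsStarNormal) g A).mulVec v = g α • v := by
  by_cases hv0 : v = 0
  · simp [hv0]
  have hα : α ∈ spectrum ℂ A := by
    rw [← Matrix.spectrum_toLin', ← Module.End.hasEigenvalue_iff_mem_spectrum]
    exact Module.End.hasEigenvalue_of_hasEigenvector
      (x := v) ⟨Module.End.mem_eigenspace_iff.2 (by simpa using hv), hv0⟩
  have hfin : (spectrum ℂ A).Finite := Matrix.finite_spectrum A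
  set s := hfin.toFinset
  set q := Lagrange.interpolate s id g
  have hq : ∀ z ∈ spectrum ℂ A, g z = q.eval z := fun z hz =>
    (Lagrange.eval_interpolate_at_node (v := id) g Function.injective_id.injOn
      (hfin.mem_toFinset.2 hz)).symm
  have hqv : ∀ p : Polynomial ℂ, (Polynomial.aeval A p).mulVec v = p.eval α • v := by
    intro p
    induction p using Polynomial.induction_on' with
    | add p q hp hq => simp [Matrix.add_mulVec, hp, hq, add_smul]
    | monomial n c =>
      have : ∀ n : ℕ, (A ^ n).mulVec v = α ^ n • v := by
        intro n
        induction n with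
        | zero => simp
        | succ n ih => rw [pow_succ, ← Matrix.mulVec_mulVec, hv, Matrix.mulVec_smul, ih, smul_smul,
            pow_succ']
      rw [Polynomial.aeval_monomial, ← Algebra.smul_def, Matrix.smul_mulVec, this,
        Polynomial.eval_monomial, smul_smul]
  rw [cfc_congr (g := q.eval) hq, cfc_polynomial q A, hqv, hq α hα]

end JointEigen

/-! ### Identities for the function φ -/

section Scalar

lemma mul_expTail_one (z : ℂ) : z * expTail 1 z = Complex.exp z - 1 := by
  rw [mul_expTail_succ 0 z, expTail_zero_left, Complex.exp_eq_exp_ℂ]; simp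

lemma mul_expTail_two (z : ℂ) : z * expTail 2 z = expTail 1 z - 1 := by
  rw [mul_expTail_succ 1 z]; simp

/-- From eᶻ - 1 = 2 e^{z/2} sinh(z/2). -/
lemma sinh_half_ne_zero {z : ℂ} (h : expTail 1 z ≠ 0) (hz : z ≠ 0) : Complex.sinh (z / 2) ≠ 0 := by
  intro h0
  have h1 : Complex.exp z - 1 = 2 * Complex.exp (z / 2) * Complex.sinh (z / 2) := by
    rw [Complex.sinh]
    have : Complex.exp z = Complex.exp (z / 2) * Complex.exp (z / 2) := by
      rw [← Complex.exp_add]; ring_nf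
    have h2 : Complex.exp (z / 2) * Complex.exp (-(z / 2)) = 1 := by
      rw [← Complex.exp_add]; simp
    rw [this]
    linear_combination h2
  rw [h0, mul_zero, ← mul_expTail_one] at h1
  exact mul_ne_zero hz h h1

lemma phi_zero : phi 0 = 0 := by simp [phi]

lemma phi_neg (z : ℂ) : phi (-z) = -phi z := by
  simp only [phi, neg_div, Complex.cosh_neg, Complex.sinh_neg, div_neg]; ring

/-- This form has no singularity at 0, where it gives (1/2)/1 - 1/2 = 0, in agreement with the value
of `phi` at 0. -/
lemma phi_eq {z : ℂ} (h : expTail 1 z ≠ 0) : phi z = expTail 2 z / expTail 1 z - 1 / 2 := by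
  by_cases hz : z = 0
  · subst hz
    rw [phi_zero, expTail_succ_zero, expTail_succ_zero]
    simp [Nat.factorial]
  have hs := sinh_half_ne_zero h hz
  have h1 := mul_expTail_one z
  have h2 := mul_expTail_two z
  have e1 : Complex.exp z = (Complex.cosh (z / 2) + Complex.sinh (z / 2)) ^ 2 := by
    rw [Complex.cosh_add_sinh, ← Complex.exp_nat_mul]; congr 1; push_cast; ring
  have e2 := Complex.cosh_sq_sub_sinh_sq (z / 2)
  have h1' : expTail 1 z = (Complex.exp z - 1) / z := by rw [← h1]; field_simp
  have h2' : expTail 2 z = (expTail 1 z - 1) / z := by rw [← h2]; field_simp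
  have h3 : Complex.exp z - 1 = 2 * Complex.sinh (z / 2) *
      (Complex.cosh (z / 2) + Complex.sinh (z / 2)) := by
    rw [e1]; linear_combination e2
  have h4 : Complex.cosh (z / 2) + Complex.sinh (z / 2) ≠ 0 := by
    rw [Complex.cosh_add_sinh]; exact Complex.exp_ne_zero _
  rw [h2', h1', h3, phi]
  field_simp
  linear_combination -z * e2

/-- The derivative of `phi`. -/
def phiDeriv (z : ℂ) : ℂ := if z = 0 then -1 / 12 else -1 / z ^ 2 + 1 / (4 * Complex.sinh (z / 2) ^ 2)

lemma phiDeriv_neg (z : ℂ) : phiDeriv (-z) = phiDeriv z := by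
  simp [phiDeriv, neg_div]

lemma hasDerivAt_expTail_zero (k : ℕ) :
    HasDerivAt (expTail k : ℂ → ℂ) ((((k + 1).factorial : ℝ)⁻¹ : ℝ) : ℂ) 0 := by
  have h : (expTail k : ℂ → ℂ) = fun z => z * expTail (k + 1) z + (((k.factorial : ℝ)⁻¹ : ℝ) : ℂ) := by
    ext z; rw [mul_expTail_succ]; simp
  rw [hasDerivAt_iff_tendsto_slope]
  have hc : Filter.Tendsto (expTail (k + 1) : ℂ → ℂ) (nhdsWithin 0 {0}ᶜ)
      (nhds (expTail (k + 1) 0)) :=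
    ((contDiff_expTail (k + 1)).continuous.tendsto 0).mono_left nhdsWithin_le_nhds
  rw [expTail_succ_zero] at hc
  refine Filter.Tendsto.congr' ?_ (by simpa using hc)
  filter_upwards [self_mem_nhdsWithin] with z hz
  have hz' : z ≠ 0 := hz
  rw [slope_def_field, h]
  field_simp
  simp

lemma hasDerivAt_phi {z : ℂ} (h : expTail 1 z ≠ 0) : HasDerivAt phi (phiDeriv z) z := by
  by_cases hz : z = 0
  · subst hz
    have h1 := (hasDerivAt_expTail_zero 2).div (hasDerivAt_expTail_zero 1) h
    have h2 := h1.sub_const (1 / 2)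
    rw [expTail_succ_zero, expTail_succ_zero] at h2
    have hev : phi =ᶠ[nhds 0] fun z => (expTail 2 / expTail 1 : ℂ → ℂ) z - 1 / 2 := by
      filter_upwards [(contDiff_expTail 1).continuous.continuousAt.eventually_ne h] with z hz
      exact phi_eq hz
    have h3 := h2.congr_of_eventuallyEq hev
    -- At 0 one has S₁ = 1, S₂ = 1/2, S₁' = 1/2 and S₂' = 1/6, so the quotient rule yields 1/6 - 1/4
    -- = -1/12.
    refine h3.congr_deriv ?_
    simp [phiDeriv, Nat.factorial]
    norm_num
  · have hs := sinh_half_ne_zero h hz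
    have hh : HasDerivAt (fun s : ℂ => s / 2) (1 / 2) z := (hasDerivAt_id z).div_const 2
    have h1 := ((hasDerivAt_const z (1:ℂ)).div (hasDerivAt_id z) hz).sub
      (((hh.ccosh).div (hh.csinh) hs).const_mul (1 / 2 : ℂ))
    refine (h1.congr_of_eventuallyEq (Filter.Eventually.of_forall fun s => ?_)).congr_deriv ?_
    · simp [phi]
    · have e2 := Complex.cosh_sq_sub_sinh_sq (z / 2)
      simp only [phiDeriv, hz, if_false, id]
      field_simp
      linear_combination (4 * z ^ 2) * e2

/-- With p, q, r the values of coth at the half-arguments, the mixed terms cancel and leave (α + β +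
γ)/(αβγ) - (pq + qr + rp)/4. The first term vanishes by hypothesis, and pq + qr + rp = -1 is the
addition theorem. -/
lemma phi_add_relation {α β γ : ℂ} (h : α + β + γ = 0) (hα : expTail 1 α ≠ 0)
    (hβ : expTail 1 β ≠ 0) (hγ : expTail 1 γ ≠ 0) (h1 : α ≠ 0) (h2 : β ≠ 0) (h3 : γ ≠ 0) :
    (phi α + phi β) / γ + (phi β + phi γ) / α + (phi γ + phi α) / β
      - (phi β * phi γ + phi α * phi γ + phi α * phi β) = 1 / 4 := by
  have sα := sinh_half_ne_zero hα h1
  have sβ := sinh_half_ne_zero hβ h2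
  have sγ := sinh_half_ne_zero hγ h3
  have hg : γ = -(α + β) := by linear_combination h
  have hg2 : γ / 2 = -(α / 2 + β / 2) := by rw [hg]; ring
  set p := Complex.cosh (α / 2) / Complex.sinh (α / 2) with hp
  set q := Complex.cosh (β / 2) / Complex.sinh (β / 2) with hq
  set r := Complex.cosh (γ / 2) / Complex.sinh (γ / 2) with hr
  have hpqr : p * q + q * r + r * p = -1 := by
    have e1 : Complex.cosh (γ / 2) = Complex.cosh (α / 2) * Complex.cosh (β / 2) +
      Complex.sinh (α / 2) * Complex.sinh (β / 2) := by rw [hg2, Complex.cosh_neg, Complex.cosh_add]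
    have e2 : Complex.sinh (γ / 2) = -(Complex.sinh (α / 2) * Complex.cosh (β / 2) +
      Complex.cosh (α / 2) * Complex.sinh (β / 2)) := by
      rw [hg2, Complex.sinh_neg, Complex.sinh_add]
    rw [hp, hq, hr]
    field_simp
    rw [e1, e2]
    ring
  have f1 : phi α = 1 / α - 1 / 2 * p := rfl
  have f2 : phi β = 1 / β - 1 / 2 * q := rfl
  have f3 : phi γ = 1 / γ - 1 / 2 * r := rfl
  rw [f1, f2, f3]
  have : (1 / α - 1 / 2 * p + (1 / β - 1 / 2 * q)) / γ + (1 / β - 1 / 2 * q + (1 / γ - 1 / 2 * r)) / α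
    + (1 / γ - 1 / 2 * r + (1 / α - 1 / 2 * p)) / β - ((1 / β - 1 / 2 * q) * (1 / γ - 1 / 2 * r) +
    (1 / α - 1 / 2 * p) * (1 / γ - 1 / 2 * r) + (1 / α - 1 / 2 * p) * (1 / β - 1 / 2 * q)) =
    (α + β + γ) / (α * β * γ) - 1 / 4 * (p * q + q * r + r * p) := by
    field_simp; ring
  rw [this, h, hpqr]; norm_num

/-- The limit of `phi_add_relation` as β tends to 0 and γ to -α. -/
lemma phi_sub_phiDeriv_relation {α : ℂ} (hα : expTail 1 α ≠ 0) (h1 : α ≠ 0) :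
    -phiDeriv α - 2 * phi α / α + phi α ^ 2 = 1 / 4 := by
  have sα := sinh_half_ne_zero hα h1
  have e2 := Complex.cosh_sq_sub_sinh_sq (α / 2)
  simp only [phiDeriv, h1, if_false, phi]
  field_simp
  linear_combination (α ^ 2) * e2 * 4

end Scalar

/-! ### Equivariance and smoothness of φ(ad ξ) -/

section Equivariant
variable {𝔤 : Type*} [NormedAddCommGroup 𝔤] [NormedSpace ℝ 𝔤] [FiniteDimensional ℝ 𝔤]
  {G : Type*} [TopologicalSpace G] [ChartedSpace 𝔤 G] [Group G] [LieGroup 𝓘(ℝ, 𝔤) ∞ G] [T2Space G]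

lemma hasDerivAt_Ad_lieExp_zero (η : 𝔤) :
    HasDerivAt (fun s : ℝ => (Ad (lieExp G (s • η)) : 𝔤 →L[ℝ] 𝔤)) (adL G η) 0 := by
  have h := hasDerivAt_Ad_lieExp (G := G) η 0
  rw [zero_smul, lieExp_zero, Ad_one] at h
  exact h

/-- The infinitesimal form of equivariance of an operator-valued function on the Lie algebra. -/
lemma fderiv_lieBr_of_equivariant {F : 𝔤 → 𝔤 →L[ℝ] 𝔤} {F' : 𝔤 →L[ℝ] 𝔤 →L[ℝ] 𝔤} {ξ : 𝔤}
    (hF : HasFDerivAt F F' ξ)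
    (heq : ∀ g : G, F (Ad g ξ) * (Ad g : 𝔤 →L[ℝ] 𝔤) = (Ad g : 𝔤 →L[ℝ] 𝔤) * F ξ) (η : 𝔤) :
    F' (lieBr G η ξ) = adL G η * F ξ - F ξ * adL G η := by
  have h0 : (Ad (lieExp G ((0 : ℝ) • η)) : 𝔤 →L[ℝ] 𝔤) = 1 := by
    rw [zero_smul, lieExp_zero, Ad_one]; rfl
  have hA := hasDerivAt_Ad_lieExp_zero (G := G) η
  have hAξ : HasDerivAt (fun s : ℝ => Ad (lieExp G (s • η)) ξ) (lieBr G η ξ) 0 := by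
    rw [← adL_apply]; exact hA.clm_apply (hasDerivAt_const 0 ξ) |>.congr_deriv (by simp)
  have hFA : HasDerivAt (fun s : ℝ => F (Ad (lieExp G (s • η)) ξ)) (F' (lieBr G η ξ)) 0 := by
    refine HasFDerivAt.comp_hasDerivAt (f := fun s : ℝ => Ad (lieExp G (s • η)) ξ) 0 ?_ hAξ
    rw [h0]; exact hF
  have h1 := hFA.mul hA
  have h2 := hA.mul_const (F ξ)
  have hfun : ((fun s : ℝ => F (Ad (lieExp G (s • η)) ξ)) *
      fun s : ℝ => (Ad (lieExp G (s • η)) : 𝔤 →L[ℝ] 𝔤)) =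
      fun s : ℝ => (Ad (lieExp G (s • η)) : 𝔤 →L[ℝ] 𝔤) * F ξ := funext fun s => heq _
  rw [hfun] at h1
  have h3 := h1.unique h2
  rw [h0] at h3
  simp only [mul_one, one_apply_eq_self] at h3
  exact eq_sub_of_add_eq h3

lemma adL_Ad_mul (g : G) (ξ : 𝔤) :
    adL G (Ad g ξ) * (Ad g : 𝔤 →L[ℝ] 𝔤) = (Ad g : 𝔤 →L[ℝ] 𝔤) * adL G ξ := by
  ext η
  simp [adL_apply, lieBr_Ad]

/-- The Jacobi identity, obtained as the infinitesimal equivariance of ad. -/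
lemma adL_lieBr (η ξ : 𝔤) : adL G (lieBr G η ξ) = adL G η * adL G ξ - adL G ξ * adL G η :=
  fderiv_lieBr_of_equivariant (adL G).hasFDerivAt (fun g => adL_Ad_mul g ξ) η

/-- The operator `Ad g` as a unit of the algebra of endomorphisms. -/
def AdUnit (g : G) : (𝔤 →L[ℝ] 𝔤)ˣ where
  val := Ad g
  inv := Ad g⁻¹
  val_inv := by ext ξ; exact Ad_Ad_inv g ξ
  inv_val := by ext ξ; exact Ad_inv_Ad g ξ

lemma adL_Ad (g : G) (ξ : 𝔤) :
    adL G (Ad g ξ) = (AdUnit (𝔤 := 𝔤) g).val * adL G ξ * ((AdUnit (𝔤 := 𝔤) g)⁻¹).val := by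
  rw [Units.eq_mul_inv_iff_mul_eq]
  exact adL_Ad_mul g ξ

lemma expTail_conj {𝔸 : Type*} [NormedRing 𝔸] [NormedAlgebra ℝ 𝔸] [CompleteSpace 𝔸] (k : ℕ)
    (u : 𝔸ˣ) (x : 𝔸) : expTail k (u * x * (↑u⁻¹ : 𝔸)) = u * expTail k x * (↑u⁻¹ : 𝔸) := by
  have h := ((hasSum_expTail k x).mul_left (u : 𝔸)).mul_right (↑u⁻¹ : 𝔸)
  refine (h.unique ?_).symm
  have hfun : (fun n : ℕ => (u : 𝔸) * ((((n + k).factorial : ℝ)⁻¹) • x ^ n) * (↑u⁻¹ : 𝔸)) =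
      fun n : ℕ => (((n + k).factorial : ℝ)⁻¹) • (u * x * (↑u⁻¹ : 𝔸)) ^ n := by
    ext n
    rw [Units.conj_pow, mul_smul_comm, smul_mul_assoc]
  rw [hfun]
  exact hasSum_expTail k _

variable (G) in
/-- The operator `φ(ad ξ)`, for regular `ξ`. -/
def phiAd (ξ : 𝔤) : 𝔤 →L[ℝ] 𝔤 :=
  expTail 2 (adL G ξ) * Ring.inverse (expTail 1 (adL G ξ)) - (1 / 2 : ℝ) • 1

lemma commute_expTail {𝔸 : Type*} [NormedRing 𝔸] [NormedAlgebra ℝ 𝔸] [CompleteSpace 𝔸]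
    {x y : 𝔸} (h : Commute y x) (k : ℕ) : Commute y (expTail k x) := by
  have h1 := (hasSum_expTail k x).mul_left y
  have h2 := (hasSum_expTail k x).mul_right y
  have hfun : (fun n : ℕ => y * ((((n + k).factorial : ℝ)⁻¹) • x ^ n)) =
      fun n : ℕ => ((((n + k).factorial : ℝ)⁻¹) • x ^ n) * y := by
    ext n
    rw [mul_smul_comm, smul_mul_assoc, (h.pow_right n).eq]
  rw [hfun] at h1
  exact h1.unique h2

variable [CompactSpace G]

lemma phiAd_add_half_mul {ξ : 𝔤} (hξ : ξ ∈ expRegular G) :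
    (phiAd G ξ + (1 / 2 : ℝ) • 1) * expTail 1 (adL G ξ) = expTail 2 (adL G ξ) := by
  rw [phiAd, sub_add_cancel, mul_assoc, Ring.inverse_mul_cancel _ (mem_expRegular_iff.1 hξ), mul_one]

lemma adL_mul_phiAd (ξ : 𝔤) : adL G ξ * phiAd G ξ = phiAd G ξ * adL G ξ := by
  have h2 := commute_expTail (Commute.refl (adL G ξ)) 2
  have h3 : Commute (adL G ξ) (Ring.inverse (expTail 1 (adL G ξ))) := by
    by_cases hu : IsUnit (expTail 1 (adL G ξ))
    · obtain ⟨u, hu⟩ := hu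
      rw [← hu, Ring.inverse_unit]
      have := commute_expTail (Commute.refl (adL G ξ)) 1
      rw [← hu] at this
      exact this.units_inv_right
    · rw [Ring.inverse_non_unit _ hu]; exact Commute.zero_right _
  exact (h2.mul_right h3).sub_right ((Commute.one_right _).smul_right _)

/-- `(1 - φ(ad ξ) ad ξ) S₁(ad ξ) = (exp (ad ξ) + 1) / 2`. -/
lemma one_sub_phiAd_mul_expTail {ξ : 𝔤} (hξ : ξ ∈ expRegular G) :
    (1 - phiAd G ξ * adL G ξ) * expTail 1 (adL G ξ) =
      (1 / 2 : ℝ) • ((Ad (lieExp G ξ) : 𝔤 →L[ℝ] 𝔤) + 1) := by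
  have h1 := phiAd_add_half_mul hξ
  have h2 : (Ad (lieExp G ξ) : 𝔤 →L[ℝ] 𝔤) = expTail 0 (adL G ξ) := by
    have := Ad_lieExp_smul (G := G) ξ 1
    rwa [one_smul, one_smul, ← expTail_zero_left] at this
  have h3 := expTail_succ_mul 0 (adL G ξ)
  have h4 := expTail_succ_mul 1 (adL G ξ)
  have h5 := (commute_expTail (Commute.refl (adL G ξ)) 1).eq
  simp only [Nat.factorial, Nat.cast_one, inv_one, one_smul, zero_add, Nat.succ_eq_add_one,
    mul_one, Nat.reduceAdd] at h3 h4
  rw [h2, sub_mul, one_mul, mul_assoc, h5, ← mul_assoc]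
  have h6 : phiAd G ξ * expTail 1 (adL G ξ) = expTail 2 (adL G ξ) -
      (1 / 2 : ℝ) • expTail 1 (adL G ξ) := by
    rw [← h1, add_mul, smul_mul_assoc, one_mul, add_sub_cancel_right]
  rw [h6, sub_mul, h4, smul_mul_assoc, h3]
  module

lemma Ad_mem_expRegular {ξ : 𝔤} (hξ : ξ ∈ expRegular G) (g : G) : Ad g ξ ∈ expRegular G := by
  rw [mem_expRegular_iff] at hξ ⊢
  rw [adL_Ad, expTail_conj]
  exact ((AdUnit g).isUnit.mul hξ).mul (AdUnit g)⁻¹.isUnit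

lemma phiAd_Ad {ξ : 𝔤} (hξ : ξ ∈ expRegular G) (g : G) :
    phiAd G (Ad g ξ) * (Ad g : 𝔤 →L[ℝ] 𝔤) = (Ad g : 𝔤 →L[ℝ] 𝔤) * phiAd G ξ := by
  obtain ⟨s, hs⟩ := mem_expRegular_iff.1 hξ
  have hinv : Ring.inverse ((AdUnit (𝔤 := 𝔤) g).val * s * ((AdUnit (𝔤 := 𝔤) g)⁻¹).val) =
      (AdUnit (𝔤 := 𝔤) g).val * (↑s⁻¹ : 𝔤 →L[ℝ] 𝔤) * ((AdUnit (𝔤 := 𝔤) g)⁻¹).val := by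
    have := Ring.inverse_unit (AdUnit (𝔤 := 𝔤) g * s * (AdUnit g)⁻¹)
    simpa [mul_inv_rev, mul_assoc] using this
  have hAd : (Ad g : 𝔤 →L[ℝ] 𝔤) = (AdUnit (𝔤 := 𝔤) g).val := rfl
  have e' : ∀ X : 𝔤 →L[ℝ] 𝔤, X * ((AdUnit (𝔤 := 𝔤) g)⁻¹).val * (AdUnit (𝔤 := 𝔤) g).val = X :=
    fun X => Units.inv_mul_cancel_right X (AdUnit g)
  rw [phiAd, phiAd, adL_Ad, expTail_conj, expTail_conj, ← hs, hinv, hAd, Ring.inverse_unit]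
  simp only [sub_mul, mul_sub, smul_mul_assoc, mul_smul_comm, one_mul, mul_one, ← mul_assoc, e']

lemma contDiffAt_phiAd {ξ : 𝔤} (hξ : ξ ∈ expRegular G) : ContDiffAt ℝ ∞ (phiAd G) ξ := by
  have h : ∀ k, ContDiffAt ℝ ∞ (fun ξ : 𝔤 => expTail k (adL G ξ)) ξ := fun k =>
    ((contDiff_expTail k).comp (adL G).contDiff).contDiffAt
  obtain ⟨s, hs⟩ := mem_expRegular_iff.1 hξ
  have hi : ContDiffAt ℝ ∞ (fun ξ : 𝔤 => Ring.inverse (expTail 1 (adL G ξ))) ξ := by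
    have := contDiffAt_ringInverse ℝ (n := ∞) s
    rw [hs] at this
    exact this.comp ξ (h 1)
  exact ((h 2).mul hi).sub contDiffAt_const

lemma isOpen_expRegular : IsOpen (expRegular G : Set 𝔤) := by
  have : (expRegular G : Set 𝔤) = (fun ξ : 𝔤 => expTail 1 (adL G ξ)) ⁻¹' {x | IsUnit x} :=
    Set.ext fun ξ => mem_expRegular_iff
  rw [this]
  exact Units.isOpen.preimage ((contDiff_expTail 1).continuous.comp (adL G).continuous)

lemma fderiv_phiAd_lieBr {ξ : 𝔤} (hξ : ξ ∈ expRegular G) (η : 𝔤) :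
    fderiv ℝ (phiAd G) ξ (lieBr G η ξ) = adL G η * phiAd G ξ - phiAd G ξ * adL G η :=
  fderiv_lieBr_of_equivariant
    ((contDiffAt_phiAd hξ).differentiableAt (by simp)).hasFDerivAt (phiAd_Ad hξ) η

end Equivariant

/-! ### Complex matrices of real operators -/

section Complexify
variable {𝔤 : Type*} [NormedAddCommGroup 𝔤] [NormedSpace ℝ 𝔤] [FiniteDimensional ℝ 𝔤]
  {ι : Type*} [Fintype ι] [DecidableEq ι]
  {B : LinearMap.BilinForm ℝ 𝔤} {e : Module.Basis ι ℝ 𝔤}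

lemma sum_orthonormal_smul (he : ∀ a b, B (e a) (e b) = if a = b then 1 else 0) (x : 𝔤) :
    ∑ c, B (e c) x • e c = x := by
  have h : ∀ c, B (e c) x = e.repr x c := by
    intro c
    conv_lhs => rw [← e.sum_repr x, map_sum]
    simp only [map_smul, he, smul_eq_mul, mul_ite, mul_one, mul_zero, Finset.sum_ite_eq,
      Finset.mem_univ, if_true]
  simp_rw [h]
  exact e.sum_repr x

variable (B e) in
/-- The complex matrix of an operator in an orthonormal basis. -/
def cmat : (𝔤 →L[ℝ] 𝔤) →ₗ[ℝ] Matrix ι ι ℂ where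
  toFun Y := Matrix.of fun a b => ((B (e a) (Y (e b)) : ℝ) : ℂ)
  map_add' Y Z := by ext a b; simp
  map_smul' c Y := by ext a b; simp

lemma cmat_apply (Y : 𝔤 →L[ℝ] 𝔤) (a b : ι) : cmat B e Y a b = ((B (e a) (Y (e b)) : ℝ) : ℂ) := rfl

lemma cmat_mul (he : ∀ a b, B (e a) (e b) = if a = b then 1 else 0) (Y Z : 𝔤 →L[ℝ] 𝔤) :
    cmat B e (Y * Z) = cmat B e Y * cmat B e Z := by
  ext a b
  rw [Matrix.mul_apply, cmat_apply]
  conv_lhs => rw [ContinuousLinearMap.mul_def, ContinuousLinearMap.comp_apply, ← sum_orthonormal_smul he (Z (e b))]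
  simp only [map_sum, map_smul, cmat_apply]
  push_cast
  refine Finset.sum_congr rfl fun c _ => ?_
  simp [mul_comm]

lemma cmat_one (he : ∀ a b, B (e a) (e b) = if a = b then 1 else 0) : cmat B e 1 = 1 := by
  ext a b
  simp only [cmat_apply, one_apply_eq_self, he, Matrix.one_apply]
  split_ifs <;> simp

lemma cmat_pow_mulVec (he : ∀ a b, B (e a) (e b) = if a = b then 1 else 0) {X : 𝔤 →L[ℝ] 𝔤} {β : ℂ}
    {v : ι → ℂ} (hv : (cmat B e X).mulVec v = β • v) (n : ℕ) :
    (cmat B e (X ^ n)).mulVec v = β ^ n • v := by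
  induction n with
  | zero => simp [cmat_one he]
  | succ n ih =>
    rw [pow_succ, cmat_mul he, ← Matrix.mulVec_mulVec, hv, Matrix.mulVec_smul, ih, smul_smul,
      pow_succ']

variable (B e) in
/-- Evaluation of the complex matrix of an operator on a vector. -/
def cmatVec (v : ι → ℂ) : (𝔤 →L[ℝ] 𝔤) →L[ℝ] (ι → ℂ) :=
  LinearMap.toContinuousLinearMap
    { toFun := fun Y => (cmat B e Y).mulVec v
      map_add' := fun Y Z => by rw [map_add, Matrix.add_mulVec]
      map_smul' := fun c Y => by rw [map_smul, Matrix.smul_mulVec]; rfl }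

lemma cmatVec_apply (v : ι → ℂ) (Y : 𝔤 →L[ℝ] 𝔤) : cmatVec B e v Y = (cmat B e Y).mulVec v := rfl

lemma cmat_expTail_mulVec (he : ∀ a b, B (e a) (e b) = if a = b then 1 else 0) {X : 𝔤 →L[ℝ] 𝔤}
    {β : ℂ} {v : ι → ℂ} (hv : (cmat B e X).mulVec v = β • v) (k : ℕ) :
    (cmat B e (expTail k X)).mulVec v = expTail k β • v := by
  have h := (hasSum_expTail k X).mapL (cmatVec B e v)
  have h2 := (hasSum_expTail k β).smul_const v
  have hfun : (fun n : ℕ => cmatVec B e v ((((n + k).factorial : ℝ)⁻¹) • X ^ n)) =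
      fun n : ℕ => ((((n + k).factorial : ℝ)⁻¹) • β ^ n) • v := by
    ext1 n
    rw [map_smul, cmatVec_apply, cmat_pow_mulVec he hv, smul_assoc]
  rw [hfun] at h
  exact h.unique h2

end Complexify

/-! ### Comparison of φ(ad ξ) with the functional calculus -/

section Eigen
variable {𝔤 : Type*} [NormedAddCommGroup 𝔤] [NormedSpace ℝ 𝔤] [FiniteDimensional ℝ 𝔤]
  {G : Type*} [TopologicalSpace G] [ChartedSpace 𝔤 G] [Group G] [LieGroup 𝓘(ℝ, 𝔤) ∞ G] [T2Space G]
  {ι : Type*} [Fintype ι] [DecidableEq ι]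
  {B : LinearMap.BilinForm ℝ 𝔤} {e : Module.Basis ι ℝ 𝔤}

lemma adMatrix_eq_cmat (ξ : 𝔤) : adMatrix G B e ξ = cmat B e (adL G ξ) := by
  ext a b; rw [cmat_apply, adL_apply]; rfl

lemma adMatrix_swap (hB : IsInvariantInnerProduct G B) (ξ : 𝔤) (a b : ι) :
    adMatrix G B e ξ b a = -adMatrix G B e ξ a b := by
  change ((B (e b) (lieBr G ξ (e a)) : ℝ) : ℂ) = -((B (e a) (lieBr G ξ (e b)) : ℝ) : ℂ)
  rw [hB.symm, invariant_lieBr hB]; simp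

lemma adMatrix_conjTranspose (hB : IsInvariantInnerProduct G B) (ξ : 𝔤) :
    (adMatrix G B e ξ).conjTranspose = -adMatrix G B e ξ := by
  ext a b
  rw [Matrix.conjTranspose_apply, adMatrix_swap hB ξ a b]
  simp [adMatrix]

lemma dotProduct_adMatrix (hB : IsInvariantInnerProduct G B) (ξ : 𝔤) (u v : ι → ℂ) :
    dotProduct u ((adMatrix G B e ξ).mulVec v) = -dotProduct ((adMatrix G B e ξ).mulVec u) v := by
  have h : (adMatrix G B e ξ).transpose = -adMatrix G B e ξ := by
    ext a b; exact adMatrix_swap hB ξ a b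
  rw [Matrix.dotProduct_mulVec, ← Matrix.mulVec_transpose, h, Matrix.neg_mulVec, neg_dotProduct]

variable [CompactSpace G]

/-- S₁(β) is an eigenvalue of the invertible operator S₁(ad ξ). All eigenvalues of ad ξ at a regular
point therefore lie where the scalar identities for φ hold. -/
lemma expTail_one_ne_zero_of_eigenvector (he : ∀ a b, B (e a) (e b) = if a = b then 1 else 0) {ξ : 𝔤}
    (hξ : ξ ∈ expRegular G) {β : ℂ} {v : ι → ℂ} (hv0 : v ≠ 0)
    (hv : (adMatrix G B e ξ).mulVec v = β • v) : expTail 1 β ≠ 0 := by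
  rw [adMatrix_eq_cmat] at hv
  intro h0
  have h1 := cmat_expTail_mulVec he hv 1
  rw [h0, zero_smul] at h1
  have h2 := Ring.inverse_mul_cancel _ (mem_expRegular_iff.1 hξ)
  have h3 := congrArg (fun Y => (cmat B e Y).mulVec v) h2
  simp only [cmat_mul he, cmat_one he, ← Matrix.mulVec_mulVec, h1, Matrix.mulVec_zero,
    Matrix.one_mulVec] at h3
  exact hv0 h3.symm

lemma cmat_phiAd_mulVec (he : ∀ a b, B (e a) (e b) = if a = b then 1 else 0) {ξ : 𝔤}
    (hξ : ξ ∈ expRegular G) {β : ℂ} {v : ι → ℂ}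
    (hv : (adMatrix G B e ξ).mulVec v = β • v) :
    (cmat B e (phiAd G ξ)).mulVec v = phi β • v := by
  by_cases hv0 : v = 0
  · simp [hv0]
  have hβ := expTail_one_ne_zero_of_eigenvector he hξ hv0 hv
  rw [adMatrix_eq_cmat] at hv
  have h1 := cmat_expTail_mulVec he hv 1
  have h2 := cmat_expTail_mulVec he hv 2
  have h3 := congrArg (fun Y => (cmat B e Y).mulVec v) (phiAd_add_half_mul hξ)
  simp only [cmat_mul he, ← Matrix.mulVec_mulVec, h1, h2, Matrix.mulVec_smul] at h3
  rw [map_add, map_smul, cmat_one he, Matrix.add_mulVec, Matrix.smul_mulVec, Matrix.one_mulVec] at h3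
  have h4 : (cmat B e (phiAd G ξ)).mulVec v + (1 / 2 : ℝ) • v =
      (expTail 2 β / expTail 1 β) • v := by
    rw [div_eq_inv_mul (expTail 2 β), mul_smul (expTail 1 β)⁻¹, ← h3, smul_smul, inv_mul_cancel₀ hβ, one_smul]
  rw [phi_eq hβ, sub_smul, ← h4]
  ext i
  simp

open scoped Matrix.Norms.L2Operator in
lemma cfc_phi_adMatrix (hB : IsInvariantInnerProduct G B)
    (he : ∀ a b, B (e a) (e b) = if a = b then 1 else 0) {ξ : 𝔤} (hξ : ξ ∈ expRegular G) :
    cfc (p := IsStarNormal) phi (adMatrix G B e ξ) = cmat B e (phiAd G ξ) := by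
  have hA := adMatrix_conjTranspose (e := e) hB ξ
  have hn : IsStarNormal (adMatrix G B e ξ) :=
    ⟨by rw [Matrix.star_eq_conjTranspose, hA]; exact (Commute.refl _).neg_left⟩
  refine matrix_eq_of_eigenvectors hA fun β v hv => ?_
  rw [cfc_mulVec_of_eigenvector hn phi hv, cmat_phiAd_mulVec he hξ hv]

lemma Tcoef_eq (hB : IsInvariantInnerProduct G B)
    (he : ∀ a b, B (e a) (e b) = if a = b then 1 else 0) {ξ : 𝔤} (hξ : ξ ∈ expRegular G) (a b : ι) :
    Tcoef G B e ξ a b = B (e a) (phiAd G ξ (e b)) := by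
  rw [Tcoef, cfc_phi_adMatrix hB he hξ]; rfl

end Eigen

/-! ### Testing multilinear identities on eigenvectors -/

section Multilinear
variable {ι : Type*} [Fintype ι] [DecidableEq ι]

lemma eq_zero_of_eigenvectors {A : Matrix ι ι ℂ} (hA : A.conjTranspose = -A)
    {L : (ι → ℂ) → ℂ} (hL : IsLinearMap ℂ L)
    (h : ∀ (α : ℂ) (v : ι → ℂ), A.mulVec v = α • v → L v = 0) (v : ι → ℂ) : L v = 0 :=
  LinearMap.congr_fun (linearMap_eq_zero_of_eigenvectors hA hL.mk' h) v

lemma trilinear_eq_zero_of_eigenvectors {A : Matrix ι ι ℂ} (hA : A.conjTranspose = -A)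
    {K : (ι → ℂ) → (ι → ℂ) → (ι → ℂ) → ℂ} (h1 : ∀ v w, IsLinearMap ℂ fun u => K u v w)
    (h2 : ∀ u w, IsLinearMap ℂ fun v => K u v w) (h3 : ∀ u v, IsLinearMap ℂ fun w => K u v w)
    (h : ∀ (α β γ : ℂ) (u v w : ι → ℂ), A.mulVec u = α • u → A.mulVec v = β • v →
      A.mulVec w = γ • w → K u v w = 0) (u v w : ι → ℂ) : K u v w = 0 :=
  eq_zero_of_eigenvectors hA (h1 v w) (fun α u hu =>
    eq_zero_of_eigenvectors hA (h2 u w) (fun β v hv =>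
      eq_zero_of_eigenvectors hA (h3 u v) (fun γ w hw => h α β γ u v w hu hv hw) w) v) u

end Multilinear

/-! ### Complex-linear extension of operator-valued maps -/

section Extension
variable {𝔤 : Type*} [NormedAddCommGroup 𝔤] [NormedSpace ℝ 𝔤] [FiniteDimensional ℝ 𝔤]
  {ι : Type*} [Fintype ι] [DecidableEq ι]
  {B : LinearMap.BilinForm ℝ 𝔤} {e : Module.Basis ι ℝ 𝔤}

variable (B e) in
/-- The complex-linear extension of an operator-valued linear map. -/
def cext (Λ : 𝔤 →L[ℝ] 𝔤 →L[ℝ] 𝔤) (w : ι → ℂ) : Matrix ι ι ℂ := ∑ c, w c • cmat B e (Λ (e c))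

variable (B e) in
/-- The complex coordinates of a vector. -/
def ccoord (x : 𝔤) (c : ι) : ℂ := ((B (e c) x : ℝ) : ℂ)

variable (Λ : 𝔤 →L[ℝ] 𝔤 →L[ℝ] 𝔤)

lemma cext_add (w w' : ι → ℂ) : cext B e Λ (w + w') = cext B e Λ w + cext B e Λ w' := by
  simp [cext, add_smul, Finset.sum_add_distrib]

lemma cext_smul (c : ℂ) (w : ι → ℂ) : cext B e Λ (c • w) = c • cext B e Λ w := by
  simp [cext, Finset.smul_sum, mul_smul]

lemma ofReal_smul_matrix (c : ℝ) (Y : Matrix ι ι ℂ) : (c : ℂ) • Y = c • Y := by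
  ext; simp

lemma cext_ccoord (he : ∀ a b, B (e a) (e b) = if a = b then 1 else 0) (x : 𝔤) :
    cext B e Λ (ccoord B e x) = cmat B e (Λ x) := by
  conv_rhs => rw [← sum_orthonormal_smul he x]
  simp only [map_sum, map_smul, cext, ccoord, ofReal_smul_matrix]

lemma cmat_mulVec_ccoord (he : ∀ a b, B (e a) (e b) = if a = b then 1 else 0) (Y : 𝔤 →L[ℝ] 𝔤)
    (x : 𝔤) : (cmat B e Y).mulVec (ccoord B e x) = ccoord B e (Y x) := by
  ext a
  conv_rhs => rw [ccoord, ← sum_orthonormal_smul he x]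
  simp only [map_sum, map_smul, Matrix.mulVec, dotProduct, ccoord, cmat_apply, smul_eq_mul]
  push_cast
  exact Finset.sum_congr rfl fun c _ => mul_comm _ _

lemma cext_mulVec (he : ∀ a b, B (e a) (e b) = if a = b then 1 else 0) (Y : 𝔤 →L[ℝ] 𝔤)
    (w : ι → ℂ) : cext B e Λ ((cmat B e Y).mulVec w) = cext B e (Λ.comp Y) w := by
  have h : ∀ b, cmat B e (Λ (Y (e b))) = ∑ c, ((B (e c) (Y (e b)) : ℝ) : ℂ) • cmat B e (Λ (e c)) := by
    intro b
    rw [← cext_ccoord Λ he]; rfl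
  simp only [cext, ContinuousLinearMap.comp_apply, h, Finset.smul_sum, Matrix.mulVec, dotProduct,
    cmat_apply, Finset.sum_smul, smul_smul]
  rw [Finset.sum_comm]
  exact Finset.sum_congr rfl fun b _ => Finset.sum_congr rfl fun c _ => by rw [mul_comm]

/-- A complex vector in the kernel of a real operator is a combination of real ones. -/
lemma exists_ccoord_of_mulVec_eq_zero (he : ∀ a b, B (e a) (e b) = if a = b then 1 else 0)
    (Y : 𝔤 →L[ℝ] 𝔤) {w : ι → ℂ} (hw : (cmat B e Y).mulVec w = 0) :
    ∃ x y : 𝔤, Y x = 0 ∧ Y y = 0 ∧ w = ccoord B e x + Complex.I • ccoord B e y := by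
  have hc : ∀ r : ι → ℝ, ccoord B e (∑ c, r c • e c) = fun c => (r c : ℂ) := by
    intro r; ext c
    simp [ccoord, he]
  have hw' : w = ccoord B e (∑ c, (w c).re • e c) + Complex.I • ccoord B e (∑ c, (w c).im • e c) := by
    rw [hc, hc]; ext c
    simp [mul_comm Complex.I]
  refine ⟨_, _, ?_, ?_, hw'⟩
  all_goals
    rw [hw', Matrix.mulVec_add, Matrix.mulVec_smul, cmat_mulVec_ccoord he, cmat_mulVec_ccoord he] at hw
    rw [← sum_orthonormal_smul he (Y _)]
    refine Finset.sum_eq_zero fun c _ => ?_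
    have h := congrFun hw c
    rw [Pi.add_apply, Pi.smul_apply] at h
  · have := congrArg Complex.re h
    simp only [ccoord, Complex.add_re, Complex.ofReal_re, smul_eq_mul, Complex.mul_re, Complex.I_re,
      Complex.I_im, Complex.ofReal_im, Pi.zero_apply, Complex.zero_re] at this
    rw [show B (e c) (Y (∑ c, (w c).re • e c)) = 0 by linarith, zero_smul]
  · have := congrArg Complex.im h
    simp only [ccoord, Complex.add_im, Complex.ofReal_re, smul_eq_mul, Complex.mul_im, Complex.I_re,
      Complex.I_im, Complex.ofReal_im, Pi.zero_apply, Complex.zero_im] at this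
    rw [show B (e c) (Y (∑ c, (w c).im • e c)) = 0 by linarith, zero_smul]

end Extension

/-! ### The classical dynamical Yang-Baxter equation -/

section Dynamical
variable {𝔤 : Type*} [NormedAddCommGroup 𝔤] [NormedSpace ℝ 𝔤] [FiniteDimensional ℝ 𝔤]
  {G : Type*} [TopologicalSpace G] [ChartedSpace 𝔤 G] [Group G] [LieGroup 𝓘(ℝ, 𝔤) ∞ G] [T2Space G]
  {ι : Type*} [Fintype ι] [DecidableEq ι]
  {B : LinearMap.BilinForm ℝ 𝔤} {e : Module.Basis ι ℝ 𝔤}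

/-- The pairing is complex bilinear, not Hermitian, so skewness of ad ξ pairs the eigenvalue α with
-α. -/
lemma add_mul_dotProduct_eq_zero (hB : IsInvariantInnerProduct G B) {ξ : 𝔤} {u v : ι → ℂ} {α β : ℂ}
    (hu : (adMatrix G B e ξ).mulVec u = α • u) (hv : (adMatrix G B e ξ).mulVec v = β • v) :
    (α + β) * dotProduct u v = 0 := by
  have h := dotProduct_adMatrix (e := e) hB ξ u v
  rw [hu, hv, dotProduct_smul, smul_dotProduct, smul_eq_mul, smul_eq_mul] at h
  linear_combination h

variable (G B e) in
/-- The complex trilinear extension of `x · [y, z]`. -/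
def cform (u v w : ι → ℂ) : ℂ := dotProduct u ((cext B e (adL G) v).mulVec w)

lemma cform_eq_sum (u v w : ι → ℂ) :
    cform G B e u v w = ∑ a, ∑ b, ∑ c, u a * v b * w c * (structConst G B e a b c : ℂ) := by
  simp only [cform, cext, dotProduct, Matrix.mulVec, Matrix.sum_apply, Matrix.smul_apply,
    smul_eq_mul, cmat_apply, adL_apply, structConst, Finset.mul_sum, Finset.sum_mul]
  refine Finset.sum_congr rfl fun a _ => ?_
  rw [Finset.sum_comm]
  exact Finset.sum_congr rfl fun b _ => Finset.sum_congr rfl fun c _ => by ring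

lemma structConst_swap₂₃ (a b c : ι) : structConst G B e a b c = -structConst G B e a c b := by
  rw [structConst, structConst, lieBr_swap, map_neg]

lemma structConst_swap₁₃ (hB : IsInvariantInnerProduct G B) (a b c : ι) :
    structConst G B e a b c = -structConst G B e c b a := by
  rw [structConst, structConst, hB.symm, invariant_lieBr hB]

lemma structConst_rotate (hB : IsInvariantInnerProduct G B) (a b c : ι) :
    structConst G B e a b c = structConst G B e b c a := by
  rw [structConst_swap₂₃, structConst_swap₁₃ hB, neg_neg]

lemma cform_rotate (hB : IsInvariantInnerProduct G B) (u v w : ι → ℂ) :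
    cform G B e u v w = cform G B e v w u := by
  rw [cform_eq_sum, cform_eq_sum]
  rw [Finset.sum_comm]
  refine Finset.sum_congr rfl fun b _ => ?_
  rw [Finset.sum_comm]
  refine Finset.sum_congr rfl fun c _ => Finset.sum_congr rfl fun a _ => ?_
  rw [structConst_rotate hB a b c]; ring

lemma cform_swap₂₃ (u v w : ι → ℂ) : cform G B e u v w = -cform G B e u w v := by
  rw [cform_eq_sum, cform_eq_sum, ← Finset.sum_neg_distrib]
  refine Finset.sum_congr rfl fun a _ => ?_
  rw [Finset.sum_comm, ← Finset.sum_neg_distrib]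
  refine Finset.sum_congr rfl fun c _ => ?_
  rw [← Finset.sum_neg_distrib]
  refine Finset.sum_congr rfl fun b _ => ?_
  rw [structConst_swap₂₃ a b c]; push_cast; ring

lemma cform_smul₁ (c : ℂ) (u v w : ι → ℂ) : cform G B e (c • u) v w = c * cform G B e u v w := by
  simp [cform]

lemma cform_add₁ (u u' v w : ι → ℂ) :
    cform G B e (u + u') v w = cform G B e u v w + cform G B e u' v w := by
  simp [cform]

lemma cform_smul₃ (c : ℂ) (u v w : ι → ℂ) : cform G B e u v (c • w) = c * cform G B e u v w := by
  simp [cform, Matrix.mulVec_smul]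

lemma cform_add₃ (u v w w' : ι → ℂ) :
    cform G B e u v (w + w') = cform G B e u v w + cform G B e u v w' := by
  simp [cform, Matrix.mulVec_add]

lemma cform_smul₂ (c : ℂ) (u v w : ι → ℂ) : cform G B e u (c • v) w = c * cform G B e u v w := by
  simp [cform, cext_smul, Matrix.smul_mulVec]

lemma cform_add₂ (u v v' w : ι → ℂ) :
    cform G B e u (v + v') w = cform G B e u v w + cform G B e u v' w := by
  simp [cform, cext_add, Matrix.add_mulVec]

/-- The complexified Jacobi identity. -/
lemma cext_comp_adL (ξ : 𝔤) (w : ι → ℂ) (he : ∀ a b, B (e a) (e b) = if a = b then 1 else 0) :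
    cext B e (adL G) ((adMatrix G B e ξ).mulVec w) =
      adMatrix G B e ξ * cext B e (adL G) w - cext B e (adL G) w * adMatrix G B e ξ := by
  rw [adMatrix_eq_cmat, cext_mulVec _ he]
  simp only [cext, ContinuousLinearMap.comp_apply, adL_apply ξ, adL_lieBr, map_sub, cmat_mul he,
    Finset.mul_sum, Finset.sum_mul, smul_sub, Finset.sum_sub_distrib, Matrix.mul_smul,
    Matrix.smul_mul]

/-- The trilinear form x · [y, z] is invariant under ad ξ, hence vanishes on eigenvectors whose
eigenvalues do not sum to 0. -/
lemma add_mul_cform_eq_zero (hB : IsInvariantInnerProduct G B)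
    (he : ∀ a b, B (e a) (e b) = if a = b then 1 else 0) {ξ : 𝔤} {u v w : ι → ℂ} {α β γ : ℂ}
    (hu : (adMatrix G B e ξ).mulVec u = α • u) (hv : (adMatrix G B e ξ).mulVec v = β • v)
    (hw : (adMatrix G B e ξ).mulVec w = γ • w) :
    (α + β + γ) * cform G B e u v w = 0 := by
  have h1 : cform G B e u ((adMatrix G B e ξ).mulVec v) w =
      -cform G B e ((adMatrix G B e ξ).mulVec u) v w - cform G B e u v ((adMatrix G B e ξ).mulVec w) := by
    simp only [cform]
    rw [cext_comp_adL ξ v he, Matrix.sub_mulVec, dotProduct_sub, ← Matrix.mulVec_mulVec,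
      ← Matrix.mulVec_mulVec, dotProduct_adMatrix hB]
  rw [hu, hv, hw, cform_smul₁, cform_smul₂, cform_smul₃] at h1
  linear_combination h1

variable [CompactSpace G]

/-- An odd function of a skew operator is skew; on eigenvectors this is `phi_neg` together with the
orthogonality of eigenspaces of non-opposite eigenvalues. -/
lemma dotProduct_cmat_phiAd (hB : IsInvariantInnerProduct G B)
    (he : ∀ a b, B (e a) (e b) = if a = b then 1 else 0) {ξ : 𝔤} (hξ : ξ ∈ expRegular G)
    (u v : ι → ℂ) : dotProduct u ((cmat B e (phiAd G ξ)).mulVec v) +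
      dotProduct ((cmat B e (phiAd G ξ)).mulVec u) v = 0 := by
  have hA := adMatrix_conjTranspose (e := e) hB ξ
  refine eq_zero_of_eigenvectors hA (L := fun u => dotProduct u ((cmat B e (phiAd G ξ)).mulVec v) +
      dotProduct ((cmat B e (phiAd G ξ)).mulVec u) v) ⟨fun x y => ?_, fun c x => ?_⟩
      (fun α u hu => ?_) u
  · simp only [add_dotProduct, Matrix.mulVec_add]; ring
  · simp only [smul_dotProduct, Matrix.mulVec_smul, smul_add]
  refine eq_zero_of_eigenvectors hA (L := fun v => dotProduct u ((cmat B e (phiAd G ξ)).mulVec v) +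
      dotProduct ((cmat B e (phiAd G ξ)).mulVec u) v) ⟨fun x y => ?_, fun c x => ?_⟩
      (fun β v hv => ?_) v
  · simp only [dotProduct_add, Matrix.mulVec_add]; ring
  · simp only [dotProduct_smul, Matrix.mulVec_smul, smul_add]
  rw [cmat_phiAd_mulVec he hξ hu, cmat_phiAd_mulVec he hξ hv, dotProduct_smul, smul_dotProduct,
    ← add_smul]
  rcases mul_eq_zero.1 (add_mul_dotProduct_eq_zero hB hu hv) with h | h
  · rw [show β = -α by linear_combination h, phi_neg]; simp
  · rw [h, smul_zero]

lemma phiAd_skew (hB : IsInvariantInnerProduct G B)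
    (he : ∀ a b, B (e a) (e b) = if a = b then 1 else 0) {ξ : 𝔤} (hξ : ξ ∈ expRegular G) (a b : ι) :
    B (e a) (phiAd G ξ (e b)) = -B (e b) (phiAd G ξ (e a)) := by
  have h := dotProduct_cmat_phiAd hB he hξ (Pi.single a 1) (Pi.single b 1)
  simp only [Matrix.mulVec_single_one, single_dotProduct, dotProduct_single, one_mul, mul_one,
    Matrix.col_apply, cmat_apply] at h
  exact_mod_cast eq_neg_of_add_eq_zero_left h

/-- The derivative of `φ(ad ξ)` in a direction that commutes with `ξ`. -/
lemma dotProduct_fderiv_phiAd_of_commute (hB : IsInvariantInnerProduct G B)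
    (he : ∀ a b, B (e a) (e b) = if a = b then 1 else 0) {ξ η : 𝔤} (hξ : ξ ∈ expRegular G)
    (hη : lieBr G ξ η = 0) {α : ℂ} {u : ι → ℂ} (hu : (adMatrix G B e ξ).mulVec u = α • u)
    (v : ι → ℂ) : dotProduct u ((cmat B e (fderiv ℝ (phiAd G) ξ η)).mulVec v) =
      phiDeriv α * dotProduct u ((adMatrix G B e η).mulVec v) := by
  have hcomm : adMatrix G B e ξ * adMatrix G B e η = adMatrix G B e η * adMatrix G B e ξ := by
    rw [adMatrix_eq_cmat, adMatrix_eq_cmat, ← cmat_mul he, ← cmat_mul he]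
    have := adL_lieBr (G := G) ξ η
    rw [hη, map_zero] at this
    rw [sub_eq_zero.1 this.symm]
  rw [← sub_eq_zero]
  have hlin : IsLinearMap ℂ (fun v : ι → ℂ =>
      dotProduct u ((cmat B e (fderiv ℝ (phiAd G) ξ η)).mulVec v) -
      phiDeriv α * dotProduct u ((adMatrix G B e η).mulVec v)) :=
    ⟨fun x y => by simp only [Matrix.mulVec_add, dotProduct_add]; ring,
     fun c x => by simp only [Matrix.mulVec_smul, dotProduct_smul, smul_eq_mul]; ring⟩
  -- As ad ξ and ad η commute, v may be a joint eigenvector with eigenvalues β and δ. It is then an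
  -- eigenvector of ad(ξ + tη) with eigenvalue β + tδ, and the operator derivative reduces to that
  -- of φ(β + tδ).
  refine LinearMap.congr_fun (linearMap_eq_zero_of_joint_eigenvectors
    (adMatrix_conjTranspose hB ξ) (adMatrix_conjTranspose hB η) hcomm hlin.mk'
    fun β δ v hv hδ => ?_) v
  rw [IsLinearMap.mk'_apply]
  by_cases hv0 : v = 0
  · simp [hv0]
  have hβ := expTail_one_ne_zero_of_eigenvector he hξ hv0 hv
  have hline : HasDerivAt (fun t : ℝ => ξ + t • η) η 0 := by
    have := ((hasDerivAt_id (0 : ℝ)).smul_const η).const_add ξ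
    simpa using this
  have hd : HasDerivAt (fun t : ℝ => cmatVec B e v (phiAd G (ξ + t • η)))
      (cmatVec B e v (fderiv ℝ (phiAd G) ξ η)) 0 := by
    have h1 : HasFDerivAt (phiAd G) (fderiv ℝ (phiAd G) ξ) (ξ + (0 : ℝ) • η) := by
      rw [zero_smul, add_zero]
      exact ((contDiffAt_phiAd hξ).differentiableAt (by simp)).hasFDerivAt
    have h2 : HasDerivAt (fun t : ℝ => phiAd G (ξ + t • η)) (fderiv ℝ (phiAd G) ξ η) 0 :=
      h1.comp_hasDerivAt (f := fun t : ℝ => ξ + t • η) 0 hline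
    exact (cmatVec B e v).hasFDerivAt.comp_hasDerivAt 0 h2
  have hs : HasDerivAt (fun t : ℝ => phi (β + (t : ℂ) * δ) • v) ((phiDeriv β * δ) • v) 0 := by
    have h1 : HasDerivAt phi (phiDeriv β) (β + ((0 : ℝ) : ℂ) * δ) := by
      simpa using hasDerivAt_phi hβ
    have h2 : HasDerivAt (fun t : ℝ => β + (t : ℂ) * δ) δ 0 := by
      have := (Complex.ofRealCLM.hasDerivAt (x := (0 : ℝ))).mul_const δ |>.const_add β
      simpa using this
    exact (HasDerivAt.comp (h₂ := phi) (h := fun t : ℝ => β + (t : ℂ) * δ) (0 : ℝ) h1 h2).smul_const v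
  have hev : (fun t : ℝ => cmatVec B e v (phiAd G (ξ + t • η))) =ᶠ[nhds 0]
      fun t : ℝ => phi (β + (t : ℂ) * δ) • v := by
    have hc : ContinuousAt (fun t : ℝ => ξ + t • η) 0 := hline.continuousAt
    have hO : (expRegular G : Set 𝔤) ∈ nhds (ξ + (0 : ℝ) • η) := by
      rw [zero_smul, add_zero]; exact isOpen_expRegular.mem_nhds hξ
    filter_upwards [hc hO] with t ht
    refine cmat_phiAd_mulVec he ht ?_
    rw [adMatrix_eq_cmat, map_add, map_smul, map_add, map_smul, ← adMatrix_eq_cmat,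
      ← adMatrix_eq_cmat, Matrix.add_mulVec, Matrix.smul_mulVec, hv, hδ, add_smul, mul_smul]
    rfl
  have heq := (hs.congr_of_eventuallyEq hev).unique hd
  rw [cmatVec_apply] at heq
  rw [← heq, hδ, dotProduct_smul, dotProduct_smul, smul_eq_mul, smul_eq_mul]
  -- The computation produced φ'(β); it may be replaced by φ'(α) since φ' is even, unless the
  -- pairing vanishes.
  rcases mul_eq_zero.1 (add_mul_dotProduct_eq_zero hB hu hv) with h | h
  · rw [show β = -α by linear_combination h, phiDeriv_neg]; ring
  · rw [h]; ring

/-- The complexified derivative of `φ(ad ξ)`, on eigenvectors of `ad ξ`. -/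
lemma mul_dotProduct_cext_fderiv (hB : IsInvariantInnerProduct G B)
    (he : ∀ a b, B (e a) (e b) = if a = b then 1 else 0) {ξ : 𝔤} (hξ : ξ ∈ expRegular G)
    {u v w : ι → ℂ} {α β γ : ℂ}
    (hu : (adMatrix G B e ξ).mulVec u = α • u) (hv : (adMatrix G B e ξ).mulVec v = β • v)
    (hw : (adMatrix G B e ξ).mulVec w = γ • w) :
    γ * dotProduct u ((cext B e (fderiv ℝ (phiAd G) ξ) w).mulVec v) =
      (phi α + phi β) * cform G B e u v w := by
  -- The vector γw = ad_ξ w is tangent to the adjoint orbit of ξ, where equivariance determines the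
  -- derivative as a commutator.
  have h1 : γ • cext B e (fderiv ℝ (phiAd G) ξ) w = cmat B e (phiAd G ξ) * cext B e (adL G) w -
      cext B e (adL G) w * cmat B e (phiAd G ξ) := by
    rw [← cext_smul, ← hw, adMatrix_eq_cmat, cext_mulVec _ he]
    have : ∀ c, fderiv ℝ (phiAd G) ξ (lieBr G ξ (e c)) =
        phiAd G ξ * adL G (e c) - adL G (e c) * phiAd G ξ := by
      intro c
      rw [lieBr_swap, map_neg, fderiv_phiAd_lieBr hξ, neg_sub]
    simp only [cext, ContinuousLinearMap.comp_apply, adL_apply ξ, this, map_sub, cmat_mul he,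
      Finset.mul_sum, Finset.sum_mul, smul_sub, Finset.sum_sub_distrib, Matrix.mul_smul,
      Matrix.smul_mul]
  have h2 := dotProduct_cmat_phiAd hB he hξ u ((cext B e (adL G) w).mulVec v)
  rw [cmat_phiAd_mulVec he hξ hu, smul_dotProduct] at h2
  have h3 : γ * dotProduct u ((cext B e (fderiv ℝ (phiAd G) ξ) w).mulVec v) =
      dotProduct u ((γ • cext B e (fderiv ℝ (phiAd G) ξ) w).mulVec v) := by
    rw [Matrix.smul_mulVec, dotProduct_smul, smul_eq_mul]
  rw [h3, h1, Matrix.sub_mulVec, ← Matrix.mulVec_mulVec, ← Matrix.mulVec_mulVec, dotProduct_sub,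
    cmat_phiAd_mulVec he hξ hv, Matrix.mulVec_smul, dotProduct_smul, cform_swap₂₃, cform,
    smul_eq_mul]
  rw [smul_eq_mul] at h2
  linear_combination h2

/-- The complex kernel of ad ξ is spanned by real vectors commuting with ξ, to which the commuting
case applies. The sign comes from exchanging v and w in the trilinear form. -/
lemma dotProduct_cext_fderiv_of_ker (hB : IsInvariantInnerProduct G B)
    (he : ∀ a b, B (e a) (e b) = if a = b then 1 else 0) {ξ : 𝔤} (hξ : ξ ∈ expRegular G)
    {u w : ι → ℂ} {α : ℂ} (hu : (adMatrix G B e ξ).mulVec u = α • u)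
    (hw : (adMatrix G B e ξ).mulVec w = 0) (v : ι → ℂ) :
    dotProduct u ((cext B e (fderiv ℝ (phiAd G) ξ) w).mulVec v) =
      -phiDeriv α * cform G B e u v w := by
  rw [adMatrix_eq_cmat] at hw
  obtain ⟨x, y, hx, hy, rfl⟩ := exists_ccoord_of_mulVec_eq_zero he _ hw
  rw [adL_apply] at hx hy
  have h1 := dotProduct_fderiv_phiAd_of_commute hB he hξ hx hu v
  have h2 := dotProduct_fderiv_phiAd_of_commute hB he hξ hy hu v
  rw [cform_swap₂₃, cform, cext_add, cext_smul, cext_add, cext_smul, cext_ccoord _ he,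
    cext_ccoord _ he, cext_ccoord _ he, cext_ccoord _ he, Matrix.add_mulVec, Matrix.smul_mulVec,
    Matrix.add_mulVec, Matrix.smul_mulVec, dotProduct_add, dotProduct_add, dotProduct_smul,
    dotProduct_smul, h1, h2, ← adMatrix_eq_cmat, ← adMatrix_eq_cmat, smul_eq_mul, smul_eq_mul]
  ring

open Classical in
/-- The coefficient of `x · [y, z]` in the derivative of `φ(ad ξ)` on eigenvectors. -/
def derivCoeff (α β γ : ℂ) : ℂ := if γ = 0 then -phiDeriv α else (phi α + phi β) / γ

lemma dotProduct_cext_fderiv (hB : IsInvariantInnerProduct G B)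
    (he : ∀ a b, B (e a) (e b) = if a = b then 1 else 0) {ξ : 𝔤} (hξ : ξ ∈ expRegular G)
    {u v w : ι → ℂ} {α β γ : ℂ}
    (hu : (adMatrix G B e ξ).mulVec u = α • u) (hv : (adMatrix G B e ξ).mulVec v = β • v)
    (hw : (adMatrix G B e ξ).mulVec w = γ • w) :
    dotProduct u ((cext B e (fderiv ℝ (phiAd G) ξ) w).mulVec v) =
      derivCoeff α β γ * cform G B e u v w := by
  by_cases hγ : γ = 0
  · rw [dotProduct_cext_fderiv_of_ker hB he hξ hu (by rw [hw, hγ, zero_smul]), derivCoeff, if_pos hγ]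
  · have := mul_dotProduct_cext_fderiv hB he hξ hu hv hw
    rw [derivCoeff, if_neg hγ]
    field_simp
    linear_combination this

/-- If no eigenvalue vanishes this is `phi_add_relation`. If exactly one vanishes, the other two are
opposite and the degenerate relation applies. If all vanish, the three terms -φ'(0) = 1/12 add up to
1/4. -/
lemma derivCoeff_relation {α β γ : ℂ} (h : α + β + γ = 0) (hα : expTail 1 α ≠ 0)
    (hβ : expTail 1 β ≠ 0) (hγ : expTail 1 γ ≠ 0) :
    derivCoeff α β γ + derivCoeff β γ α + derivCoeff γ α β
      - (phi β * phi γ + phi α * phi γ + phi α * phi β) = 1 / 4 := by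
  by_cases h1 : α = 0
  · by_cases h2 : β = 0
    · have h3 : γ = 0 := by linear_combination h - h1 - h2
      subst h1; subst h2; subst h3
      simp [derivCoeff, phiDeriv, phi_zero]; norm_num
    · have h3 : γ = -β := by linear_combination h - h1
      have h4 := phi_sub_phiDeriv_relation hβ h2
      subst h1; subst h3
      simp only [derivCoeff, if_pos, neg_eq_zero, h2, if_false, phi_neg, phi_zero]
      field_simp at h4 ⊢
      linear_combination h4
  · by_cases h2 : β = 0
    · have h3 : γ = -α := by linear_combination h - h2
      have h4 := phi_sub_phiDeriv_relation hα h1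
      subst h2; subst h3
      simp only [derivCoeff, if_pos, neg_eq_zero, h1, if_false, phi_neg, phi_zero, phiDeriv_neg]
      field_simp at h4 ⊢
      linear_combination h4
    · by_cases h3 : γ = 0
      · have h3' : β = -α := by linear_combination h - h3
        have h4 := phi_sub_phiDeriv_relation hα h1
        subst h3; subst h3'
        simp only [derivCoeff, if_pos, neg_eq_zero, h1, if_false, phi_neg, phi_zero]
        field_simp at h4 ⊢
        linear_combination h4
      · have := phi_add_relation h hα hβ hγ h1 h2 h3
        simp only [derivCoeff, h1, h2, h3, if_false]
        exact this

/-- The classical dynamical Yang-Baxter equation for `φ(ad ξ)`, in complexified form. -/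
lemma dynamical_yang_baxter_complex (hB : IsInvariantInnerProduct G B)
    (he : ∀ a b, B (e a) (e b) = if a = b then 1 else 0) {ξ : 𝔤} (hξ : ξ ∈ expRegular G)
    (u v w : ι → ℂ) :
    dotProduct u ((cext B e (fderiv ℝ (phiAd G) ξ) w).mulVec v) +
      dotProduct v ((cext B e (fderiv ℝ (phiAd G) ξ) u).mulVec w) +
      dotProduct w ((cext B e (fderiv ℝ (phiAd G) ξ) v).mulVec u) -
      (cform G B e u ((cmat B e (phiAd G ξ)).mulVec v) ((cmat B e (phiAd G ξ)).mulVec w) +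
       cform G B e ((cmat B e (phiAd G ξ)).mulVec u) v ((cmat B e (phiAd G ξ)).mulVec w) +
       cform G B e ((cmat B e (phiAd G ξ)).mulVec u) ((cmat B e (phiAd G ξ)).mulVec v) w) -
      1 / 4 * cform G B e u v w = 0 := by
  refine trilinear_eq_zero_of_eigenvectors (adMatrix_conjTranspose (e := e) hB ξ)
    (K := fun u v w => dotProduct u ((cext B e (fderiv ℝ (phiAd G) ξ) w).mulVec v) +
      dotProduct v ((cext B e (fderiv ℝ (phiAd G) ξ) u).mulVec w) +
      dotProduct w ((cext B e (fderiv ℝ (phiAd G) ξ) v).mulVec u) -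
      (cform G B e u ((cmat B e (phiAd G ξ)).mulVec v) ((cmat B e (phiAd G ξ)).mulVec w) +
       cform G B e ((cmat B e (phiAd G ξ)).mulVec u) v ((cmat B e (phiAd G ξ)).mulVec w) +
       cform G B e ((cmat B e (phiAd G ξ)).mulVec u) ((cmat B e (phiAd G ξ)).mulVec v) w) -
      1 / 4 * cform G B e u v w)
    (fun v w => ⟨fun x y => ?_, fun c x => ?_⟩) (fun v w => ⟨fun x y => ?_, fun c x => ?_⟩)
    (fun v w => ⟨fun x y => ?_, fun c x => ?_⟩) (fun α β γ u v w hu hv hw => ?_) u v w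
  case refine_7 =>
    rw [dotProduct_cext_fderiv hB he hξ hu hv hw, dotProduct_cext_fderiv hB he hξ hv hw hu,
      dotProduct_cext_fderiv hB he hξ hw hu hv, cmat_phiAd_mulVec he hξ hu,
      cmat_phiAd_mulVec he hξ hv, cmat_phiAd_mulVec he hξ hw, cform_smul₂, cform_smul₃, cform_smul₁,
      cform_smul₃, cform_smul₁, cform_smul₂, cform_rotate hB v w u, cform_rotate hB w u v]
    -- A zero vector says nothing about its eigenvalue, so this case is removed before S₁ ≠ 0 is
    -- used at α, β, γ.
    by_cases hu0 : u = 0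
    · simp [hu0, cform]
    by_cases hv0 : v = 0
    · rw [cform_rotate hB]; simp [hv0, cform]
    by_cases hw0 : w = 0
    · simp [hw0, cform]
    rcases mul_eq_zero.1 (add_mul_cform_eq_zero hB he hu hv hw) with h | h
    · have := derivCoeff_relation h (expTail_one_ne_zero_of_eigenvector he hξ hu0 hu)
        (expTail_one_ne_zero_of_eigenvector he hξ hv0 hv)
        (expTail_one_ne_zero_of_eigenvector he hξ hw0 hw)
      linear_combination this * cform G B e u v w
    · rw [h]; ring
  all_goals
    simp only [add_dotProduct, dotProduct_add, Matrix.mulVec_add, cext_add, Matrix.add_mulVec,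
      cform_add₁, cform_add₂, cform_add₃, smul_dotProduct, dotProduct_smul, Matrix.mulVec_smul,
      cext_smul, Matrix.smul_mulVec, cform_smul₁, cform_smul₂, cform_smul₃, smul_eq_mul]
    ring

/-- The classical dynamical Yang-Baxter equation for the coefficients of `T`. -/
lemma dynamical_yang_baxter (hB : IsInvariantInnerProduct G B)
    (he : ∀ a b, B (e a) (e b) = if a = b then 1 else 0) {ξ : 𝔤} (hξ : ξ ∈ expRegular G)
    (a b c : ι) :
    (B (e a) (fderiv ℝ (phiAd G) ξ (e c) (e b)) - ∑ k, ∑ l, structConst G B e a k l *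
      B (e k) (phiAd G ξ (e b)) * B (e l) (phiAd G ξ (e c))) +
    (B (e b) (fderiv ℝ (phiAd G) ξ (e a) (e c)) - ∑ k, ∑ l, structConst G B e b k l *
      B (e k) (phiAd G ξ (e c)) * B (e l) (phiAd G ξ (e a))) +
    (B (e c) (fderiv ℝ (phiAd G) ξ (e b) (e a)) - ∑ k, ∑ l, structConst G B e c k l *
      B (e k) (phiAd G ξ (e a)) * B (e l) (phiAd G ξ (e b))) = 1 / 4 * structConst G B e a b c := by
  have h := dynamical_yang_baxter_complex hB he hξ (Pi.single a 1) (Pi.single b 1) (Pi.single c 1)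
  -- Rotation brings the argument without φ(ad ξ) into the first slot of each quadratic term.
  rw [cform_rotate hB (Matrix.mulVec _ (Pi.single a 1)) (Pi.single b 1),
    ← cform_rotate hB (Pi.single c 1) (Matrix.mulVec _ (Pi.single a 1))] at h
  have hf : ∀ x y : ι → ℂ, ∀ a, cform G B e (Pi.single a 1) x y =
      ∑ k, ∑ l, x k * y l * (structConst G B e a k l : ℂ) := by
    intro x y a
    rw [cform_eq_sum, Finset.sum_eq_single a (fun a' _ ha => by simp [ha]) (by simp)]
    simp
  have hext : ∀ Λ : 𝔤 →L[ℝ] 𝔤 →L[ℝ] 𝔤, ∀ c, cext B e Λ (Pi.single c 1) = cmat B e (Λ (e c)) := by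
    intro Λ c
    rw [cext, Finset.sum_eq_single c (fun a' _ ha => by simp [ha]) (by simp)]
    simp
  have hf3 : cform G B e (Pi.single a 1) (Pi.single b 1) (Pi.single c 1) = structConst G B e a b c := by
    rw [hf, Finset.sum_eq_single b (fun a' _ ha => by simp [ha]) (by simp),
      Finset.sum_eq_single c (fun a' _ ha => by simp [ha]) (by simp)]
    simp
  simp only [hf3] at h
  simp only [hf, hext, Matrix.mulVec_single_one, single_dotProduct, one_mul, Matrix.col_apply,
    cmat_apply] at h
  rw [← sub_eq_zero]
  have h' : ∀ x y : ℝ, (x : ℂ) = (y : ℂ) → x = y := fun x y h => by exact_mod_cast h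
  apply h'
  push_cast
  rw [← h]
  have hs : ∀ a b c : ι, ∑ k, ∑ l, (structConst G B e a k l : ℂ) * (B (e k) (phiAd G ξ (e b)) : ℝ) *
      (B (e l) (phiAd G ξ (e c)) : ℝ) = ∑ k, ∑ l, ((B (e k) (phiAd G ξ (e b)) : ℝ) : ℂ) *
      ((B (e l) (phiAd G ξ (e c)) : ℝ) : ℂ) * (structConst G B e a k l : ℂ) := by
    intro a b c
    exact Finset.sum_congr rfl fun k _ => Finset.sum_congr rfl fun l _ => by ring
  rw [hs, hs, hs]
  ring

end Dynamical

/-! ### Differentials of real-valued functions -/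

section RealCalculus
variable {E : Type*} [NormedAddCommGroup E] [NormedSpace ℝ E]
  {N : Type*} [TopologicalSpace N] [ChartedSpace E N] {f g : N → ℝ} {p : N}

lemma tder_add (hf : MDifferentiableAt 𝓘(ℝ, E) 𝓘(ℝ, ℝ) f p)
    (hg : MDifferentiableAt 𝓘(ℝ, E) 𝓘(ℝ, ℝ) g p) :
    tder E ℝ (fun x => f x + g x) p = tder E ℝ f p + tder E ℝ g p :=
  (hf.hasMFDerivAt.add hg.hasMFDerivAt).mfderiv

lemma tder_sub (hf : MDifferentiableAt 𝓘(ℝ, E) 𝓘(ℝ, ℝ) f p)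
    (hg : MDifferentiableAt 𝓘(ℝ, E) 𝓘(ℝ, ℝ) g p) :
    tder E ℝ (fun x => f x - g x) p = tder E ℝ f p - tder E ℝ g p :=
  (hf.hasMFDerivAt.sub hg.hasMFDerivAt).mfderiv

lemma tder_neg (f : N → ℝ) (p : N) : tder E ℝ (fun x => -f x) p = -tder E ℝ f p :=
  mfderiv_neg

lemma tder_mul (hf : MDifferentiableAt 𝓘(ℝ, E) 𝓘(ℝ, ℝ) f p)
    (hg : MDifferentiableAt 𝓘(ℝ, E) 𝓘(ℝ, ℝ) g p) :
    tder E ℝ (fun x => f x * g x) p = f p • tder E ℝ g p + g p • tder E ℝ f p :=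
  (hf.hasMFDerivAt.mul hg.hasMFDerivAt).mfderiv

lemma tder_sum {κ : Type*} (s : Finset κ) {f : κ → N → ℝ}
    (hf : ∀ i, ContMDiff 𝓘(ℝ, E) 𝓘(ℝ, ℝ) ∞ (f i)) (p : N) :
    tder E ℝ (fun x => ∑ i ∈ s, f i x) p = ∑ i ∈ s, tder E ℝ (f i) p := by
  classical
  induction s using Finset.induction_on with
  | empty => simpa using tder_const (E := E) (E₃ := ℝ) (0 : ℝ) p
  | insert i s hi ih =>
    simp only [Finset.sum_insert hi]
    rw [tder_add (mdiff_of_contMDiff (hf i) p)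
      (mdiff_of_contMDiff (contMDiff_finsetSum fun i _ => hf i) p), ih]

/-- The Leibniz rule for a continuous bilinear map. -/
lemma tder_bilin {E₂ : Type*} [NormedAddCommGroup E₂] [NormedSpace ℝ E₂]
    {N₂ : Type*} [TopologicalSpace N₂] [ChartedSpace E₂ N₂] {V : Type*} [NormedAddCommGroup V]
    [NormedSpace ℝ V] (b : V →L[ℝ] V →L[ℝ] ℝ) {F F' : N₂ → V} {p : N₂}
    (hF : MDifferentiableAt 𝓘(ℝ, E₂) 𝓘(ℝ, V) F p) (hF' : MDifferentiableAt 𝓘(ℝ, E₂) 𝓘(ℝ, V) F' p)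
    (u : E₂) :
    tder E₂ ℝ (fun x => b (F x) (F' x)) p u =
      b (tder E₂ V F p u) (F' p) + b (F p) (tder E₂ V F' p u) := by
  have hK : MDifferentiableAt (𝓘(ℝ, V).prod 𝓘(ℝ, V)) 𝓘(ℝ, ℝ) (fun z : V × V => b z.1 z.2)
      (F p, F' p) := by
    have : ContMDiff (𝓘(ℝ, V).prod 𝓘(ℝ, V)) 𝓘(ℝ, ℝ) ∞ (fun z : V × V => b z.1 z.2) :=
      ContMDiff.clm_apply (b.contMDiff.comp contMDiff_fst) contMDiff_snd
    exact this.mdifferentiable (by simp) _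
  have h := tder_prod (K := fun z : V × V => b z.1 z.2) hK hF hF' u
  rw [h]
  congr 1
  · rw [show (fun y => b y (F' p)) = fun y => (b.flip (F' p)) y from rfl, tder_eq_fderiv,
      ContinuousLinearMap.fderiv]; rfl
  · rw [show (fun y => b (F p, y).1 (F p, y).2) = fun y => b (F p) y from rfl, tder_eq_fderiv,
      ContinuousLinearMap.fderiv]

end RealCalculus

/-! ### Evaluation of multivectors on covectors -/

section Pairing
variable {W W' : Type*} [AddCommGroup W] [Module ℝ W] [AddCommGroup W'] [Module ℝ W']

lemma update_pair_zero (x y z : W) : Function.update ![x, y] 0 z = ![z, y] := by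
  ext i; fin_cases i <;> rfl

lemma update_pair_one (x y z : W) : Function.update ![x, y] 1 z = ![x, z] := by
  ext i; fin_cases i <;> rfl

variable (W) in
/-- The wedge product of two vectors, as a bilinear map. -/
def wedge : W →ₗ[ℝ] W →ₗ[ℝ] ⋀[ℝ]^2 W :=
  LinearMap.mk₂ ℝ (fun x y => exteriorPower.ιMulti ℝ 2 ![x, y])
    (fun x x' y => by
      have h := (exteriorPower.ιMulti ℝ 2 (M := W)).map_update_add ![x, y] 0 x x'
      simpa only [update_pair_zero] using h)
    (fun c x y => by
      have h := (exteriorPower.ιMulti ℝ 2 (M := W)).map_update_smul ![x, y] 0 c x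
      simpa only [update_pair_zero] using h)
    (fun x y y' => by
      have h := (exteriorPower.ιMulti ℝ 2 (M := W)).map_update_add ![x, y] 1 y y'
      simpa only [update_pair_one] using h)
    (fun c x y => by
      have h := (exteriorPower.ιMulti ℝ 2 (M := W)).map_update_smul ![x, y] 1 c y
      simpa only [update_pair_one] using h)

lemma wedge_apply (x y : W) : wedge W x y = exteriorPower.ιMulti ℝ 2 ![x, y] := rfl

/-- Evaluation of a bivector, as a bilinear form on covectors. -/
def biv (Q : ⋀[ℝ]^2 W) : Module.Dual ℝ W →ₗ[ℝ] Module.Dual ℝ W →ₗ[ℝ] ℝ :=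
  (wedge (Module.Dual ℝ W)).compr₂ ((exteriorPower.pairingDual ℝ W 2).flip Q)

lemma ev_eq_biv (Q : ⋀[ℝ]^2 W) (α β : Module.Dual ℝ W) : ev Q ![α, β] = biv Q α β := rfl

lemma biv_swap (Q : ⋀[ℝ]^2 W) (α β : Module.Dual ℝ W) : biv Q α β = -biv Q β α := by
  have h : exteriorPower.ιMulti ℝ 2 ![α, β] = -exteriorPower.ιMulti ℝ 2 ![β, α] := by
    have := (exteriorPower.ιMulti ℝ 2 (M := Module.Dual ℝ W)).map_swap ![β, α]
      (i := 0) (j := 1) (by simp)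
    rw [← this]
    congr 1
    ext i; fin_cases i <;> simp
  rw [← ev_eq_biv, ← ev_eq_biv, ev, ev, h, map_neg, LinearMap.neg_apply]

lemma ev_ιMulti {k : ℕ} (v : Fin k → W) (α : Fin k → Module.Dual ℝ W) :
    ev (exteriorPower.ιMulti ℝ k v) α = Matrix.det (Matrix.of fun i j => α j (v i)) :=
  exteriorPower.pairingDual_ιMulti_ιMulti α v

lemma ev_map {k : ℕ} (L : W →ₗ[ℝ] W') (Q : ⋀[ℝ]^k W) (α : Fin k → Module.Dual ℝ W') :
    ev (exteriorPower.map k L Q) α = ev Q (fun i => (α i).comp L) := by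
  have h : (exteriorPower.pairingDual ℝ W' k (exteriorPower.ιMulti ℝ k α)).comp
      (exteriorPower.map k L) =
      exteriorPower.pairingDual ℝ W k (exteriorPower.ιMulti ℝ k fun i => (α i).comp L) := by
    refine exteriorPower.linearMap_ext ?_
    ext v
    simp [exteriorPower.map_apply_ιMulti]
  exact LinearMap.congr_fun h Q

lemma biv_wedge (x y : W) (α β : Module.Dual ℝ W) :
    biv (wedge W x y) α β = α x * β y - β x * α y := by
  rw [← ev_eq_biv, wedge_apply, ev_ιMulti, Matrix.det_fin_two]
  simp

lemma ev_smul {k : ℕ} (c : ℝ) (Q : ⋀[ℝ]^k W) (α : Fin k → Module.Dual ℝ W) :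
    ev (c • Q) α = c * ev Q α := map_smul _ _ _

lemma ev_sum {k : ℕ} {κ : Type*} (s : Finset κ) (Q : κ → ⋀[ℝ]^k W) (α : Fin k → Module.Dual ℝ W) :
    ev (∑ i ∈ s, Q i) α = ∑ i ∈ s, ev (Q i) α := map_sum _ _ _

lemma ev_zero {k : ℕ} (α : Fin k → Module.Dual ℝ W) : ev (0 : ⋀[ℝ]^k W) α = 0 := map_zero _

end Pairing

/-! ### The tensors φ and T evaluated on covectors -/

section Tensors
variable {𝔤 : Type*} [NormedAddCommGroup 𝔤] [NormedSpace ℝ 𝔤] [FiniteDimensional ℝ 𝔤]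
  {G : Type*} [TopologicalSpace G] [ChartedSpace 𝔤 G] [Group G] [LieGroup 𝓘(ℝ, 𝔤) ∞ G] [T2Space G]
  {ι : Type*} [Fintype ι] [DecidableEq ι]
  {B : LinearMap.BilinForm ℝ 𝔤} {e : Module.Basis ι ℝ 𝔤}

/-- By total antisymmetry of the coefficients each of the six terms of the determinant contributes
the same sum. -/
lemma sum_det_eq_six_mul {R : Type*} [CommRing R] (c : ι → ι → ι → R)
    (h1 : ∀ a b d, c a b d = -c a d b) (h2 : ∀ a b d, c a b d = -c d b a) (x y z : ι → R) :
    ∑ a, ∑ b, ∑ d, c a b d * (x a * y b * z d - x a * z b * y d - y a * x b * z d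
      + y a * z b * x d + z a * x b * y d - z a * y b * x d) =
    6 * ∑ a, ∑ b, ∑ d, c a b d * (x a * y b * z d) := by
  have s23 : ∀ u v w : ι → R, ∑ a, ∑ b, ∑ d, c a b d * (u a * v b * w d) =
      -∑ a, ∑ b, ∑ d, c a b d * (u a * w b * v d) := by
    intro u v w
    rw [← Finset.sum_neg_distrib]
    refine Finset.sum_congr rfl fun a _ => ?_
    rw [Finset.sum_comm, ← Finset.sum_neg_distrib]
    refine Finset.sum_congr rfl fun d _ => ?_
    rw [← Finset.sum_neg_distrib]
    refine Finset.sum_congr rfl fun b _ => ?_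
    rw [h1 a b d]; ring
  have s13 : ∀ u v w : ι → R, ∑ a, ∑ b, ∑ d, c a b d * (u a * v b * w d) =
      -∑ a, ∑ b, ∑ d, c a b d * (w a * v b * u d) := by
    intro u v w
    have e1 : ∑ a, ∑ b, ∑ d, c a b d * (u a * v b * w d) =
        ∑ d, ∑ b, ∑ a, c a b d * (u a * v b * w d) := by
      rw [Finset.sum_comm, Finset.sum_congr rfl fun b _ => Finset.sum_comm, Finset.sum_comm]
    rw [e1, ← Finset.sum_neg_distrib]
    refine Finset.sum_congr rfl fun d _ => ?_
    rw [← Finset.sum_neg_distrib]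
    refine Finset.sum_congr rfl fun b _ => ?_
    rw [← Finset.sum_neg_distrib]
    refine Finset.sum_congr rfl fun a _ => ?_
    rw [h2 a b d]; ring
  simp only [mul_add, mul_sub, Finset.sum_add_distrib, Finset.sum_sub_distrib]
  have e1 := s23 x z y
  have e2 := s13 z y x
  have e3 := s23 y x z
  have e4 := s13 y z x
  have e5 := s23 z x y
  rw [e5, e3, e4, e2, e1]
  ring

lemma ev_map_cartanTensor (hB : IsInvariantInnerProduct G B) {W : Type*} [AddCommGroup W]
    [Module ℝ W] (L : 𝔤 →ₗ[ℝ] W) (α β γ : Module.Dual ℝ W) :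
    ev (exteriorPower.map 3 L (cartanTensor G B e)) ![α, β, γ] =
      1 / 2 * ∑ a, ∑ b, ∑ c, structConst G B e a b c *
        (α (L (e a)) * β (L (e b)) * γ (L (e c))) := by
  rw [ev_map, cartanTensor, ev_smul]
  simp only [ev_sum, ev_smul, ev_ιMulti, Matrix.det_fin_three, Matrix.of_apply]
  have h := sum_det_eq_six_mul (fun a b c => structConst G B e a b c)
    (fun a b c => structConst_swap₂₃ a b c) (fun a b c => structConst_swap₁₃ hB a b c)
    (fun a => α (L (e a))) (fun a => β (L (e a))) (fun a => γ (L (e a)))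
  rw [show (1 / 2 : ℝ) = 1 / 12 * 6 by norm_num, mul_assoc, ← h]
  rfl

variable [CompactSpace G]

/-- Written as ½ ∑ r(e_b) ∧ e_b, the tensor uses the basis only through ∑ e_b ⊗ e_b, which makes
equivariance accessible. -/
lemma Ttensor_eq (hB : IsInvariantInnerProduct G B)
    (he : ∀ a b, B (e a) (e b) = if a = b then 1 else 0) {ξ : 𝔤} (hξ : ξ ∈ expRegular G) :
    Ttensor G B e ξ = (1 / 2 : ℝ) • ∑ b, wedge 𝔤 (phiAd G ξ (e b)) (e b) := by
  rw [Ttensor]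
  congr 1
  rw [Finset.sum_comm]
  refine Finset.sum_congr rfl fun b _ => ?_
  conv_rhs => rw [← sum_orthonormal_smul he (phiAd G ξ (e b))]
  simp only [map_sum, map_smul, LinearMap.sum_apply, LinearMap.smul_apply, wedge_apply,
    Tcoef_eq hB he hξ]

/-- The factor 1/2 disappears because the coefficients are skew, so the two terms of each wedge
contribute equally. -/
lemma biv_Ttensor (hB : IsInvariantInnerProduct G B)
    (he : ∀ a b, B (e a) (e b) = if a = b then 1 else 0) {ξ : 𝔤} (hξ : ξ ∈ expRegular G)
    (α β : Module.Dual ℝ 𝔤) : biv (Ttensor G B e ξ) α β =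
      ∑ a, ∑ b, B (e a) (phiAd G ξ (e b)) * α (e a) * β (e b) := by
  have h1 : biv (Ttensor G B e ξ) α β = 1 / 2 * ∑ a, ∑ b, B (e a) (phiAd G ξ (e b)) *
      (α (e a) * β (e b) - β (e a) * α (e b)) := by
    rw [← ev_eq_biv, Ttensor, ev_smul]
    simp only [ev_sum, ev_smul, Tcoef_eq hB he hξ]
    simp only [← wedge_apply, ev_eq_biv, biv_wedge]
  have h2 : ∑ a, ∑ b, B (e a) (phiAd G ξ (e b)) * (β (e a) * α (e b)) =
      -∑ a, ∑ b, B (e a) (phiAd G ξ (e b)) * (α (e a) * β (e b)) := by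
    rw [Finset.sum_comm, ← Finset.sum_neg_distrib]
    refine Finset.sum_congr rfl fun a _ => ?_
    rw [← Finset.sum_neg_distrib]
    refine Finset.sum_congr rfl fun b _ => ?_
    rw [phiAd_skew hB he hξ b a]; ring
  rw [h1]
  simp only [mul_sub, Finset.sum_sub_distrib, h2, mul_assoc]
  ring

/-- `Ad g` is orthogonal for B, so ∑ e_b ⊗ e_b is invariant under it. -/
lemma sum_orthogonal_change (hB : IsInvariantInnerProduct G B)
    (he : ∀ a b, B (e a) (e b) = if a = b then 1 else 0) {X : Type*} [AddCommGroup X] [Module ℝ X]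
    (s : 𝔤 →ₗ[ℝ] 𝔤 →ₗ[ℝ] X) (g : G) :
    ∑ b, s (Ad g (e b)) (Ad g (e b)) = ∑ b, s (e b) (e b) := by
  have hR : ∀ c b, B (e c) (Ad g (e b)) = B (e b) (Ad g⁻¹ (e c)) := by
    intro c b
    rw [← hB.invariant g⁻¹, Ad_inv_Ad, hB.symm]
  have horth : ∀ c d, ∑ b, B (e c) (Ad g (e b)) * B (e d) (Ad g (e b)) = if c = d then 1 else 0 := by
    intro c d
    simp only [hR]
    rw [← he c d, ← hB.invariant g⁻¹ (e c) (e d)]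
    conv_rhs => rw [← sum_orthonormal_smul he (Ad g⁻¹ (e c))]
    simp
  have h1 : ∀ b, s (Ad g (e b)) (Ad g (e b)) = ∑ c, ∑ d,
      (B (e c) (Ad g (e b)) * B (e d) (Ad g (e b))) • s (e c) (e d) := by
    intro b
    conv_lhs => rw [← sum_orthonormal_smul he (Ad g (e b))]
    simp only [map_sum, map_smul, LinearMap.sum_apply, LinearMap.smul_apply, Finset.smul_sum,
      smul_smul]
    rw [Finset.sum_comm]
    exact Finset.sum_congr rfl fun c _ => Finset.sum_congr rfl fun d _ => by rw [mul_comm]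
  simp only [h1]
  rw [Finset.sum_comm]
  refine Finset.sum_congr rfl fun c _ => ?_
  rw [Finset.sum_comm]
  simp only [← Finset.sum_smul, horth]
  simp

lemma map_Ad_Ttensor (hB : IsInvariantInnerProduct G B)
    (he : ∀ a b, B (e a) (e b) = if a = b then 1 else 0) {ξ : 𝔤} (hξ : ξ ∈ expRegular G) (g : G) :
    exteriorPower.map 2 (Ad g : 𝔤 →L[ℝ] 𝔤).toLinearMap (Ttensor G B e ξ) =
      Ttensor G B e (Ad g ξ) := by
  rw [Ttensor_eq hB he hξ, Ttensor_eq hB he (Ad_mem_expRegular hξ g), map_smul, map_sum]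
  congr 1
  have h := sum_orthogonal_change hB he
    ((wedge 𝔤).comp (phiAd G (Ad g ξ)).toLinearMap) g
  simp only [LinearMap.comp_apply, ContinuousLinearMap.coe_coe] at h
  rw [← h]
  refine Finset.sum_congr rfl fun b _ => ?_
  rw [wedge_apply, exteriorPower.map_apply_ιMulti, wedge_apply]
  congr 1
  have h2 := congrArg (fun L : 𝔤 →L[ℝ] 𝔤 => L (e b)) (phiAd_Ad hξ g)
  ext i
  fin_cases i
  · exact h2.symm
  · rfl

end Tensors

/-! ### Bivectors as continuous bilinear forms -/

section Bivector
variable {V : Type*} [NormedAddCommGroup V] [NormedSpace ℝ V] [FiniteDimensional ℝ V]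

/-- Evaluation of a bivector, as a continuous bilinear form on continuous covectors. -/
def bivC (Q : ⋀[ℝ]^2 V) : (V →L[ℝ] ℝ) →L[ℝ] (V →L[ℝ] ℝ) →L[ℝ] ℝ :=
  ((biv Q).compl₁₂ (ContinuousLinearMap.coeLM ℝ : (V →L[ℝ] ℝ) →ₗ[ℝ] V →ₗ[ℝ] ℝ)
    (ContinuousLinearMap.coeLM ℝ : (V →L[ℝ] ℝ) →ₗ[ℝ] V →ₗ[ℝ] ℝ)).toContinuousBilinearMap

lemma bivC_apply (Q : ⋀[ℝ]^2 V) (α β : V →L[ℝ] ℝ) :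
    bivC Q α β = biv Q α.toLinearMap β.toLinearMap := rfl

lemma bivC_swap (Q : ⋀[ℝ]^2 V) (α β : V →L[ℝ] ℝ) : bivC Q α β = -bivC Q β α := biv_swap Q _ _

end Bivector

/-! ### Generating vector fields and invariant bivector fields -/

section Action
variable {𝔤 : Type*} [NormedAddCommGroup 𝔤] [NormedSpace ℝ 𝔤] [FiniteDimensional ℝ 𝔤]
  {G : Type*} [TopologicalSpace G] [ChartedSpace 𝔤 G] [Group G] [LieGroup 𝓘(ℝ, 𝔤) ∞ G] [T2Space G]
  {V : Type*} [NormedAddCommGroup V] [NormedSpace ℝ V] [FiniteDimensional ℝ V]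
  {M : Type*} [TopologicalSpace M] [ChartedSpace V M] [IsManifold 𝓘(ℝ, V) ∞ M]
  [MulAction G M] [ContMDiffSMul 𝓘(ℝ, 𝔤) 𝓘(ℝ, V) ∞ G M]

/-- The value of a bivector field, as a bivector on the model space. -/
def bivAt (P : MultivectorField V M 2) (m : M) : ⋀[ℝ]^2 V := P m

lemma bracket_eq (P : MultivectorField V M 2) (f g : M → ℝ) (m : M) :
    bracket P f g m = bivC (bivAt P m) (tder V ℝ f m) (tder V ℝ g m) := by
  rw [bivC_apply, ← ev_eq_biv]; rfl

lemma bracket_swap (P : MultivectorField V M 2) (f g : M → ℝ) (m : M) :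
    bracket P f g m = -bracket P g f m := by
  rw [bracket_eq, bracket_eq, bivC_swap]

variable (G V) in
/-- The infinitesimal action, with values in the model space. -/
def gen (m : M) : 𝔤 →L[ℝ] V := -tder 𝔤 V (fun g : G => g • m) 1

variable (G V) in
/-- The derivative of a function along a generating vector field. -/
def lieD (ξ : 𝔤) (f : M → ℝ) (m : M) : ℝ := tder V ℝ f m (gen G V m ξ)

lemma contMDiff_action : ContMDiff (𝓘(ℝ, 𝔤).prod 𝓘(ℝ, V)) 𝓘(ℝ, V) ∞
    (fun z : G × M => z.1 • z.2) :=
  ContMDiffSMul.contMDiff_smul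

lemma contMDiff_orbit (m : M) : ContMDiff 𝓘(ℝ, 𝔤) 𝓘(ℝ, V) ∞ (fun g : G => g • m) :=
  (contMDiff_action (𝔤 := 𝔤)).comp (contMDiff_id.prodMk contMDiff_const)

lemma tder_gen {E₃ N' : Type*} [NormedAddCommGroup E₃] [NormedSpace ℝ E₃] [TopologicalSpace N']
    [ChartedSpace E₃ N'] {F : M → N'} {m : M} (hF : MDifferentiableAt 𝓘(ℝ, V) 𝓘(ℝ, E₃) F m) (ξ : 𝔤) :
    tder V E₃ F m (gen G V m ξ) = -tder 𝔤 E₃ (fun g : G => F (g • m)) 1 ξ := by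
  rw [gen, neg_apply, map_neg]
  congr 1
  have h := tder_comp_apply (p := (1 : G)) (f := fun g : G => g • m) (F := F)
    (by rwa [one_smul]) (mdiff_of_contMDiff (contMDiff_orbit m) 1) ξ
  rw [h, one_smul]

lemma lieD_eq {f : M → ℝ} (hf : ContMDiff 𝓘(ℝ, V) 𝓘(ℝ, ℝ) ∞ f) (ξ : 𝔤) (m : M) :
    lieD G V ξ f m = -tder 𝔤 ℝ (fun g : G => f (g • m)) 1 ξ :=
  tder_gen (mdiff_of_contMDiff hf m) ξ

lemma contMDiff_comp_action {f : M → ℝ} (hf : ContMDiff 𝓘(ℝ, V) 𝓘(ℝ, ℝ) ∞ f) :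
    ContMDiff (𝓘(ℝ, 𝔤).prod 𝓘(ℝ, V)) 𝓘(ℝ, ℝ) ∞ (fun z : G × M => f (z.1 • z.2)) :=
  hf.comp contMDiff_action

lemma contMDiff_lieD {f : M → ℝ} (hf : ContMDiff 𝓘(ℝ, V) 𝓘(ℝ, ℝ) ∞ f) (ξ : 𝔤) :
    ContMDiff 𝓘(ℝ, V) 𝓘(ℝ, ℝ) ∞ (lieD G V ξ f) := by
  have h := (ContMDiff.clm_eval (contMDiff_tder_left (contMDiff_comp_action (G := G) hf) 1) ξ).neg
  convert h using 2 with m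
  exact lieD_eq hf ξ m

/-- The minus sign in the definition of ξ_M makes ξ ↦ ξ_M a homomorphism of Lie algebras. -/
lemma lieD_comm {f : M → ℝ} (hf : ContMDiff 𝓘(ℝ, V) 𝓘(ℝ, ℝ) ∞ f) (ξ η : 𝔤) (m : M) :
    lieD G V ξ (lieD G V η f) m - lieD G V η (lieD G V ξ f) m = lieD G V (lieBr G ξ η) f m := by
  have hφ : ContMDiff 𝓘(ℝ, 𝔤) 𝓘(ℝ, ℝ) ∞ (fun g : G => f (g • m)) := hf.comp (contMDiff_orbit m)
  have hmul : ContMDiff (𝓘(ℝ, 𝔤).prod 𝓘(ℝ, 𝔤)) 𝓘(ℝ, ℝ) ∞ (fun z : G × G => f ((z.1 * z.2) • m)) :=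
    hφ.comp contMDiff_mul'
  -- The outer derivative moves the point first, so ξ belongs to the factor x next to m and η to the
  -- factor g. The two minus signs cancel.
  have key : ∀ ξ η : 𝔤, lieD G V ξ (lieD G V η f) m =
      tder 𝔤 ℝ (fun g : G => tder 𝔤 ℝ (fun x : G => f ((g * x) • m)) 1 ξ) 1 η := by
    intro ξ η
    rw [lieD_eq (contMDiff_lieD hf η)]
    simp only [lieD_eq hf η, smul_smul]
    rw [tder_neg, neg_apply, neg_neg]
    exact (tder_tder_swap hmul 1 1 η ξ).symm
  rw [key, key, lieD_eq hf, tder_lieBr hφ]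
  ring

lemma ev_eq_bivC (P : MultivectorField V M 2) (m : M)
    (α β : V →L[ℝ] ℝ) (α' β' : Module.Dual ℝ (TangentSpace 𝓘(ℝ, V) m)) (hα : α' = α.toLinearMap)
    (hβ : β' = β.toLinearMap) : ev (P m) ![α', β'] = bivC (bivAt P m) α β := by
  subst hα; subst hβ
  rw [bivC_apply, ← ev_eq_biv]; rfl

lemma bivC_bivAt_smul {P : MultivectorField V M 2} (hP : IsInvariant G P) (g : G) (m : M)
    (α β : V →L[ℝ] ℝ) : bivC (bivAt P (g • m)) α β =
      bivC (bivAt P m) (α.comp (tder V V (fun x : M => g • x) m))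
        (β.comp (tder V V (fun x : M => g • x) m)) := by
  rw [← ev_eq_bivC P (g • m) α β α.toLinearMap β.toLinearMap rfl rfl, ← hP g m, ev_map]
  rw [← ev_eq_bivC P m _ _ _ _ rfl rfl]
  congr 1
  ext i : 1; fin_cases i <;> rfl

lemma bracket_translate {P : MultivectorField V M 2} (hP : IsInvariant G P) {f k : M → ℝ}
    (hf : ContMDiff 𝓘(ℝ, V) 𝓘(ℝ, ℝ) ∞ f) (hk : ContMDiff 𝓘(ℝ, V) 𝓘(ℝ, ℝ) ∞ k) (g : G)
    (hg : ContMDiff 𝓘(ℝ, V) 𝓘(ℝ, V) ∞ fun m : M => g • m) (m : M) :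
    bracket P f k (g • m) = bivC (bivAt P m) (tder V ℝ (fun x => f (g • x)) m)
      (tder V ℝ (fun x => k (g • x)) m) := by
  have hc : ∀ {f : M → ℝ}, ContMDiff 𝓘(ℝ, V) 𝓘(ℝ, ℝ) ∞ f → tder V ℝ (fun x => f (g • x)) m =
      (tder V ℝ f (g • m)).comp (tder V V (fun x => g • x) m) := fun hf =>
    tder_comp (mdiff_of_contMDiff hf _)
      (mdiff_of_contMDiff hg m)
  rw [hc hf, hc hk, bracket_eq, bivC_bivAt_smul hP]

/-- By invariance, {f, k}(g.m) is P at the fixed point m evaluated on the differentials of the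
translated functions. Differentiating in g is then the Leibniz rule for a fixed bilinear form. -/
lemma lieD_bracket {P : MultivectorField V M 2} (hPs : IsSmoothBivector P) (hP : IsInvariant G P)
    {f k : M → ℝ} (hf : ContMDiff 𝓘(ℝ, V) 𝓘(ℝ, ℝ) ∞ f) (hk : ContMDiff 𝓘(ℝ, V) 𝓘(ℝ, ℝ) ∞ k)
    (ξ : 𝔤) (m : M) :
    lieD G V ξ (bracket P f k) m = bracket P (lieD G V ξ f) k m + bracket P f (lieD G V ξ k) m := by
  have hd : ∀ {f : M → ℝ}, ContMDiff 𝓘(ℝ, V) 𝓘(ℝ, ℝ) ∞ f →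
      tder 𝔤 (V →L[ℝ] ℝ) (fun g : G => tder V ℝ (fun x => f (g • x)) m) 1 ξ =
        -tder V ℝ (lieD G V ξ f) m := by
    intro f hf
    have hs := contMDiff_tder_right (contMDiff_comp_action (𝔤 := 𝔤) (G := G) hf) m
    ext v
    rw [← tder_clm_eval (mdiff_of_contMDiff hs 1), tder_tder_swap (contMDiff_comp_action (G := G) hf),
      neg_apply, ← neg_apply, ← tder_neg]
    congr 2
    ext y
    rw [lieD_eq hf, neg_neg]
  have h1 : ∀ {f : M → ℝ}, tder V ℝ (fun x => f ((1 : G) • x)) m = tder V ℝ f m := by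
    intro f; simp only [one_smul]
  rw [lieD_eq (hPs f k hf hk)]
  simp only [fun g : G => bracket_translate hP hf hk g
    (ContMDiffSMul.contMDiff_const_smul (I := 𝓘(ℝ, 𝔤)) g) m]
  rw [tder_bilin _ (mdiff_of_contMDiff (contMDiff_tder_right (contMDiff_comp_action (G := G) hf) m) 1)
    (mdiff_of_contMDiff (contMDiff_tder_right (contMDiff_comp_action (G := G) hk) m) 1), hd hf, hd hk,
    h1, h1, bracket_eq, bracket_eq]
  simp only [map_neg, neg_apply]
  ring

/-- Differentiate (g x g⁻¹).(g.m) = g.(x.m) at x = 1. -/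
lemma gen_smul_Ad (g : G) (m : M) (ξ : 𝔤) :
    gen G V (g • m) (Ad g ξ) = tder V V (fun x : M => g • x) m (gen G V m ξ) := by
  rw [tder_gen (mdiff_of_contMDiff (ContMDiffSMul.contMDiff_const_smul (I := 𝓘(ℝ, 𝔤)) g) m), gen,
    neg_apply, tder_Ad (mdiff_of_contMDiff (contMDiff_orbit (g • m)) 1)]
  simp [smul_smul]

end Action

/-! ### Index computations for the Jacobiator -/

section JacobiAlgebra
variable {ι : Type*} [Fintype ι]

lemma sum_rotate {R : Type*} [AddCommMonoid R] (X : ι → ι → ι → R) :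
    ∑ a, ∑ b, ∑ c, X a b c = ∑ b, ∑ c, ∑ a, X a b c := by
  rw [Finset.sum_comm]
  exact Finset.sum_congr rfl fun b _ => Finset.sum_comm

lemma sum_pair_comm {R : Type*} [AddCommMonoid R] (X : ι → ι → ι → ι → R) :
    ∑ b, ∑ c, ∑ k, ∑ l, X b c k l = ∑ k, ∑ l, ∑ b, ∑ c, X b c k l := by
  have h : ∀ b, ∑ c, ∑ k, ∑ l, X b c k l = ∑ k, ∑ l, ∑ c, X b c k l := fun b =>
    sum_rotate fun c k l => X b c k l
  simp only [h]
  rw [sum_rotate]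

/-- The contraction of a vector with a matrix in the first index. -/
def hat (t : ι → ι → ℝ) (x : ι → ℝ) (d : ι) : ℝ := ∑ c, t c d * x c

/-- The trilinear form with the given coefficients. -/
def tri (fs : ι → ι → ι → ℝ) (x y z : ι → ℝ) : ℝ := ∑ a, ∑ b, ∑ c, fs a b c * (x a * y b * z c)

variable {t : ι → ι → ℝ} {fs : ι → ι → ι → ℝ}

lemma sum_mul_eq_neg_hat (ht : ∀ a b, t a b = -t b a) (x : ι → ℝ) (k : ι) :
    ∑ b, t k b * x b = -hat t x k := by
  rw [hat, ← Finset.sum_neg_distrib]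
  exact Finset.sum_congr rfl fun b _ => by rw [ht k b]; ring

lemma sum_sum_mul_hat_right (ht : ∀ a b, t a b = -t b a) (x y : ι → ℝ) :
    ∑ a, ∑ b, t a b * x b * y a = -∑ a, hat t x a * y a := by
  rw [← Finset.sum_neg_distrib]
  refine Finset.sum_congr rfl fun a _ => ?_
  rw [← Finset.sum_mul, sum_mul_eq_neg_hat ht]; ring

lemma sum_sum_mul_hat_left (x y : ι → ℝ) :
    ∑ a, ∑ b, t a b * x a * y b = ∑ b, hat t x b * y b := by
  rw [Finset.sum_comm]
  refine Finset.sum_congr rfl fun b _ => ?_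
  rw [hat, ← Finset.sum_mul]

lemma tri_rotate (hf : ∀ a b c, fs a b c = fs b c a) (x y z : ι → ℝ) :
    tri fs x y z = tri fs y z x := by
  rw [tri, sum_rotate, tri]
  refine Finset.sum_congr rfl fun b _ => Finset.sum_congr rfl fun c _ => Finset.sum_congr rfl
    fun a _ => ?_
  rw [hf a b c]; ring

lemma tri_swap (hf : ∀ a b c, fs a b c = -fs a c b) (x y z : ι → ℝ) :
    tri fs x y z = -tri fs x z y := by
  rw [tri, tri, ← Finset.sum_neg_distrib]
  refine Finset.sum_congr rfl fun a _ => ?_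
  rw [Finset.sum_comm, ← Finset.sum_neg_distrib]
  refine Finset.sum_congr rfl fun c _ => ?_
  rw [← Finset.sum_neg_distrib]
  refine Finset.sum_congr rfl fun b _ => ?_
  rw [hf a b c]; ring

lemma sum_quadratic (ht : ∀ a b, t a b = -t b a) (x y z : ι → ℝ) :
    ∑ a, ∑ b, ∑ c, x a * y b * z c * ∑ k, ∑ l, fs a k l * t k b * t l c =
      tri fs x (hat t y) (hat t z) := by
  rw [tri]
  refine Finset.sum_congr rfl fun a _ => ?_
  simp only [Finset.mul_sum]
  rw [sum_pair_comm]
  refine Finset.sum_congr rfl fun k _ => Finset.sum_congr rfl fun l _ => ?_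
  have h : hat t y k * hat t z l = (∑ b, t k b * y b) * ∑ c, t l c * z c := by
    rw [sum_mul_eq_neg_hat ht, sum_mul_eq_neg_hat ht]; ring
  rw [mul_assoc (x a), h, Finset.sum_mul_sum, Finset.mul_sum, Finset.mul_sum]
  refine Finset.sum_congr rfl fun b _ => ?_
  rw [Finset.mul_sum, Finset.mul_sum]
  exact Finset.sum_congr rfl fun c _ => by ring

/-- The contraction of the derivative of a matrix-valued function with three vectors. -/
def dsum (dt : ι → ι → ι → ℝ) (x y z : ι → ℝ) : ℝ :=
  ∑ a, ∑ b, ∑ c, dt c a b * (x a * y b * z c)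

lemma yang_baxter_contract (ht : ∀ a b, t a b = -t b a) {dt : ι → ι → ι → ℝ}
    (hYB : ∀ a b c, (dt c a b - ∑ k, ∑ l, fs a k l * t k b * t l c) +
      (dt a b c - ∑ k, ∑ l, fs b k l * t k c * t l a) +
      (dt b c a - ∑ k, ∑ l, fs c k l * t k a * t l b) = 1 / 4 * fs a b c) (x y z : ι → ℝ) :
    dsum dt x y z + dsum dt y z x + dsum dt z x y -
      (tri fs x (hat t y) (hat t z) + tri fs y (hat t z) (hat t x) + tri fs z (hat t x) (hat t y)) =
      1 / 4 * tri fs x y z := by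
  have e2 : dsum dt y z x = ∑ a, ∑ b, ∑ c, x a * y b * z c * dt a b c := by
    rw [dsum, ← sum_rotate fun a b c => dt a b c * (y b * z c * x a)]
    exact Finset.sum_congr rfl fun b _ => Finset.sum_congr rfl fun c _ => Finset.sum_congr rfl
      fun a _ => by ring
  have e3 : dsum dt z x y = ∑ a, ∑ b, ∑ c, x a * y b * z c * dt b c a := by
    rw [dsum, sum_rotate fun c a b => dt b c a * (z c * x a * y b)]
    exact Finset.sum_congr rfl fun b _ => Finset.sum_congr rfl fun c _ => Finset.sum_congr rfl
      fun a _ => by ring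
  have e1 : dsum dt x y z = ∑ a, ∑ b, ∑ c, x a * y b * z c * dt c a b :=
    Finset.sum_congr rfl fun b _ => Finset.sum_congr rfl fun c _ => Finset.sum_congr rfl
      fun a _ => by ring
  have q1 := sum_quadratic (fs := fs) ht x y z
  have q2 : ∑ a, ∑ b, ∑ c, x a * y b * z c * ∑ k, ∑ l, fs b k l * t k c * t l a =
      tri fs y (hat t z) (hat t x) := by
    rw [← sum_quadratic ht, sum_rotate]
    exact Finset.sum_congr rfl fun b _ => Finset.sum_congr rfl fun c _ => Finset.sum_congr rfl
      fun a _ => by ring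
  have q3 : ∑ a, ∑ b, ∑ c, x a * y b * z c * ∑ k, ∑ l, fs c k l * t k a * t l b =
      tri fs z (hat t x) (hat t y) := by
    rw [← sum_quadratic ht, sum_rotate fun c a b => z c * x a * y b * ∑ k, ∑ l, fs c k l * t k a * t l b]
    exact Finset.sum_congr rfl fun b _ => Finset.sum_congr rfl fun c _ => Finset.sum_congr rfl
      fun a _ => by ring
  rw [e1, e2, e3, ← q1, ← q2, ← q3, tri, Finset.mul_sum]
  simp only [← Finset.sum_add_distrib, ← Finset.sum_sub_distrib]
  refine Finset.sum_congr rfl fun a _ => ?_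
  rw [Finset.mul_sum]
  refine Finset.sum_congr rfl fun b _ => ?_
  rw [Finset.mul_sum]
  refine Finset.sum_congr rfl fun c _ => ?_
  linear_combination x a * y b * z c * hYB a b c

/-- The correction to `{h, {f, g}}` in terms of derivatives at a point. -/
def jacTerm (t : ι → ι → ℝ) (dt Et : ι → ι → ι → ℝ) (F G H : ι → ℝ) (Ff Gg : ι → ι → ℝ)
    (Pfg Pgf Phf Phg : ι → ℝ) : ℝ :=
  -∑ d, hat t H d * (-Pgf d + Pfg d)
  - ∑ b, hat t F b * (Phg b - ∑ d, hat t H d * Gg d b)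
  + ∑ a, hat t G a * (Phf a - ∑ d, hat t H d * Ff d a)
  - ∑ a, ∑ b, F a * G b * (-∑ c, dt c a b * H c - ∑ d, hat t H d * Et d a b)

/-- The hypothesis `hEt` is the infinitesimal equivariance of T. The contraction yields two of the
three quadratic Yang-Baxter terms, so a cyclic sum will contain each of them twice. -/
lemma sum_Et (ht : ∀ a b, t a b = -t b a) (hf : ∀ a b c, fs a b c = -fs a c b)
    (hr : ∀ a b c, fs a b c = fs b c a) {Et : ι → ι → ι → ℝ}
    (hEt : ∀ d a b, Et d a b = -∑ k, (fs a d k * t k b - t a k * fs k d b)) (x y z : ι → ℝ) :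
    ∑ a, ∑ b, x a * y b * ∑ d, hat t z d * Et d a b =
      -tri fs x (hat t y) (hat t z) - tri fs y (hat t z) (hat t x) := by
  have h1 : ∑ a, ∑ b, x a * y b * ∑ d, hat t z d * ∑ k, fs a d k * t k b =
      -tri fs x (hat t z) (hat t y) := by
    rw [tri, ← Finset.sum_neg_distrib]
    refine Finset.sum_congr rfl fun a _ => ?_
    simp only [Finset.mul_sum]
    rw [sum_rotate, ← Finset.sum_neg_distrib]
    refine Finset.sum_congr rfl fun d _ => ?_
    rw [← Finset.sum_neg_distrib]
    refine Finset.sum_congr rfl fun k _ => ?_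
    have := sum_mul_eq_neg_hat ht y k
    rw [show -(fs a d k * (x a * hat t z d * hat t y k)) =
      fs a d k * x a * hat t z d * (-hat t y k) by ring, ← this, Finset.mul_sum]
    exact Finset.sum_congr rfl fun b _ => by ring
  have h2 : ∑ a, ∑ b, x a * y b * ∑ d, hat t z d * ∑ k, t a k * fs k d b =
      tri fs (hat t x) (hat t z) y := by
    rw [tri]
    simp only [Finset.mul_sum]
    rw [Finset.sum_comm]
    have : ∀ b, ∑ a, ∑ d, ∑ k, x a * y b * (hat t z d * (t a k * fs k d b)) =
        ∑ k, ∑ d, fs k d b * (hat t x k * hat t z d * y b) := by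
      intro b
      rw [sum_rotate, Finset.sum_comm]
      refine Finset.sum_congr rfl fun k _ => Finset.sum_congr rfl fun d _ => ?_
      rw [show fs k d b * (hat t x k * hat t z d * y b) = fs k d b * hat t z d * y b * hat t x k by
        ring, show hat t x k = ∑ c, t c k * x c from rfl, Finset.mul_sum]
      exact Finset.sum_congr rfl fun a _ => by ring
    simp only [this]
    rw [sum_rotate]
  have h3 : ∑ a, ∑ b, x a * y b * ∑ d, hat t z d * Et d a b =
      -(∑ a, ∑ b, x a * y b * ∑ d, hat t z d * ∑ k, fs a d k * t k b) +
      ∑ a, ∑ b, x a * y b * ∑ d, hat t z d * ∑ k, t a k * fs k d b := by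
    rw [← Finset.sum_neg_distrib, ← Finset.sum_add_distrib]
    refine Finset.sum_congr rfl fun a _ => ?_
    rw [← Finset.sum_neg_distrib, ← Finset.sum_add_distrib]
    refine Finset.sum_congr rfl fun b _ => ?_
    rw [← mul_neg, ← mul_add, ← Finset.sum_neg_distrib, ← Finset.sum_add_distrib]
    congr 1
    refine Finset.sum_congr rfl fun d _ => ?_
    rw [hEt, Finset.sum_sub_distrib]; ring
  rw [h3, h1, h2, tri_swap hf x, tri_rotate hr (hat t x), tri_rotate hr (hat t z), tri_swap hf y]
  ring

/-- Only the antisymmetric part of the second derivatives enters, and this is a first derivative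
along a bracket. -/
lemma sum_second_order {S : ι → ι → ℝ} {K : ι → ℝ}
    (hS : ∀ d a, S d a - S a d = ∑ k, fs k d a * K k) (u v : ι → ℝ) :
    ∑ b, u b * ∑ d, v d * S d b - ∑ b, v b * ∑ d, u d * S d b = tri fs K v u := by
  have h1 : ∑ b, v b * ∑ d, u d * S d b = ∑ b, ∑ d, u b * (v d * S b d) := by
    simp only [Finset.mul_sum]
    rw [Finset.sum_comm]
    exact Finset.sum_congr rfl fun b _ => Finset.sum_congr rfl fun d _ => by ring
  rw [h1]
  conv_rhs => rw [tri, sum_rotate, Finset.sum_comm]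
  simp only [Finset.mul_sum, ← Finset.sum_sub_distrib]
  refine Finset.sum_congr rfl fun b _ => Finset.sum_congr rfl fun d _ => ?_
  rw [← mul_sub, ← mul_sub, hS, Finset.mul_sum, Finset.mul_sum]
  exact Finset.sum_congr rfl fun k _ => by ring

lemma jacTerm_eq (ht : ∀ a b, t a b = -t b a) (hf : ∀ a b c, fs a b c = -fs a c b)
    (hr : ∀ a b c, fs a b c = fs b c a) {dt Et : ι → ι → ι → ℝ}
    (hEt : ∀ d a b, Et d a b = -∑ k, (fs a d k * t k b - t a k * fs k d b))
    (F G H : ι → ℝ) (Ff Gg : ι → ι → ℝ) (Pfg Pgf Phf Phg : ι → ℝ) :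
    jacTerm t dt Et F G H Ff Gg Pfg Pgf Phf Phg =
      ∑ d, hat t H d * Pgf d - ∑ d, hat t H d * Pfg d - ∑ d, hat t F d * Phg d
      + ∑ d, hat t G d * Phf d + ∑ b, hat t F b * ∑ d, hat t H d * Gg d b
      - ∑ b, hat t G b * ∑ d, hat t H d * Ff d b + dsum dt F G H
      - tri fs F (hat t G) (hat t H) - tri fs G (hat t H) (hat t F) := by
  have h1 := sum_Et ht hf hr hEt F G H
  have h2 : ∑ a, ∑ b, F a * G b * ∑ c, dt c a b * H c = dsum dt F G H := by
    refine Finset.sum_congr rfl fun a _ => Finset.sum_congr rfl fun b _ => ?_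
    rw [Finset.mul_sum]
    exact Finset.sum_congr rfl fun c _ => by ring
  simp only [jacTerm, mul_add, mul_sub, mul_neg, Finset.sum_add_distrib, Finset.sum_sub_distrib,
    Finset.sum_neg_distrib]
  rw [h1, h2]
  ring

/-- Cyclic summation cancels all brackets formed with the original bivector. Equivariance of T gives
each quadratic term with coefficient -2, and the commutators of second derivatives give it back with
coefficient +1. The remainder is the left side of the Yang-Baxter equation. -/
lemma jacTerm_cyclic (ht : ∀ a b, t a b = -t b a) (hf : ∀ a b c, fs a b c = -fs a c b)
    (hr : ∀ a b c, fs a b c = fs b c a) {dt Et : ι → ι → ι → ℝ}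
    (hEt : ∀ d a b, Et d a b = -∑ k, (fs a d k * t k b - t a k * fs k d b))
    (hYB : ∀ a b c, (dt c a b - ∑ k, ∑ l, fs a k l * t k b * t l c) +
      (dt a b c - ∑ k, ∑ l, fs b k l * t k c * t l a) +
      (dt b c a - ∑ k, ∑ l, fs c k l * t k a * t l b) = 1 / 4 * fs a b c)
    {F G H : ι → ℝ} {Ff Gg Hh : ι → ι → ℝ} (Pfg Pgf Phf Pfh Phg Pgh : ι → ℝ)
    (hF : ∀ d a, Ff d a - Ff a d = ∑ k, fs k d a * F k)
    (hG : ∀ d a, Gg d a - Gg a d = ∑ k, fs k d a * G k)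
    (hH : ∀ d a, Hh d a - Hh a d = ∑ k, fs k d a * H k) :
    jacTerm t dt Et F G H Ff Gg Pfg Pgf Phf Phg + jacTerm t dt Et G H F Gg Hh Pgh Phg Pfg Pfh +
      jacTerm t dt Et H F G Hh Ff Phf Pfh Pgh Pgf = 1 / 4 * tri fs F G H := by
  have y := yang_baxter_contract ht hYB F G H
  have s1 := sum_second_order hF (hat t H) (hat t G)
  have s2 := sum_second_order hG (hat t F) (hat t H)
  have s3 := sum_second_order hH (hat t G) (hat t F)
  rw [jacTerm_eq ht hf hr hEt, jacTerm_eq ht hf hr hEt, jacTerm_eq ht hf hr hEt]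
  linear_combination y + s1 + s2 + s3

end JacobiAlgebra

/-! ### Brackets of a bivector field twisted by T -/

section Twist
variable {𝔤 : Type*} [NormedAddCommGroup 𝔤] [NormedSpace ℝ 𝔤] [FiniteDimensional ℝ 𝔤]
  {G : Type*} [TopologicalSpace G] [ChartedSpace 𝔤 G] [Group G] [LieGroup 𝓘(ℝ, 𝔤) ∞ G] [T2Space G]
  {V : Type*} [NormedAddCommGroup V] [NormedSpace ℝ V] [FiniteDimensional ℝ V]
  {M : Type*} [TopologicalSpace M] [ChartedSpace V M] [IsManifold 𝓘(ℝ, V) ∞ M]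
  [MulAction G M] [ContMDiffSMul 𝓘(ℝ, 𝔤) 𝓘(ℝ, V) ∞ G M]
  {ι : Type*} [Fintype ι] [DecidableEq ι]
  {B : LinearMap.BilinForm ℝ 𝔤} {e : Module.Basis ι ℝ 𝔤}

lemma bivC_add (P Q : MultivectorField V M 2) (m : M) (α β : V →L[ℝ] ℝ) :
    bivC (bivAt (P + Q) m) α β = bivC (bivAt P m) α β + bivC (bivAt Q m) α β := by
  rw [← ev_eq_bivC _ m α β _ _ rfl rfl, ← ev_eq_bivC _ m α β _ _ rfl rfl,
    ← ev_eq_bivC _ m α β _ _ rfl rfl]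
  exact map_add _ _ _

lemma bivC_sub (P Q : MultivectorField V M 2) (m : M) (α β : V →L[ℝ] ℝ) :
    bivC (bivAt (P - Q) m) α β = bivC (bivAt P m) α β - bivC (bivAt Q m) α β := by
  rw [← ev_eq_bivC _ m α β _ _ rfl rfl, ← ev_eq_bivC _ m α β _ _ rfl rfl,
    ← ev_eq_bivC _ m α β _ _ rfl rfl]
  exact map_sub _ _ _

lemma bivC_genMulti (α : M → ⋀[ℝ]^2 𝔤) (m : M) (β γ : V →L[ℝ] ℝ) :
    bivC (bivAt (genMulti G α) m) β γ =
      biv (α m) (β.comp (gen G V m)).toLinearMap (γ.comp (gen G V m)).toLinearMap := by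
  rw [← ev_eq_bivC _ m β γ _ _ rfl rfl, genMulti, ev_map, ← ev_eq_biv]
  congr 1
  ext i : 1; fin_cases i <;> rfl

variable (G B e) in
/-- The coefficients of `T ∘ μ`. -/
def tFun (μ : M → 𝔤) (a b : ι) (m : M) : ℝ := B (e a) (phiAd G (μ m) (e b))

/-- A map to the Lie algebra is a moment map for a bivector field. -/
def IsMoment (G : Type*) [TopologicalSpace G] [ChartedSpace 𝔤 G] [Group G] [MulAction G M]
    (B : LinearMap.BilinForm ℝ 𝔤) (P : MultivectorField V M 2) (μ : M → 𝔤) : Prop :=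
  ∀ (ξ : 𝔤) (m : M) (β : V →L[ℝ] ℝ),
    bivC (bivAt P m) (tder V ℝ (fun x => B (μ x) ξ) m) β = β (gen G V m ξ)

variable {μ : M → 𝔤}

lemma tder_comp_moment {K : 𝔤 → ℝ} {m : M} (hμ : ContMDiff 𝓘(ℝ, V) 𝓘(ℝ, 𝔤) ∞ μ)
    (hK : DifferentiableAt ℝ K (μ m)) :
    tder V ℝ (fun x => K (μ x)) m = (fderiv ℝ K (μ m)).comp (tder V 𝔤 μ m) := by
  rw [tder_comp hK.mdifferentiableAt (mdiff_of_contMDiff hμ m), tder_eq_fderiv]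

lemma hasFDerivAt_bilin_right (B : LinearMap.BilinForm ℝ 𝔤) (ξ ζ : 𝔤) :
    HasFDerivAt (fun η => B η ξ) (B.toContinuousBilinearMap.flip ξ) ζ :=
  (B.toContinuousBilinearMap.flip ξ).hasFDerivAt

lemma tder_bilin_moment (hμ : ContMDiff 𝓘(ℝ, V) 𝓘(ℝ, 𝔤) ∞ μ) (ξ : 𝔤) (m : M) :
    tder V ℝ (fun x => B (μ x) ξ) m = (B.toContinuousBilinearMap.flip ξ).comp (tder V 𝔤 μ m) := by
  have h := hasFDerivAt_bilin_right B ξ (μ m)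
  rw [tder_comp_moment (K := fun η => B η ξ) hμ h.differentiableAt, h.fderiv]

/-- A covector that factors through dμ is a combination of the covectors d(μ · e_c). -/
lemma IsMoment.bivC_comp (hB : IsInvariantInnerProduct G B)
    (he : ∀ a b, B (e a) (e b) = if a = b then 1 else 0) {P : MultivectorField V M 2}
    (hP : IsMoment G B P μ) (hμ : ContMDiff 𝓘(ℝ, V) 𝓘(ℝ, 𝔤) ∞ μ) (L : 𝔤 →L[ℝ] ℝ) (m : M)
    (β : V →L[ℝ] ℝ) :
    bivC (bivAt P m) (L.comp (tder V 𝔤 μ m)) β = ∑ c, L (e c) * β (gen G V m (e c)) := by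
  have h : L.comp (tder V 𝔤 μ m) = ∑ c, L (e c) • tder V ℝ (fun x => B (μ x) (e c)) m := by
    ext v
    simp only [tder_bilin_moment hμ, sum_apply, smul_apply, ContinuousLinearMap.comp_apply,
      ContinuousLinearMap.flip_apply, LinearMap.toContinuousBilinearMap_apply]
    conv_lhs => rw [← sum_orthonormal_smul he (tder V 𝔤 μ m v)]
    simp only [map_sum, map_smul, smul_eq_mul]
    exact Finset.sum_congr rfl fun c _ => by rw [hB.symm, mul_comm]
  rw [h]
  simp only [map_sum, map_smul, sum_apply, smul_apply, hP (e _) m β, smul_eq_mul]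

lemma tder_equivariant (hμ : ContMDiff 𝓘(ℝ, V) 𝓘(ℝ, 𝔤) ∞ μ)
    (heq : ∀ (g : G) (m : M), μ (g • m) = Ad g (μ m)) (m : M) (ξ : 𝔤) :
    tder V 𝔤 μ m (gen G V m ξ) = -lieBr G ξ (μ m) := by
  rw [tder_gen (mdiff_of_contMDiff hμ m)]
  simp only [heq]
  rw [tder_Ad_apply]

variable [CompactSpace G]

lemma bivC_Ttensor (hB : IsInvariantInnerProduct G B)
    (he : ∀ a b, B (e a) (e b) = if a = b then 1 else 0) {m : M} (hm : μ m ∈ expRegular G)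
    (α β : V →L[ℝ] ℝ) :
    bivC (bivAt (genMulti G fun m => Ttensor G B e (μ m)) m) α β =
      ∑ b, hat (fun a b => tFun G B e μ a b m) (fun a => α (gen G V m (e a))) b *
        β (gen G V m (e b)) := by
  rw [bivC_genMulti, biv_Ttensor hB he hm, ← sum_sum_mul_hat_left]
  rfl

lemma hasFDerivAt_tFun {ζ : 𝔤} (hζ : ζ ∈ expRegular G) (a b : ι) :
    HasFDerivAt (fun ζ : 𝔤 => B (e a) (phiAd G ζ (e b)))
      (((LinearMap.toContinuousLinearMap (B (e a))).comp
        (ContinuousLinearMap.apply ℝ 𝔤 (e b))).comp (fderiv ℝ (phiAd G) ζ)) ζ := by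
  have h := ((contDiffAt_phiAd hζ).differentiableAt (by simp)).hasFDerivAt
  exact (((LinearMap.toContinuousLinearMap (B (e a))).comp
        (ContinuousLinearMap.apply ℝ 𝔤 (e b))).hasFDerivAt).comp ζ h

lemma contMDiff_tFun (hμ : ContMDiff 𝓘(ℝ, V) 𝓘(ℝ, 𝔤) ∞ μ) (hreg : ∀ m, μ m ∈ expRegular G)
    (a b : ι) : ContMDiff 𝓘(ℝ, V) 𝓘(ℝ, ℝ) ∞ (tFun G B e μ a b) := by
  intro m
  have h1 : ContDiffAt ℝ ∞ (fun ζ : 𝔤 => B (e a) (phiAd G ζ (e b))) (μ m) :=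
    ContDiffAt.comp (f := phiAd G) (g := (LinearMap.toContinuousLinearMap (B (e a))).comp
      (ContinuousLinearMap.apply ℝ 𝔤 (e b))) (μ m) (ContinuousLinearMap.contDiff _).contDiffAt
      (contDiffAt_phiAd (hreg m))
  exact h1.contMDiffAt.comp m (hμ m)

lemma tFun_skew (hB : IsInvariantInnerProduct G B)
    (he : ∀ a b, B (e a) (e b) = if a = b then 1 else 0) (hreg : ∀ m, μ m ∈ expRegular G)
    (m : M) (a b : ι) : tFun G B e μ a b m = -tFun G B e μ b a m :=
  phiAd_skew hB he (hreg m) a b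

lemma tder_tFun (hμ : ContMDiff 𝓘(ℝ, V) 𝓘(ℝ, 𝔤) ∞ μ) (hreg : ∀ m, μ m ∈ expRegular G) (m : M)
    (a b : ι) : tder V ℝ (tFun G B e μ a b) m = (((LinearMap.toContinuousLinearMap (B (e a))).comp
        (ContinuousLinearMap.apply ℝ 𝔤 (e b))).comp (fderiv ℝ (phiAd G) (μ m))).comp
          (tder V 𝔤 μ m) := by
  have h := hasFDerivAt_tFun (B := B) (e := e) (hreg m) a b
  have h2 := tder_comp_moment hμ h.differentiableAt
  rw [h.fderiv] at h2
  exact h2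

lemma lieD_tFun (he : ∀ a b, B (e a) (e b) = if a = b then 1 else 0)
    (hμ : ContMDiff 𝓘(ℝ, V) 𝓘(ℝ, 𝔤) ∞ μ) (hreg : ∀ m, μ m ∈ expRegular G)
    (heq : ∀ (g : G) (m : M), μ (g • m) = Ad g (μ m)) (m : M) (d a b : ι) :
    lieD G V (e d) (tFun G B e μ a b) m =
      -∑ k, (structConst G B e a d k * tFun G B e μ k b m -
        tFun G B e μ a k m * structConst G B e k d b) := by
  rw [lieD, tder_tFun hμ hreg, ContinuousLinearMap.comp_apply, tder_equivariant hμ heq, map_neg,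
    ContinuousLinearMap.comp_apply, fderiv_phiAd_lieBr (hreg m)]
  congr 1
  change B (e a) ((adL G (e d) * phiAd G (μ m) - phiAd G (μ m) * adL G (e d)) (e b)) = _
  have h1 : ∀ Y Z : 𝔤 →L[ℝ] 𝔤, B (e a) ((Y * Z) (e b)) =
      ∑ k, B (e a) (Y (e k)) * B (e k) (Z (e b)) := by
    intro Y Z
    conv_lhs => rw [ContinuousLinearMap.mul_def, ContinuousLinearMap.comp_apply,
      ← sum_orthonormal_smul he (Z (e b))]
    simp only [map_sum, map_smul, smul_eq_mul]
    exact Finset.sum_congr rfl fun k _ => mul_comm _ _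
  rw [sub_apply, map_sub, h1, h1, ← Finset.sum_sub_distrib]
  exact Finset.sum_congr rfl fun k _ => by simp only [adL_apply]; rfl

lemma bracket_sub_Ttensor (hB : IsInvariantInnerProduct G B)
    (he : ∀ a b, B (e a) (e b) = if a = b then 1 else 0) (hreg : ∀ m, μ m ∈ expRegular G)
    (P : MultivectorField V M 2) (f k : M → ℝ) :
    bracket (P - genMulti G fun m => Ttensor G B e (μ m)) f k = fun m => bracket P f k m -
      ∑ a, ∑ b, tFun G B e μ a b m * lieD G V (e a) f m * lieD G V (e b) k m := by
  ext m
  rw [bracket_eq, bivC_sub, bivC_Ttensor hB he (hreg m), bracket_eq, ← sum_sum_mul_hat_left]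
  rfl

lemma tder_triple {f g h : M → ℝ} (hf : ContMDiff 𝓘(ℝ, V) 𝓘(ℝ, ℝ) ∞ f)
    (hg : ContMDiff 𝓘(ℝ, V) 𝓘(ℝ, ℝ) ∞ g) (hh : ContMDiff 𝓘(ℝ, V) 𝓘(ℝ, ℝ) ∞ h) (m : M) :
    tder V ℝ (fun x => f x * g x * h x) m = (f m * g m) • tder V ℝ h m +
      (f m * h m) • tder V ℝ g m + (g m * h m) • tder V ℝ f m := by
  rw [tder_mul (f := fun x => f x * g x) (mdiff_of_contMDiff (hf.mul hg) m) (mdiff_of_contMDiff hh m),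
    tder_mul (mdiff_of_contMDiff hf m) (mdiff_of_contMDiff hg m), smul_add, smul_smul, smul_smul,
    mul_comm (h m), mul_comm (h m), add_assoc]

lemma bracket_bracket_sub_Ttensor (hB : IsInvariantInnerProduct G B)
    (he : ∀ a b, B (e a) (e b) = if a = b then 1 else 0)
    (hμ : ContMDiff 𝓘(ℝ, V) 𝓘(ℝ, 𝔤) ∞ μ) (hreg : ∀ m, μ m ∈ expRegular G)
    {P : MultivectorField V M 2} (hPs : IsSmoothBivector P)
    (hPi : IsInvariant G P) (hP : IsMoment G B P μ) {f g h : M → ℝ}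
    (hf : ContMDiff 𝓘(ℝ, V) 𝓘(ℝ, ℝ) ∞ f) (hg : ContMDiff 𝓘(ℝ, V) 𝓘(ℝ, ℝ) ∞ g) (m : M) :
    bracket (P - genMulti G fun m => Ttensor G B e (μ m)) h
      (bracket (P - genMulti G fun m => Ttensor G B e (μ m)) f g) m =
    bracket P h (bracket P f g) m + jacTerm (fun a b => tFun G B e μ a b m)
      (fun c a b => B (e a) (fderiv ℝ (phiAd G) (μ m) (e c) (e b)))
      (fun d a b => lieD G V (e d) (tFun G B e μ a b) m)
      (fun a => lieD G V (e a) f m) (fun a => lieD G V (e a) g m) (fun a => lieD G V (e a) h m)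
      (fun d a => lieD G V (e d) (lieD G V (e a) f) m)
      (fun d a => lieD G V (e d) (lieD G V (e a) g) m)
      (fun a => bracket P f (lieD G V (e a) g) m) (fun a => bracket P g (lieD G V (e a) f) m)
      (fun a => bracket P h (lieD G V (e a) f) m) (fun a => bracket P h (lieD G V (e a) g) m) := by
  set t := fun a b => tFun G B e μ a b m with ht
  set H := fun a => lieD G V (e a) h m with hH
  have ts := contMDiff_tFun (B := B) (e := e) hμ hreg
  have fs := fun a => contMDiff_lieD (G := G) hf (e a)
  have gs := fun a => contMDiff_lieD (G := G) hg (e a)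
  have hφ : ∀ X : M → ℝ, bracket (P - genMulti G fun m => Ttensor G B e (μ m)) h X m =
      bracket P h X m - ∑ d, hat t H d * lieD G V (e d) X m := by
    intro X
    rw [bracket_eq, bivC_sub, bivC_Ttensor hB he (hreg m), bracket_eq]
    rfl
  -- The Leibniz rule for the inner bracket, whose correction is a sum of products t_ab · (e_a)_M f
  -- · (e_b)_M g.
  have hlin : bracket (P - genMulti G fun m => Ttensor G B e (μ m)) h
      (bracket (P - genMulti G fun m => Ttensor G B e (μ m)) f g) m =
      bracket (P - genMulti G fun m => Ttensor G B e (μ m)) h (bracket P f g) m -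
      ∑ a, ∑ b, (t a b * lieD G V (e a) f m *
          bracket (P - genMulti G fun m => Ttensor G B e (μ m)) h (lieD G V (e b) g) m +
        t a b * lieD G V (e b) g m *
          bracket (P - genMulti G fun m => Ttensor G B e (μ m)) h (lieD G V (e a) f) m +
        lieD G V (e a) f m * lieD G V (e b) g m *
          bracket (P - genMulti G fun m => Ttensor G B e (μ m)) h (tFun G B e μ a b) m) := by
    have hs : ∀ a b, ContMDiff 𝓘(ℝ, V) 𝓘(ℝ, ℝ) ∞ (fun m => tFun G B e μ a b m *
        lieD G V (e a) f m * lieD G V (e b) g m) := fun a b => ((ts a b).mul (fs a)).mul (gs b)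
    rw [bracket_sub_Ttensor hB he hreg P f g, bracket_eq, tder_sub
      (mdiff_of_contMDiff (hPs f g hf hg) m) (mdiff_of_contMDiff (contMDiff_finsetSum fun a _ =>
        contMDiff_finsetSum fun b _ => hs a b) m),
      tder_sum _ (fun a => contMDiff_finsetSum fun b _ => hs a b)]
    simp only [tder_sum _ (hs _), tder_triple (ts _ _) (fs _) (gs _), map_sub, map_sum, map_add,
      map_smul, bracket_eq, smul_eq_mul]
    rfl
  -- The coefficients of T are functions of μ, so the moment condition converts their brackets with
  -- h into derivatives of h along the generating fields.
  have ht' : ∀ a b, bracket P h (tFun G B e μ a b) m =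
      -∑ c, B (e a) (fderiv ℝ (phiAd G) (μ m) (e c) (e b)) * H c := by
    intro a b
    rw [bracket_swap, bracket_eq, tder_tFun hμ hreg, hP.bivC_comp hB he hμ]
    rfl
  have hbr : ∀ d, lieD G V (e d) (bracket P f g) m =
      -bracket P g (lieD G V (e d) f) m + bracket P f (lieD G V (e d) g) m := by
    intro d
    rw [lieD_bracket hPs hPi hf hg, bracket_swap P _ g]
  rw [hlin]
  simp only [hφ, ht', hbr]
  simp only [Finset.sum_add_distrib]
  rw [sum_sum_mul_hat_left (t := t) (fun a => lieD G V (e a) f m),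
    sum_sum_mul_hat_right (t := t) (fun a b => tFun_skew hB he hreg m a b)
      (fun a => lieD G V (e a) g m)]
  rw [jacTerm]
  ring

end Twist

/-! ### Exponential and logarithm at regular points -/

section Exponential
variable {𝔤 : Type*} [NormedAddCommGroup 𝔤] [NormedSpace ℝ 𝔤] [FiniteDimensional ℝ 𝔤]
  {G : Type*} [TopologicalSpace G] [ChartedSpace 𝔤 G] [Group G] [LieGroup 𝓘(ℝ, 𝔤) ∞ G] [T2Space G]
  [CompactSpace G]

/-- Transported to the right, the left side is (Ad(exp ζ) + 1) η, which is 2 S₁(ad ζ)(1 - ad ζ φ(ad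
ζ)) η, and S₁(ad ζ) is absorbed into the differential of exp. -/
lemma leftVec_add_rightVec_lieExp {ζ : 𝔤} (hζ : ζ ∈ expRegular G) (η : 𝔤) :
    leftVec η (lieExp G ζ) + rightVec η (lieExp G ζ) =
      (2 : ℝ) • tder 𝔤 𝔤 (lieExp G) ζ ((1 - adL G ζ * phiAd G ζ) η) := by
  have hT : Commute (phiAd G ζ) (adL G ζ) := (adL_mul_phiAd ζ).symm
  have hc : Commute (1 - phiAd G ζ * adL G ζ) (expTail 1 (adL G ζ)) :=
    commute_expTail ((Commute.one_left _).sub_left (hT.mul_left (Commute.refl _))) 1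
  have h := one_sub_phiAd_mul_expTail hζ
  rw [hc.eq, hT.eq] at h
  have h2 := congrArg (fun L : 𝔤 →L[ℝ] 𝔤 => (2 : ℝ) • L η) h
  simp only [smul_apply, add_apply, one_apply_eq_self, smul_smul] at h2
  rw [show (2 : ℝ) * (1 / 2) = 1 by norm_num, one_smul] at h2
  rw [leftVec_eq, tder_lieExp_apply]
  have hr : ∀ a b : 𝔤, rightVec a (lieExp G ζ) + rightVec b (lieExp G ζ) =
      rightVec (a + b) (lieExp G ζ) := fun a b => (map_add _ _ _).symm
  have hs : ∀ (c : ℝ) (a : 𝔤), c • rightVec a (lieExp G ζ) = rightVec (c • a) (lieExp G ζ) :=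
    fun c a => (map_smul _ _ _).symm
  rw [hr, hs, ← h2]
  rfl

lemma tder_lieExp_bijective {ζ : 𝔤} (hζ : ζ ∈ expRegular G) :
    Function.Bijective (tder 𝔤 𝔤 (lieExp G) ζ) := hζ

/-- The exponential map is injective near a regular point. -/
lemma eventually_lieExp_injective {ζ : 𝔤} (hζ : ζ ∈ expRegular G) :
    ∃ O ∈ nhds ζ, Set.InjOn (lieExp G) O := by
  obtain ⟨F, hF, hF1⟩ := exists_contMDiff_tder_eq (E := 𝔤) (lieExp G ζ) (ContinuousLinearMap.id ℝ 𝔤)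
  have hK : ContDiff ℝ ∞ (fun x : 𝔤 => F (lieExp G x)) := (hF.comp (contMDiff_lieExp 𝔤 G)).contDiff
  have hd : fderiv ℝ (fun x : 𝔤 => F (lieExp G x)) ζ = tder 𝔤 𝔤 (lieExp G) ζ := by
    rw [← tder_eq_fderiv, tder_comp (mdiff_of_contMDiff hF _)
      (mdiff_of_contMDiff (contMDiff_lieExp 𝔤 G) ζ), hF1, ContinuousLinearMap.id_comp]
  have hbij := tder_lieExp_bijective hζ
  let L : 𝔤 ≃L[ℝ] 𝔤 := ContinuousLinearEquiv.ofBijective (tder 𝔤 𝔤 (lieExp G) ζ)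
    (LinearMap.ker_eq_bot.2 hbij.1) (LinearMap.range_eq_top.2 hbij.2)
  have hs : HasStrictFDerivAt (fun x : 𝔤 => F (lieExp G x)) (L : 𝔤 →L[ℝ] 𝔤) ζ := by
    have h := hK.contDiffAt.hasStrictFDerivAt (x := ζ) (by simp)
    rw [hd] at h
    exact h
  refine ⟨(hs.toOpenPartialHomeomorph _).source,
    (hs.toOpenPartialHomeomorph _).open_source.mem_nhds hs.mem_toOpenPartialHomeomorph_source, ?_⟩
  intro x hx y hy hxy
  refine (hs.toOpenPartialHomeomorph _).injOn hx hy ?_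
  rw [hs.toOpenPartialHomeomorph_coe]
  exact congrArg F hxy

variable {U : Set G} {log : G → 𝔤}

lemma tder_lieExp_comp_tder_log (hU : IsOpen U) (hlog : ContMDiffOn 𝓘(ℝ, 𝔤) 𝓘(ℝ, 𝔤) ∞ log U)
    (hexp : ∀ u ∈ U, lieExp G (log u) = u) {u : G} (hu : u ∈ U) :
    (tder 𝔤 𝔤 (lieExp G) (log u)).comp (tder 𝔤 𝔤 log u) = ContinuousLinearMap.id ℝ 𝔤 := by
  have hl : MDifferentiableAt 𝓘(ℝ, 𝔤) 𝓘(ℝ, 𝔤) log u :=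
    (hlog.contMDiffAt (hU.mem_nhds hu)).mdifferentiableAt (by simp)
  rw [← tder_comp (mdiff_of_contMDiff (contMDiff_lieExp 𝔤 G) _) hl, ← tder_id (E := 𝔤) u]
  refine Filter.EventuallyEq.mfderiv_eq ?_
  filter_upwards [hU.mem_nhds hu] with x hx using hexp x hx

/-- The identity dexp ∘ dlog = id makes dexp surjective, and equality of dimensions makes it
bijective. -/
lemma log_mem_expRegular (hU : IsOpen U) (hlog : ContMDiffOn 𝓘(ℝ, 𝔤) 𝓘(ℝ, 𝔤) ∞ log U)
    (hexp : ∀ u ∈ U, lieExp G (log u) = u) {u : G} (hu : u ∈ U) : log u ∈ expRegular G := by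
  have h := tder_lieExp_comp_tder_log hU hlog hexp hu
  have hs : Function.Surjective (tder 𝔤 𝔤 (lieExp G) (log u)) := fun v =>
    ⟨tder 𝔤 𝔤 log u v, congrArg (fun L : 𝔤 →L[ℝ] 𝔤 => L v) h⟩
  exact ⟨(LinearMap.injective_iff_surjective
    (f := (tder 𝔤 𝔤 (lieExp G) (log u)).toLinearMap)).2 hs, hs⟩

lemma tder_log_tder_lieExp (hU : IsOpen U) (hlog : ContMDiffOn 𝓘(ℝ, 𝔤) 𝓘(ℝ, 𝔤) ∞ log U)
    (hexp : ∀ u ∈ U, lieExp G (log u) = u) {u : G} (hu : u ∈ U) (η : 𝔤) :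
    tder 𝔤 𝔤 log u (tder 𝔤 𝔤 (lieExp G) (log u) η) = η := by
  have h := tder_lieExp_comp_tder_log hU hlog hexp hu
  have hb := tder_lieExp_bijective (log_mem_expRegular hU hlog hexp hu)
  exact hb.1 (congrArg (fun L : 𝔤 →L[ℝ] 𝔤 => L (tder 𝔤 𝔤 (lieExp G) (log u) η)) h)

end Exponential

/-! ### Hamiltonian Poisson and quasi-Poisson structures -/

section Structures
variable {𝔤 : Type*} [NormedAddCommGroup 𝔤] [NormedSpace ℝ 𝔤] [FiniteDimensional ℝ 𝔤]
  {G : Type*} [TopologicalSpace G] [ChartedSpace 𝔤 G] [Group G] [LieGroup 𝓘(ℝ, 𝔤) ∞ G] [T2Space G]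
  {V : Type*} [NormedAddCommGroup V] [NormedSpace ℝ V] [FiniteDimensional ℝ V]
  {M : Type*} [TopologicalSpace M] [ChartedSpace V M] [IsManifold 𝓘(ℝ, V) ∞ M]
  [MulAction G M] [ContMDiffSMul 𝓘(ℝ, 𝔤) 𝓘(ℝ, V) ∞ G M]
  {ι : Type*} [Fintype ι] [DecidableEq ι]
  {B : LinearMap.BilinForm ℝ 𝔤} {e : Module.Basis ι ℝ 𝔤} {μ : M → 𝔤}

lemma lieD_lieBr_basis (he : ∀ a b, B (e a) (e b) = if a = b then 1 else 0) (f : M → ℝ) (m : M)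
    (d a : ι) : lieD G V (lieBr G (e d) (e a)) f m =
      ∑ k, structConst G B e k d a * lieD G V (e k) f m := by
  conv_lhs => rw [lieD, ← sum_orthonormal_smul he (lieBr G (e d) (e a))]
  simp only [map_sum, map_smul, smul_eq_mul]
  rfl

lemma ev_genMulti_cartanTensor (hB : IsInvariantInnerProduct G B) (f g h : M → ℝ) (m : M) :
    ev (genMulti G (fun _ : M => cartanTensor G B e) m) ![diff (V := V) f m, diff g m, diff h m] =
      1 / 2 * tri (structConst G B e) (fun a => lieD G V (e a) f m) (fun a => lieD G V (e a) g m)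
        (fun a => lieD G V (e a) h m) :=
  ev_map_cartanTensor hB _ _ _ _

/-- In finite dimension every algebraic covector is continuous. -/
lemma isMoment_iff (P : MultivectorField V M 2) (μ : M → 𝔤) :
    IsMoment G B P μ ↔ ∀ (ξ : 𝔤) (m : M) (β : Module.Dual ℝ (TangentSpace 𝓘(ℝ, V) m)),
      ev (P m) ![diff (fun x => B (μ x) ξ) m, β] = β (genField G m ξ) := by
  constructor
  · intro h ξ m β
    let β' : V →L[ℝ] ℝ := LinearMap.toContinuousLinearMap (β : V →ₗ[ℝ] ℝ)
    exact (ev_eq_bivC P m (tder V ℝ (fun x => B (μ x) ξ) m) β' (diff (fun x => B (μ x) ξ) m) β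
      rfl rfl).trans (h ξ m β')
  · intro h ξ m β
    rw [← ev_eq_bivC P m (tder V ℝ (fun x => B (μ x) ξ) m) β _ _ rfl rfl]
    exact h ξ m β.toLinearMap

lemma isQuasiMoment_iff (P : MultivectorField V M 2) (Φ : M → G) (f : G → ℝ) (m : M) :
    (∀ β : Module.Dual ℝ (TangentSpace 𝓘(ℝ, V) m), ev (P m) ![diff (fun x => f (Φ x)) m, β] =
        ∑ a, (1 / 2 : ℝ) * (diff f (Φ m) (leftField (e a) (Φ m) + rightField (e a) (Φ m))) *
          β (genField G m (e a))) ↔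
    ∀ β : V →L[ℝ] ℝ, bivC (bivAt P m) (tder V ℝ (fun x => f (Φ x)) m) β =
      ∑ a, (1 / 2 : ℝ) * (tder 𝔤 ℝ f (Φ m) (leftVec (e a) (Φ m) + rightVec (e a) (Φ m))) *
          β (gen G V m (e a)) := by
  constructor
  · intro h β
    rw [← ev_eq_bivC P m (tder V ℝ (fun x => f (Φ x)) m) β _ _ rfl rfl]
    exact h β.toLinearMap
  · intro h β
    let β' : V →L[ℝ] ℝ := LinearMap.toContinuousLinearMap (β : V →ₗ[ℝ] ℝ)
    exact (ev_eq_bivC P m (tder V ℝ (fun x => f (Φ x)) m) β' (diff (fun x => f (Φ x)) m) β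
      rfl rfl).trans (h β')

lemma IsInvariant.add {P Q : MultivectorField V M 2} (hP : IsInvariant G P) (hQ : IsInvariant G Q) :
    IsInvariant G (P + Q) := fun g m => by
  rw [Pi.add_apply, map_add, hP g m, hQ g m]; rfl

lemma IsInvariant.sub {P Q : MultivectorField V M 2} (hP : IsInvariant G P) (hQ : IsInvariant G Q) :
    IsInvariant G (P - Q) := fun g m => by
  rw [Pi.sub_apply, map_sub, hP g m, hQ g m]; rfl

variable [CompactSpace G]

lemma isInvariant_Ttensor (hB : IsInvariantInnerProduct G B)
    (he : ∀ a b, B (e a) (e b) = if a = b then 1 else 0) (hreg : ∀ m, μ m ∈ expRegular G)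
    (heq : ∀ (g : G) (m : M), μ (g • m) = Ad g (μ m)) :
    IsInvariant G (genMulti (V := V) G fun m => Ttensor G B e (μ m)) := by
  intro g m
  rw [genMulti, genMulti, heq, ← map_Ad_Ttensor hB he (hreg m) g, ← LinearMap.comp_apply,
    ← LinearMap.comp_apply, ← exteriorPower.map_comp, ← exteriorPower.map_comp]
  congr 2
  ext ξ
  exact (gen_smul_Ad (V := V) g m ξ).symm

lemma isSmoothBivector_sub_iff (hB : IsInvariantInnerProduct G B)
    (he : ∀ a b, B (e a) (e b) = if a = b then 1 else 0)
    (hμ : ContMDiff 𝓘(ℝ, V) 𝓘(ℝ, 𝔤) ∞ μ) (hreg : ∀ m, μ m ∈ expRegular G)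
    (P : MultivectorField V M 2) :
    IsSmoothBivector (P - genMulti G fun m => Ttensor G B e (μ m)) ↔ IsSmoothBivector P := by
  have hs : ∀ f k : M → ℝ, ContMDiff 𝓘(ℝ, V) 𝓘(ℝ, ℝ) ∞ f → ContMDiff 𝓘(ℝ, V) 𝓘(ℝ, ℝ) ∞ k →
      ContMDiff 𝓘(ℝ, V) 𝓘(ℝ, ℝ) ∞ (fun m => ∑ a, ∑ b, tFun G B e μ a b m *
        lieD G V (e a) f m * lieD G V (e b) k m) := fun f k hf hk =>
    contMDiff_finsetSum fun a _ => contMDiff_finsetSum fun b _ =>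
      ((contMDiff_tFun hμ hreg a b).mul (contMDiff_lieD hf (e a))).mul (contMDiff_lieD hk (e b))
  constructor
  · intro h f k hf hk
    have h1 := (h f k hf hk).add (hs f k hf hk)
    rw [bracket_sub_Ttensor hB he hreg] at h1
    refine h1.congr fun m => ?_
    simp
  · intro h f k hf hk
    rw [bracket_sub_Ttensor hB he hreg]
    exact (h f k hf hk).sub (hs f k hf hk)

/-- The Jacobiator of a bivector field twisted by `T`. -/
lemma jacobiator_sub_Ttensor (hB : IsInvariantInnerProduct G B)
    (he : ∀ a b, B (e a) (e b) = if a = b then 1 else 0)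
    (hμ : ContMDiff 𝓘(ℝ, V) 𝓘(ℝ, 𝔤) ∞ μ) (hreg : ∀ m, μ m ∈ expRegular G)
    (heq : ∀ (g : G) (m : M), μ (g • m) = Ad g (μ m))
    {P Q : MultivectorField V M 2} (hQ : Q = P - genMulti G fun m => Ttensor G B e (μ m))
    (hPs : IsSmoothBivector P)
    (hPi : IsInvariant G P) (hP : IsMoment G B P μ) {f g h : M → ℝ}
    (hf : ContMDiff 𝓘(ℝ, V) 𝓘(ℝ, ℝ) ∞ f) (hg : ContMDiff 𝓘(ℝ, V) 𝓘(ℝ, ℝ) ∞ g)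
    (hh : ContMDiff 𝓘(ℝ, V) 𝓘(ℝ, ℝ) ∞ h) (m : M) :
    bracket Q h (bracket Q f g) m + bracket Q f (bracket Q g h) m + bracket Q g (bracket Q h f) m =
      bracket P h (bracket P f g) m + bracket P f (bracket P g h) m + bracket P g (bracket P h f) m +
      1 / 4 * tri (structConst G B e) (fun a => lieD G V (e a) f m) (fun a => lieD G V (e a) g m)
        (fun a => lieD G V (e a) h m) := by
  have hc : ∀ {f : M → ℝ}, ContMDiff 𝓘(ℝ, V) 𝓘(ℝ, ℝ) ∞ f → ∀ d a : ι,
      lieD G V (e d) (lieD G V (e a) f) m - lieD G V (e a) (lieD G V (e d) f) m =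
        ∑ k, structConst G B e k d a * lieD G V (e k) f m := fun hf d a => by
    rw [lieD_comm hf, lieD_lieBr_basis he]
  have key := jacTerm_cyclic (t := fun a b => tFun G B e μ a b m) (fs := structConst G B e)
    (dt := fun c a b => B (e a) (fderiv ℝ (phiAd G) (μ m) (e c) (e b)))
    (Et := fun d a b => lieD G V (e d) (tFun G B e μ a b) m)
    (fun a b => tFun_skew hB he hreg m a b) (fun a b c => structConst_swap₂₃ a b c)
    (fun a b c => structConst_rotate hB a b c) (fun d a b => lieD_tFun he hμ hreg heq m d a b)
    (fun a b c => dynamical_yang_baxter hB he (hreg m) a b c)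
    (fun a => bracket P f (lieD G V (e a) g) m) (fun a => bracket P g (lieD G V (e a) f) m)
    (fun a => bracket P h (lieD G V (e a) f) m) (fun a => bracket P f (lieD G V (e a) h) m)
    (fun a => bracket P h (lieD G V (e a) g) m) (fun a => bracket P g (lieD G V (e a) h) m)
    (hc hf) (hc hg) (hc hh)
  subst hQ
  rw [bracket_bracket_sub_Ttensor hB he hμ hreg hPs hPi hP hf hg,
    bracket_bracket_sub_Ttensor hB he hμ hreg hPs hPi hP hg hh,
    bracket_bracket_sub_Ttensor hB he hμ hreg hPs hPi hP hh hf]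
  linear_combination key

lemma bivC_Ttensor_comp (hB : IsInvariantInnerProduct G B)
    (he : ∀ a b, B (e a) (e b) = if a = b then 1 else 0)
    (hμ : ContMDiff 𝓘(ℝ, V) 𝓘(ℝ, 𝔤) ∞ μ) (hreg : ∀ m, μ m ∈ expRegular G)
    (heq : ∀ (g : G) (m : M), μ (g • m) = Ad g (μ m)) (L : 𝔤 →L[ℝ] ℝ) (m : M) (β : V →L[ℝ] ℝ) :
    bivC (bivAt (genMulti G fun m => Ttensor G B e (μ m)) m) (L.comp (tder V 𝔤 μ m)) β =
      ∑ b, L ((adL G (μ m) * phiAd G (μ m)) (e b)) * β (gen G V m (e b)) := by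
  rw [bivC_Ttensor hB he (hreg m)]
  refine Finset.sum_congr rfl fun b _ => ?_
  congr 1
  have h : ∀ a, (L.comp (tder V 𝔤 μ m)) (gen G V m (e a)) = L (adL G (μ m) (e a)) := by
    intro a
    rw [ContinuousLinearMap.comp_apply, tder_equivariant hμ heq, adL_apply, ← lieBr_swap]
  simp only [h, hat, tFun]
  conv_rhs => rw [ContinuousLinearMap.mul_def, ContinuousLinearMap.comp_apply,
    ← sum_orthonormal_smul he (phiAd G (μ m) (e b))]
  simp only [map_sum, map_smul, smul_eq_mul]

/-- Exponentials of Hamiltonian Poisson structures. -/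
theorem IsHamiltonianPoisson.exponential (hB : IsInvariantInnerProduct G B)
    (he : ∀ a b, B (e a) (e b) = if a = b then 1 else 0) {P : MultivectorField V M 2}
    (h : IsHamiltonianPoisson G B P μ) (hreg : ∀ m, μ m ∈ expRegular G) :
    IsHamiltonianQuasiPoisson G B e (P - genMulti G (fun m => Ttensor G B e (μ m)))
      (fun m => lieExp G (μ m)) where
  smooth := (isSmoothBivector_sub_iff hB he h.smooth_moment hreg P).2 h.smooth
  invariant := h.invariant.sub (isInvariant_Ttensor hB he hreg h.equivariant)
  quasiPoisson := by
    intro f g k hf hg hk m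
    have h0 := h.poisson f g k hf hg hk m
    rw [ev_zero] at h0
    rw [ev_genMulti_cartanTensor hB]
    have hJ := jacobiator_sub_Ttensor hB he h.smooth_moment hreg h.equivariant rfl h.smooth
      h.invariant ((isMoment_iff P μ).2 h.moment) hf hg hk m
    -- With equal arguments the Schouten bracket is twice the Jacobiator, and 2 · 1/4 is the
    -- coefficient 1/2 of φ_M.
    linear_combination h0 - 2 * hJ
  smooth_moment := (contMDiff_lieExp 𝔤 G).comp h.smooth_moment
  equivariant := fun g m => by rw [h.equivariant, lieExp_Ad]
  moment := by
    intro f hf m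
    rw [isQuasiMoment_iff]
    intro β
    have hd : tder V ℝ (fun x => f (lieExp G (μ x))) m =
        ((tder 𝔤 ℝ f (lieExp G (μ m))).comp (tder 𝔤 𝔤 (lieExp G) (μ m))).comp (tder V 𝔤 μ m) := by
      rw [tder_comp (F := fun ζ => f (lieExp G ζ))
        (mdiff_of_contMDiff (hf.comp (contMDiff_lieExp 𝔤 G)) _)
        (mdiff_of_contMDiff h.smooth_moment m), tder_comp (mdiff_of_contMDiff hf _)
        (mdiff_of_contMDiff (contMDiff_lieExp 𝔤 G) _)]
    rw [hd, bivC_sub, ((isMoment_iff P μ).2 h.moment).bivC_comp hB he h.smooth_moment,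
      bivC_Ttensor_comp hB he h.smooth_moment hreg h.equivariant, ← Finset.sum_sub_distrib]
    refine Finset.sum_congr rfl fun a _ => ?_
    rw [leftVec_add_rightVec_lieExp (hreg m), map_smul, smul_eq_mul, ← sub_mul, ← map_sub,
      sub_apply, one_apply_eq_self, ContinuousLinearMap.comp_apply]
    ring

variable {U : Set G} {log : G → 𝔤} {Φ : M → G}

/-- For connected G, the set of g where equivariance holds at m contains 1 and is closed. It is open
because both sides always have the same exponential and exp is injective near the regular point that
they share. -/
lemma log_equivariant
    (heq : ∀ (g : G) (m : M), Φ (g • m) = g * Φ m * g⁻¹)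
    (hU : IsOpen U) (hΦU : ∀ m, Φ m ∈ U)
    (hlog : ContMDiffOn 𝓘(ℝ, 𝔤) 𝓘(ℝ, 𝔤) ∞ log U) (hexp : ∀ u ∈ U, lieExp G (log u) = u)
    (hμ : ContMDiff 𝓘(ℝ, V) 𝓘(ℝ, 𝔤) ∞ fun m => log (Φ m))
    (hor : ConnectedSpace G ∨
        ∀ g : G, ∀ u ∈ U, g * u * g⁻¹ ∈ U → log (g * u * g⁻¹) = Ad g (log u)) (g : G) (m : M) :
    log (Φ (g • m)) = Ad g (log (Φ m)) := by
  rcases hor with hconn | hlogeq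
  · have hc1 : Continuous fun g : G => log (Φ (g • m)) :=
      hμ.continuous.comp (contMDiff_orbit (𝔤 := 𝔤) (V := V) m).continuous
    have hc2 : Continuous fun g : G => (Ad g : 𝔤 →L[ℝ] 𝔤) (log (Φ m)) :=
      (ContMDiff.clm_eval contMDiff_Ad _).continuous
    have hcl : IsClopen {g : G | log (Φ (g • m)) = Ad g (log (Φ m))} := by
      refine ⟨isClosed_eq hc1 hc2, isOpen_iff_mem_nhds.2 fun g₀ hg₀ => ?_⟩
      have hr : Ad g₀ (log (Φ m)) ∈ expRegular G :=
        Ad_mem_expRegular (log_mem_expRegular hU hlog hexp (hΦU m)) g₀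
      obtain ⟨O, hO, hinj⟩ := eventually_lieExp_injective hr
      have hg₀' : log (Φ (g₀ • m)) = Ad g₀ (log (Φ m)) := hg₀
      have h1 : ∀ᶠ g in nhds g₀, log (Φ (g • m)) ∈ O :=
        hc1.continuousAt (by rw [hg₀']; exact hO)
      filter_upwards [h1, hc2.continuousAt hO] with g hg1 hg2
      refine hinj hg1 hg2 ?_
      rw [hexp _ (hΦU _), heq, lieExp_Ad, hexp _ (hΦU m)]
    have huniv := hcl.eq_univ ⟨1, by simp [Ad_one]⟩
    exact (Set.ext_iff.1 huniv g).2 trivial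
  · rw [heq]
    exact hlogeq g (Φ m) (hΦU m) (heq g m ▸ hΦU (g • m))

/-- Logarithms of Hamiltonian quasi-Poisson structures. -/
theorem IsHamiltonianQuasiPoisson.logarithm (hB : IsInvariantInnerProduct G B)
    (he : ∀ a b, B (e a) (e b) = if a = b then 1 else 0) {P : MultivectorField V M 2}
    (h : IsHamiltonianQuasiPoisson G B e P Φ) (hU : IsOpen U) (hΦU : ∀ m, Φ m ∈ U)
    (hlog : ContMDiffOn 𝓘(ℝ, 𝔤) 𝓘(ℝ, 𝔤) ∞ log U) (hexp : ∀ u ∈ U, lieExp G (log u) = u)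
    (hor : ConnectedSpace G ∨
        ∀ g : G, ∀ u ∈ U, g * u * g⁻¹ ∈ U → log (g * u * g⁻¹) = Ad g (log u)) :
    IsHamiltonianPoisson G B (P + genMulti G (fun m => Ttensor G B e (log (Φ m))))
      (fun m => log (Φ m)) := by
  have hμ : ContMDiff 𝓘(ℝ, V) 𝓘(ℝ, 𝔤) ∞ fun m => log (Φ m) := fun m =>
    (hlog.contMDiffAt (hU.mem_nhds (hΦU m))).comp m (h.smooth_moment m)
  have hreg : ∀ m, log (Φ m) ∈ expRegular G := fun m => log_mem_expRegular hU hlog hexp (hΦU m)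
  have heq := log_equivariant h.equivariant hU hΦU hlog hexp hμ hor
  -- Seen this way P is the twist of the new bivector, so the results on twisting apply with the
  -- roles exchanged.
  have hsub : P = (P + genMulti G (fun m => Ttensor G B e (log (Φ m)))) -
      genMulti G (fun m => Ttensor G B e (log (Φ m))) := (add_sub_cancel_right _ _).symm
  have hsm : IsSmoothBivector (P + genMulti G (fun m => Ttensor G B e (log (Φ m)))) := by
    rw [← isSmoothBivector_sub_iff hB he hμ hreg, ← hsub]
    exact h.smooth
  have hinv : IsInvariant G (P + genMulti G (fun m => Ttensor G B e (log (Φ m)))) :=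
    h.invariant.add (isInvariant_Ttensor hB he hreg heq)
  have hmom : IsMoment G B (P + genMulti G (fun m => Ttensor G B e (log (Φ m))))
      (fun m => log (Φ m)) := by
    intro ξ m β
    set L : 𝔤 →L[ℝ] ℝ := B.toContinuousBilinearMap.flip ξ with hL
    have hl : MDifferentiableAt 𝓘(ℝ, 𝔤) 𝓘(ℝ, 𝔤) log (Φ m) :=
      (hlog.contMDiffAt (hU.mem_nhds (hΦU m))).mdifferentiableAt (by simp)
    -- The moment condition tests global smooth functions, while `log` is smooth only on `U`; a
    -- function with the same differential at Φ(m) suffices, as the condition at m sees nothing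
    -- else.
    obtain ⟨f, hf, hf1⟩ := exists_contMDiff_tder_eq (E := 𝔤) (Φ m) (L.comp (tder 𝔤 𝔤 log (Φ m)))
    have hd : tder V ℝ (fun x => f (Φ x)) m = L.comp (tder V 𝔤 (fun x => log (Φ x)) m) := by
      rw [tder_comp (mdiff_of_contMDiff hf _) (mdiff_of_contMDiff h.smooth_moment m), hf1,
        tder_comp hl (mdiff_of_contMDiff h.smooth_moment m)]
      rfl
    have hq := (isQuasiMoment_iff P Φ f m).1 (h.moment f hf m) β
    have hlr : ∀ a, tder 𝔤 ℝ f (Φ m) (leftVec (e a) (Φ m) + rightVec (e a) (Φ m)) =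
        2 * L ((1 - adL G (log (Φ m)) * phiAd G (log (Φ m))) (e a)) := by
      intro a
      have h1 := leftVec_add_rightVec_lieExp (hreg m) (e a)
      rw [hexp _ (hΦU m)] at h1
      rw [h1, hf1, map_smul, ContinuousLinearMap.comp_apply,
        tder_log_tder_lieExp hU hlog hexp (hΦU m), smul_eq_mul]
    rw [tder_bilin_moment hμ, bivC_add, ← hL, bivC_Ttensor_comp hB he hμ hreg heq, ← hd, hq,
      ← Finset.sum_add_distrib]
    have hsum : ∀ a, 1 / 2 * tder 𝔤 ℝ f (Φ m) (leftVec (e a) (Φ m) + rightVec (e a) (Φ m)) *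
        β (gen G V m (e a)) + L ((adL G (log (Φ m)) * phiAd G (log (Φ m))) (e a)) *
        β (gen G V m (e a)) = B (e a) ξ * β (gen G V m (e a)) := by
      intro a
      have hLe : L (e a) = B (e a) ξ := rfl
      rw [hlr, sub_apply, one_apply_eq_self, map_sub, hLe]
      ring
    simp only [hsum]
    conv_rhs => rw [← sum_orthonormal_smul he ξ]
    simp only [map_sum, map_smul, smul_eq_mul]
  refine ⟨hsm, hinv, ?_, hμ, heq, (isMoment_iff _ _).1 hmom⟩
  intro f g k hf hg hk m
  have h0 := h.quasiPoisson f g k hf hg hk m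
  rw [ev_genMulti_cartanTensor hB] at h0
  rw [ev_zero]
  -- The Jacobiator formula compares P with the new bivector; the term φ_M in [P, P] is exactly its
  -- correction, so the new Jacobiator is 0.
  have hJ := jacobiator_sub_Ttensor hB he hμ hreg heq hsub hsm hinv hmom hf hg hk m
  linear_combination h0 + 2 * hJ

end Structures

end QuasiPoisson

end

open QuasiPoisson

theorem theorem7p1
    {𝔤 : Type*} [NormedAddCommGroup 𝔤] [NormedSpace ℝ 𝔤] [FiniteDimensional ℝ 𝔤]
    {G : Type*} [TopologicalSpace G] [ChartedSpace 𝔤 G] [Group G] [LieGroup 𝓘(ℝ, 𝔤) ∞ G]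
    [CompactSpace G] [T2Space G]
    {V : Type*} [NormedAddCommGroup V] [NormedSpace ℝ V] [FiniteDimensional ℝ V]
    {M : Type*} [TopologicalSpace M] [ChartedSpace V M] [IsManifold 𝓘(ℝ, V) ∞ M]
    [T2Space M] [SecondCountableTopology M]
    [MulAction G M] [ContMDiffSMul 𝓘(ℝ, 𝔤) 𝓘(ℝ, V) ∞ G M]
    (B : LinearMap.BilinForm ℝ 𝔤) (hB : IsInvariantInnerProduct G B)
    {ι : Type*} [Fintype ι] [DecidableEq ι] (e : Module.Basis ι ℝ 𝔤)
    (he : ∀ a b, B (e a) (e b) = if a = b then 1 else 0) :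
    -- exponentials of Hamiltonian Poisson manifolds
    (∀ (P₀ : MultivectorField V M 2) (Φ₀ : M → 𝔤),
      IsHamiltonianPoisson G B P₀ Φ₀ → (∀ m, Φ₀ m ∈ expRegular G) →
      IsHamiltonianQuasiPoisson G B e
        (P₀ - genMulti G (fun m => Ttensor G B e (Φ₀ m))) (fun m => lieExp G (Φ₀ m))) ∧
    -- logarithms of Hamiltonian quasi-Poisson manifolds
    (∀ (P : MultivectorField V M 2) (Φ : M → G) (U : Set G) (log : G → 𝔤),
      IsHamiltonianQuasiPoisson G B e P Φ →
      IsOpen U → (∀ m, Φ m ∈ U) →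
      ContMDiffOn 𝓘(ℝ, 𝔤) 𝓘(ℝ, 𝔤) ∞ log U → (∀ u ∈ U, lieExp G (log u) = u) →
      (ConnectedSpace G ∨
        ∀ g : G, ∀ u ∈ U, g * u * g⁻¹ ∈ U → log (g * u * g⁻¹) = Ad g (log u)) →
      IsHamiltonianPoisson G B
        (P + genMulti G (fun m => Ttensor G B e (log (Φ m)))) (fun m => log (Φ m))) := by
  exact ⟨fun P₀ Φ₀ h hreg => h.exponential hB he hreg,
    fun P Φ U log h hU hΦU hlog hexp hor => h.logarithm hB he hU hΦU hlog hexp hor⟩
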